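/- Let $X$ be a compact complex manifold with complex structure $J$ and a Kähler metric $g$, with Kähler form $\omega=g(J\cdot,\cdot)$. Let $T^{\mathbb C}=(\mathbb C^*)^r$ act holomorphically on $X$ such that the compact torus $T=(S^1)^r\subset T^{\mathbb C}$, with Lie algebra $\mathfrak t$, acts by isometries of $g$. For $u\in\mathfrak t$ denote by $\xi_u$ the vector field on $X$ with $\xi_u(x)=\frac{d}{ds}\big|_{s=0}\exp(su)x$. Let $\mu:X\to\mathfrak t^*$ be a smooth $T$-invariant moment map: the Hamiltonians $H_u=\langle\mu,u\rangle$ satisfy $dH_u=\omega(\xi_u,\cdot)$, so that $H_u$ does not decrease along the flow of $J\xi_u$ (the additive normalisation of $\mu$ is arbitrary, for example $\int_X H_u\,\omega^n=0$). Let $\Delta f=-\sum_{j,k} g^{j\bar k}\,\partial^2 f/\partial z_j\partial\bar z_k$ be the Kähler Laplacian, and let $\Delta\mu$ be given by $\langle\Delta\mu,u\rangle=\Delta H_u$. Let $A_\epsilon$, $B_\epsilon$ be real functions of $\epsilon>0$ with $A_\epsilon>0$ for small $\epsilon$ and $B_\epsilon=o(A_\epsilon)$ as $\epsilon\to0$,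 and let $\langle\cdot,\cdot\rangle_\epsilon$ be any family of inner products on $\mathfrak t$. Use $\langle\cdot,\cdot\rangle_\epsilon$ to identify $\mathfrak t^*$ with $\mathfrak t$, so that $\mu$ and $\Delta\mu$ take values in $\mathfrak t$. For $x\in X$ let $\mathfrak t_x\subset\mathfrak t$ be the Lie algebra of the stabiliser of $x$ in $T$. Fix $p\in X$ and let $\mathfrak t_\epsilon^\perp$ be the orthogonal complement of $\mathfrak t_p$ in $\mathfrak t$ with respect to $\langle\cdot,\cdot\rangle_\epsilon$; it need not be the Lie algebra of a closed subgroup of $T$. Then for all sufficiently small $\epsilon>0$ the following are equivalent: 1. there is a point $p_\epsilon\in T^{\mathbb C}.p$ with $A_\epsilon\,\mu(p_\epsilon)+B_\epsilon\,\Delta\mu(p_\epsilon)\in\mathfrak t_{p_\epsilon}$; 2. for every nonzero $u\in\mathfrak t_\epsilon^\perp$ the specialisation $q_u=\lim_{s\to\infty}\exp(sJu)\,p$ of $p$ under the flow of $Ju$ exists and satisfies $A_\epsilon H_u(q_u)+B_\epsilon\,\Delta H_u(q_u)>0$. -/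

import Mathlib

open Set Filter Topology Asymptotics
open scoped Manifold ContDiff

namespace KempfNess

noncomputable section

/-! ### Kähler metrics on complex manifolds

A complex manifold is a space `X` with an atlas of charts in a finite-dimensional complex vector
space `E` and holomorphic (complex analytic) transition maps, `IsManifold 𝓘(ℂ, E) ω X`.
Its tangent spaces are copies of `E`, the complex structure `J` being multiplication by `I`. -/

/-- A complex manifold is a smooth real manifold. -/
instance isManifoldReal {E X : Type*} [NormedAddCommGroup E] [NormedSpace ℂ E]
    [TopologicalSpace X] [ChartedSpace E X] [IsManifold 𝓘(ℂ, E) ω X] :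
    IsManifold 𝓘(ℝ, E) ∞ X := by
  apply isManifold_of_contDiffOn
  intro e e' he he'
  have h := (contDiffGroupoid ω 𝓘(ℂ, E)).compatible he he'
  have h1 := (contDiffGroupoid_le (m := ∞) le_top) h
  have h2 : ContDiffOn ℂ ∞ (𝓘(ℂ, E) ∘ e.symm ≫ₕ e' ∘ 𝓘(ℂ, E).symm)
      (𝓘(ℂ, E).symm ⁻¹' (e.symm ≫ₕ e').source ∩ range 𝓘(ℂ, E)) := h1.1
  exact h2.restrict_scalars ℝ

/-- The complex structure on the tangent space of a complex manifold at `x`. -/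
def cplxStr {E X : Type*} [NormedAddCommGroup E] [NormedSpace ℂ E]
    [TopologicalSpace X] [ChartedSpace E X] (x : X) :
    TangentSpace 𝓘(ℝ, E) x → TangentSpace 𝓘(ℝ, E) x :=
  fun v : E => Complex.I • v

/-- The exterior derivative at `y`, evaluated on the constant vector fields `a`, `b`, `c`, of a
two-form `η` given near `y` in the vector space `E`. -/
def extDerivTwo {E : Type*} [NormedAddCommGroup E] [NormedSpace ℝ E]
    (η : E → E → E → ℝ) (y a b c : E) : ℝ :=
  fderiv ℝ (fun z => η z b c) y a + fderiv ℝ (fun z => η z c a) y b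
    + fderiv ℝ (fun z => η z a b) y c

/-- A Kähler metric on a complex manifold: a smooth Riemannian metric `g` for which `J` is an
isometry and whose fundamental form `ω(v, w) = g(J v, w)` is closed, `dω = 0`, which is expressed
through the pull-back of `ω` under the inverse of each chart. -/
structure KahlerMetric (E X : Type*) [NormedAddCommGroup E] [NormedSpace ℂ E]
    [TopologicalSpace X] [ChartedSpace E X] [IsManifold 𝓘(ℂ, E) ω X] extends
    Bundle.ContMDiffRiemannianMetric 𝓘(ℝ, E) ∞ E (fun x : X => TangentSpace 𝓘(ℝ, E) x) where
  hermitian : ∀ (x : X) (v w : TangentSpace 𝓘(ℝ, E) x),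
    inner x (cplxStr x v) (cplxStr x w) = inner x v w
  closed : ∀ e ∈ atlas E X, ∀ y ∈ e.target, ∀ a b c : E,
    extDerivTwo (fun z v w => inner (e.symm z)
      (cplxStr (e.symm z) (mfderiv 𝓘(ℝ, E) 𝓘(ℝ, E) e.symm z v))
      (mfderiv 𝓘(ℝ, E) 𝓘(ℝ, E) e.symm z w)) y a b c = 0

/-- The Kähler form `ω(v, w) = g(J v, w)`. -/
def KahlerMetric.form {E X : Type*} [NormedAddCommGroup E] [NormedSpace ℂ E]
    [TopologicalSpace X] [ChartedSpace E X] [IsManifold 𝓘(ℂ, E) ω X]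
    (g : KahlerMetric E X) (x : X) (v w : TangentSpace 𝓘(ℝ, E) x) : ℝ :=
  g.inner x (cplxStr x v) w

/-- The `(1,1)`-part of a real symmetric bilinear form `Q` on `E` in the linear coordinates
`z_j = x_j + i y_j` of a complex basis `e_j`: the entries are
`Q(∂/∂z_j, ∂/∂z̄_k)`, where `∂/∂z_j = (e_j - i J e_j) / 2`, `∂/∂z̄_k = (e_k + i J e_k) / 2` and `Q` is
extended complex bilinearly. -/
def hermMatrix {E : Type*} [NormedAddCommGroup E] [NormedSpace ℂ E] {m : ℕ}
    (e : Module.Basis (Fin m) ℂ E) (Q : E → E → ℝ) : Matrix (Fin m) (Fin m) ℂ :=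
  Matrix.of fun j k =>
    ((Q (e j) (e k) + Q (Complex.I • e j) (Complex.I • e k) : ℝ)
      + Complex.I * (Q (e j) (Complex.I • e k) - Q (Complex.I • e j) (e k) : ℝ)) / 4

/-- The Laplacian `Δf = - ∑ g^{j k̄} ∂²f/∂z_j∂z̄_k` of a Kähler metric on real functions,
computed in the holomorphic coordinates of the chart at `x`. It is
nonnegative and half of the Laplace–de Rham operator, and with this sign and factor `ΔH` is
a Hamiltonian with respect to the Ricci form whenever `H` is the Hamiltonian, with respect to the
Kähler form, of a Killing field. -/
def KahlerMetric.laplacian {E X : Type*} [NormedAddCommGroup E] [NormedSpace ℂ E]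
    [FiniteDimensional ℂ E]
    [TopologicalSpace X] [ChartedSpace E X] [IsManifold 𝓘(ℂ, E) ω X]
    (g : KahlerMetric E X) (f : X → ℝ) (x : X) : ℝ :=
  let F : E → ℝ := fun z => f ((chartAt E x).symm z)
  let e := Module.finBasis ℂ E;
  -((hermMatrix e fun v w => g.inner x v w)⁻¹
    * hermMatrix e fun v w => fderiv ℝ (fderiv ℝ F) (chartAt E x x) v w).trace.re

/-! ### Torus actions

`T^ℂ = (ℂˣ)^r` is the complex torus with Lie algebra `𝔱^ℂ = ℂ^r`, and `T` is its maximal compact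
subgroup, the unit torus, with Lie algebra `𝔱`, which is identified with `ℝ^r` by `lieIncl`. -/

/-- The exponential map of `T^ℂ`. It is a surjective local biholomorphism. -/
def expT {r : ℕ} (z : Fin r → ℂ) : Fin r → ℂˣ :=
  fun j => Units.mk0 (Complex.exp (z j)) (Complex.exp_ne_zero (z j))

/-- The inclusion `𝔱 = ℝ^r → 𝔱^ℂ = ℂ^r`, `u ↦ i u`; so `expT (lieIncl u)` runs through `T`. -/
def lieIncl {r : ℕ} (u : Fin r → ℝ) : Fin r → ℂ := fun j => Complex.I * (u j : ℂ)

/-- The action of `T^ℂ` on `X` is holomorphic, as a map `T^ℂ × X → X`; it is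
read on the universal cover `ℂ^r` of `T^ℂ`. -/
def IsHolomorphicAction (r : ℕ) (E X : Type*) [NormedAddCommGroup E] [NormedSpace ℂ E]
    [TopologicalSpace X] [ChartedSpace E X] [MulAction (Fin r → ℂˣ) X] : Prop :=
  ContMDiff (𝓘(ℂ, Fin r → ℂ).prod 𝓘(ℂ, E)) 𝓘(ℂ, E) ω
    (fun q : (Fin r → ℂ) × X => expT q.1 • q.2)

/-- The compact torus `T` acts by isometries of the Kähler metric `g`. -/
def KahlerMetric.IsInvariant {E X : Type*} [NormedAddCommGroup E] [NormedSpace ℂ E]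
    [TopologicalSpace X] [ChartedSpace E X] [IsManifold 𝓘(ℂ, E) ω X]
    (g : KahlerMetric E X) (r : ℕ) [MulAction (Fin r → ℂˣ) X] : Prop :=
  ∀ (u : Fin r → ℝ) (x : X) (v w : TangentSpace 𝓘(ℝ, E) x),
    g.inner (expT (lieIncl u) • x)
      (mfderiv 𝓘(ℝ, E) 𝓘(ℝ, E) (fun y : X => expT (lieIncl u) • y) x v)
      (mfderiv 𝓘(ℝ, E) 𝓘(ℝ, E) (fun y : X => expT (lieIncl u) • y) x w) = g.inner x v w

/-- The vector field on `X` that `u ∈ 𝔱` induces, i.e. the velocity at `s = 0` of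
`s ↦ exp(s u) x`. -/
def vectorField {r : ℕ} (E : Type*) {X : Type*} [NormedAddCommGroup E] [NormedSpace ℂ E]
    [TopologicalSpace X] [ChartedSpace E X] [MulAction (Fin r → ℂˣ) X]
    (u : Fin r → ℝ) (x : X) : TangentSpace 𝓘(ℝ, E) x :=
  (mfderiv 𝓘(ℝ, ℝ) 𝓘(ℝ, E) (fun s : ℝ => expT (s • lieIncl u) • x) 0 (1 : ℝ) : E)

/-- `μ : X → 𝔱*` is a moment map for the action of `T` with respect to the Kähler form of `g`:
it is smooth, `T`-invariant, and the Hamiltonian `H_u = ⟨μ, u⟩` satisfies `dH_u = ω(u, ·)`. -/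
structure IsMomentMap {r : ℕ} {E X : Type*} [NormedAddCommGroup E] [NormedSpace ℂ E]
    [TopologicalSpace X] [ChartedSpace E X] [IsManifold 𝓘(ℂ, E) ω X]
    [MulAction (Fin r → ℂˣ) X] (g : KahlerMetric E X)
    (μ : X → Module.Dual ℝ (Fin r → ℝ)) : Prop where
  smooth : ∀ u : Fin r → ℝ, ContMDiff 𝓘(ℝ, E) 𝓘(ℝ, ℝ) ∞ (fun x => μ x u)
  invariant : ∀ (u : Fin r → ℝ) (x : X), μ (expT (lieIncl u) • x) = μ x
  hamiltonian : ∀ (u : Fin r → ℝ) (x : X) (v : TangentSpace 𝓘(ℝ, E) x),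
    (mfderiv 𝓘(ℝ, E) 𝓘(ℝ, ℝ) (fun y => μ y u) x v : ℝ) = g.form x (vectorField E u x) v

/-- The Lie algebra `𝔱_x ⊆ 𝔱` of the stabiliser of `x` in `T`. -/
def stabLie (r : ℕ) {X : Type*} [MulAction (Fin r → ℂˣ) X] (x : X) : Set (Fin r → ℝ) :=
  {u | ∀ s : ℝ, expT (s • lieIncl u) • x = x}

/-- `q` is the specialisation of `p` under the flow of `Ju`, i.e. the limit of `exp(s J u) p` as
`s → ∞`. Here `J` acts on `𝔱^ℂ` as multiplication by `i`. -/
def IsSpecialisation {r : ℕ} {X : Type*} [TopologicalSpace X] [MulAction (Fin r → ℂˣ) X]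
    (u : Fin r → ℝ) (p q : X) : Prop :=
  Tendsto (fun s : ℝ => expT (s • (Complex.I • lieIncl u)) • p) atTop (𝓝 q)

/-- The orthogonal complement of a set with respect to an inner product. -/
def orthCompl {V : Type*} [AddCommGroup V] [Module ℝ V] (ip : InnerProductSpace.Core ℝ V)
    (S : Set V) : Set V :=
  {u | ∀ v ∈ S, ip.inner v u = 0}

/-- The vector `m` represents the function `ℓ` on `V` with respect to an inner product: `m` is the
image of `ℓ` under the identification `V* ≅ V`. -/
def Represents {V : Type*} [AddCommGroup V] [Module ℝ V] (ip : InnerProductSpace.Core ℝ V)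
    (m : V) (ℓ : V → ℝ) : Prop :=
  ∀ v, ip.inner m v = ℓ v

end

end KempfNess

/-! This is a Kempf–Ness argument. Since `T^ℂ` is commutative, the stabiliser algebra is constant on
the orbit, and a vector lies in it exactly when it is orthogonal to its orthogonal complement
(`exists_represents_iff`). So condition 1 asks for a point of the orbit at which `⟨Aμ + BΔμ, u⟩`
vanishes for all `u` in that complement.

Along the orbit, `v ↦ Aμ + BΔμ` at `exp(Jv)p` is the differential of a function `f` on `𝔱`
(`exists_potential`). For small `ε` this `f` is convex, and strictly so transversally to the
stabiliser. A strictly convex function has a critical point exactly when its slope at infinity is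
positive along every ray (`exists_critical_point` for existence), and the slope at infinity in
direction `u` is the value of `AH_u + BΔH_u` at the specialisation `q_u`.

Convexity rests on a bound for the Laplacian term that is uniform on `X`. Let `logVol` be the
logarithm of the volume density of the metric pulled back by the action. Its derivative in the
direction `u` is `2ΔH_u` (`fderiv_logVol_eq_laplacian`, from the Kähler identity
`hessian_add_hessian_I`). Its second derivative is the complex Hessian of `log det g` in a chart
(`fderiv_fderiv_logVol`), that is, the Ricci form up to sign and factor. Compactness bounds it by `K
|ξ_u|²` (`exists_bound`), while `H_u` itself grows at rate `|ξ_u|²` along its gradient flow. As `B =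
o(A)`, eventually `|B| K ≤ A`, and the first term dominates.

The specialisation exists because the gradient flow of `H_u` converges
(`IsMomentMap.exists_isSpecialisation`). A flow line extends to a holomorphic map of complex time.
If it travelled from one fixed point to another inside a chart, this map on a strip would be close
to two different constants on the two boundary lines, which `norm_sub_le_of_strip` excludes. -/

namespace KempfNess

noncomputable section

/-! ### Hermitian matrices of `J`-invariant forms -/

section HermitianForms

variable {E : Type*} [NormedAddCommGroup E] [NormedSpace ℂ E] {m : ℕ}

/-- The sesquilinear form `h(a, b) = Q(a, b) + i Q(a, i b)` of a `J`-invariant real bilinear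
form `Q`. -/
def sesqForm (Q : E →L[ℝ] E →L[ℝ] ℝ)
    (hQ : ∀ a b, Q (Complex.I • a) (Complex.I • b) = Q a b) :
    E →ₗ[ℂ] E →ₛₗ[starRingEnd ℂ] ℂ :=
  have key : ∀ a b, Q (Complex.I • a) b = - Q a (Complex.I • b) := fun a b => by
    have h := hQ a (Complex.I • b)
    rw [smul_smul, Complex.I_mul_I, neg_one_smul, map_neg] at h
    linarith
  have key2 : ∀ (c : ℂ) (a : E), c • a = c.re • a + c.im • (Complex.I • a) := fun c a => by
    conv_lhs => rw [← Complex.re_add_im c]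
    rw [add_smul, mul_smul, Complex.coe_smul, Complex.coe_smul]
  LinearMap.mk₂'ₛₗ (RingHom.id ℂ) (starRingEnd ℂ)
    (fun a b => (Q a b : ℂ) + Complex.I * (Q a (Complex.I • b) : ℂ))
    (fun a a' b => by simp; ring)
    (fun c a b => by
      have h3 : Q (Complex.I • a) (Complex.I • b) = Q a b := hQ a b
      have h4 := key a b
      rw [key2 c a]
      simp only [map_add, map_smul, add_apply, smul_apply,
        h3, h4, smul_eq_mul, RingHom.id_apply]
      apply Complex.ext <;> simp <;> ring)
    (fun a b b' => by simp [smul_add]; ring)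
    (fun c a b => by
      have h3 : Complex.I • c • b = c.re • (Complex.I • b) - c.im • b := by
        rw [key2 c b, smul_add, smul_comm Complex.I c.re b, smul_comm Complex.I c.im,
          smul_smul Complex.I Complex.I, Complex.I_mul_I, neg_one_smul, smul_neg, sub_eq_add_neg]
      rw [h3, key2 c b]
      simp only [map_add, map_sub, map_smul, smul_eq_mul]
      apply Complex.ext <;> simp <;> ring)

lemma sesqForm_apply (Q : E →L[ℝ] E →L[ℝ] ℝ)
    (hQ : ∀ a b, Q (Complex.I • a) (Complex.I • b) = Q a b) (a b : E) :
    sesqForm Q hQ a b = (Q a b : ℂ) + Complex.I * (Q a (Complex.I • b) : ℂ) := rfl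

/-- Invariance merges the four real terms in pairs. As a Gram matrix of a sesquilinear form, the
coordinate expression can be transformed under complex linear maps. -/
lemma hermMatrix_eq_sesqForm (e : Module.Basis (Fin m) ℂ E) (Q : E →L[ℝ] E →L[ℝ] ℝ)
    (hQ : ∀ a b, Q (Complex.I • a) (Complex.I • b) = Q a b) (j k : Fin m) :
    hermMatrix e (fun a b => Q a b) j k = sesqForm Q hQ (e j) (e k) / 2 := by
  have h := hQ (e j) (Complex.I • e k)
  rw [smul_smul, Complex.I_mul_I, neg_one_smul, map_neg] at h
  have h' : Q (Complex.I • e j) (e k) = - Q (e j) (Complex.I • e k) := by linarith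
  rw [sesqForm_apply, hermMatrix, Matrix.of_apply, hQ, h']
  push_cast
  ring

lemma hermMatrix_comp (e : Module.Basis (Fin m) ℂ E) (Q : E →L[ℝ] E →L[ℝ] ℝ)
    (hQ : ∀ a b, Q (Complex.I • a) (Complex.I • b) = Q a b) (A : E →L[ℂ] E) :
    hermMatrix e (fun a b => Q (A a) (A b)) =
      (LinearMap.toMatrix e e A.toLinearMap).transpose * hermMatrix e (fun a b => Q a b)
        * (LinearMap.toMatrix e e A.toLinearMap).map (starRingEnd ℂ) := by
  have hA : ∀ j, A (e j) = ∑ l, (LinearMap.toMatrix e e A.toLinearMap) l j • e l := fun j => by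
    have := e.sum_repr (A (e j))
    rw [← this]
    simp [LinearMap.toMatrix_apply]
  let Q' : E →L[ℝ] E →L[ℝ] ℝ :=
    Q.bilinearComp (A.restrictScalars ℝ) (A.restrictScalars ℝ)
  have hQ' : ∀ a b, Q' (Complex.I • a) (Complex.I • b) = Q' a b := fun a b => by
    simp [Q', hQ]
  ext j k
  have h1 : hermMatrix e (fun a b => Q (A a) (A b)) j k = sesqForm Q hQ (A (e j)) (A (e k)) / 2 := by
    have := hermMatrix_eq_sesqForm e Q' hQ' j k
    rw [sesqForm_apply] at this
    rw [sesqForm_apply]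
    simpa [Q'] using this
  rw [h1, hA j, hA k]
  simp only [Matrix.mul_apply, Matrix.transpose_apply, Matrix.map_apply, map_sum, map_smul,
    LinearMap.sum_apply, LinearMap.smul_apply, LinearMap.map_smulₛₗ,
    hermMatrix_eq_sesqForm e Q hQ, Finset.sum_div, Finset.sum_mul, smul_eq_mul, Finset.mul_sum]
  refine Finset.sum_congr rfl fun i _ => Finset.sum_congr rfl fun l _ => ?_
  ring

/-- The transformation law of the volume density. The factor is the squared modulus of a determinant
that will depend holomorphically on parameters, so its logarithm will be harmonic along holomorphic
curves. -/
lemma norm_det_hermMatrix_comp (e : Module.Basis (Fin m) ℂ E) (Q : E →L[ℝ] E →L[ℝ] ℝ)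
    (hQ : ∀ a b, Q (Complex.I • a) (Complex.I • b) = Q a b) (A : E →L[ℂ] E) :
    ‖(hermMatrix e (fun a b => Q (A a) (A b))).det‖ =
      ‖LinearMap.det A.toLinearMap‖ ^ 2 * ‖(hermMatrix e (fun a b => Q a b)).det‖ := by
  rw [hermMatrix_comp e Q hQ A, Matrix.det_mul, Matrix.det_mul, Matrix.det_transpose,
    LinearMap.det_toMatrix]
  have : ((LinearMap.toMatrix e e A.toLinearMap).map (starRingEnd ℂ)).det
      = starRingEnd ℂ (LinearMap.det A.toLinearMap) := by
    rw [← LinearMap.det_toMatrix e, RingHom.map_det]; rfl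
  rw [this, norm_mul, norm_mul, Complex.norm_conj]
  ring

/-- A kernel vector gives `v` with `h(v, ·) = 0`, and the real part of `h(v, v)` is `Q(v, v)`. -/
lemma det_hermMatrix_ne_zero (e : Module.Basis (Fin m) ℂ E) (Q : E →L[ℝ] E →L[ℝ] ℝ)
    (hQ : ∀ a b, Q (Complex.I • a) (Complex.I • b) = Q a b) (hpos : ∀ a, a ≠ 0 → 0 < Q a a) :
    (hermMatrix e (fun a b => Q a b)).det ≠ 0 := by
  intro h0
  obtain ⟨c, hc, h⟩ := Matrix.exists_vecMul_eq_zero_iff.mpr h0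
  have hk : ∀ k, sesqForm Q hQ (∑ j, c j • e j) (e k) = 0 := fun k => by
    have := congrFun h k
    simp only [Matrix.vecMul, dotProduct, hermMatrix_eq_sesqForm e Q hQ, Pi.zero_apply] at this
    simp only [map_sum, map_smul, LinearMap.sum_apply, LinearMap.smul_apply, smul_eq_mul]
    have h2 : (∑ i, c i * sesqForm Q hQ (e i) (e k)) / 2 = 0 := by
      rw [← this, Finset.sum_div]
      exact Finset.sum_congr rfl fun i _ => by ring
    simpa using h2
  have hb : sesqForm Q hQ (∑ j, c j • e j) = 0 := by
    refine e.ext fun k => ?_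
    simpa using hk k
  have ha : (∑ j, c j • e j) = 0 := by
    by_contra hne
    have h1 := congrArg (fun f => (f (∑ j, c j • e j)).re) hb
    simp only [sesqForm_apply, LinearMap.zero_apply, Complex.zero_re] at h1
    have h2 := hpos _ hne
    simp at h1
    simp at h2
    linarith
  apply hc
  funext j
  exact (Fintype.linearIndependent_iff.mp e.linearIndependent) c ha j

end HermitianForms

/-! ### Derivatives of determinants and of `log |·|` -/

section DetDerivative

variable {m : ℕ}

/-- Jacobi's formula. Only the tangent vector matters, so the curve may be replaced by the line `G t
+ s G'`, on which the determinant is `det (G t)` times `det (1 + s (G t)⁻¹ G')`, a polynomial in `s`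
whose linear coefficient is the trace. -/
lemma hasDerivAt_det {G : ℝ → Matrix (Fin m) (Fin m) ℂ} {G' : Matrix (Fin m) (Fin m) ℂ} {t : ℝ}
    (hG : ∀ j k, HasDerivAt (fun s => G s j k) (G' j k) t) (h0 : (G t).det ≠ 0) :
    HasDerivAt (fun s => (G s).det) ((G t).det * ((G t)⁻¹ * G').trace) t := by
  let d : (Fin m → Fin m → ℂ) → ℂ := fun A => (Matrix.of A).det
  have hd : Differentiable ℝ d := by
    have : d = fun A => ∑ σ : Equiv.Perm (Fin m),
        (Equiv.Perm.sign σ : ℤ) • ∏ i, A (σ i) i := by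
      funext A
      simp [d, Matrix.det_apply, Units.smul_def]
    rw [this]
    fun_prop
  have hGd : HasDerivAt (fun s => (fun j k => G s j k : Fin m → Fin m → ℂ)) (fun j k => G' j k) t :=
    hasDerivAt_pi.mpr fun j => hasDerivAt_pi.mpr fun k => hG j k
  have h1 : HasDerivAt (fun s => (G s).det)
      (fderiv ℝ d (fun j k => G t j k) (fun j k => G' j k)) t :=
    ((hd (fun j k => G t j k)).hasFDerivAt).comp_hasDerivAt t hGd
  have hline : HasDerivAt (fun s : ℝ => (fun j k => G t j k + (s : ℂ) * G' j k : Fin m → Fin m → ℂ))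
      (fun j k => G' j k) 0 := by
    refine hasDerivAt_pi.mpr fun j => hasDerivAt_pi.mpr fun k => ?_
    have := ((Complex.ofRealCLM.hasDerivAt (x := (0 : ℝ))).mul_const (G' j k)).const_add (G t j k)
    simpa using this
  have h2 : HasDerivAt (fun s : ℝ => (G t + (s : ℂ) • G').det)
      (fderiv ℝ d (fun j k => G t j k) (fun j k => G' j k)) 0 := by
    have h3 : HasFDerivAt d (fderiv ℝ d (fun j k => G t j k))
        (fun j k => G t j k + ((0 : ℝ) : ℂ) * G' j k) := by
      simpa using (hd (fun j k => G t j k)).hasFDerivAt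
    exact h3.comp_hasDerivAt (0 : ℝ) hline
  have h3 : HasDerivAt (fun s : ℝ => (G t + (s : ℂ) • G').det)
      ((G t).det * ((G t)⁻¹ * G').trace) 0 := by
    have hu : IsUnit (G t).det := isUnit_iff_ne_zero.mpr h0
    have hfac : ∀ s : ℝ, (G t + (s : ℂ) • G').det
        = (G t).det * (1 + (s : ℂ) • ((G t)⁻¹ * G')).det := fun s => by
      rw [← Matrix.det_mul, mul_add, mul_one, Matrix.mul_smul, ← mul_assoc,
        Matrix.mul_nonsing_inv _ hu, one_mul]
    simp_rw [hfac]
    refine HasDerivAt.const_mul _ ?_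
    rw [funext fun s : ℝ => Matrix.det_one_add_smul (s : ℂ) ((G t)⁻¹ * G')]
    set P := (Matrix.det (1 + (Polynomial.X : Polynomial ℂ) •
      ((G t)⁻¹ * G').map Polynomial.C)).divX.divX
    have hid : HasDerivAt (fun s : ℝ => (s : ℂ)) 1 0 := Complex.ofRealCLM.hasDerivAt
    have hP := (P.hasDerivAt ((0 : ℝ) : ℂ)).comp_ofReal
    have := ((hid.const_mul ((G t)⁻¹ * G').trace).const_add 1).add (hP.mul (hid.pow 2))
    refine (this.congr_deriv ?_).congr_of_eventuallyEq (.of_eq ?_)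
    · simp
    · rfl
  rw [← h2.unique h3]
  exact h1

lemma HasDerivAt.log_norm_complex {f : ℝ → ℂ} {f' : ℂ} {t : ℝ} (hf : HasDerivAt f f' t)
    (h0 : f t ≠ 0) : HasDerivAt (fun s => Real.log ‖f s‖) (f' / f t).re t := by
  -- Dividing by `f t` moves the value to `1`, where the principal logarithm is differentiable.
  have hk : HasDerivAt (fun s => f s / f t) (f' / f t) t := hf.div_const (f t)
  have hm : f t / f t ∈ Complex.slitPlane := by simp [h0]
  have h1 := hk.clog_real hm
  have h2 : HasDerivAt (fun s => (Complex.log (f s / f t)).re + Real.log ‖f t‖) (f' / f t).re t := by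
    have := (Complex.reCLM.hasFDerivAt.comp_hasDerivAt t h1).add_const (Real.log ‖f t‖)
    simpa [h0] using this
  refine h2.congr_of_eventuallyEq ?_
  have hne : ∀ᶠ s in 𝓝 t, f s ≠ 0 := hf.continuousAt.eventually_ne h0
  filter_upwards [hne] with s hs
  rw [Complex.log_re, norm_div, Real.log_div (norm_ne_zero_iff.mpr hs) (norm_ne_zero_iff.mpr h0)]
  ring

lemma hasDerivAt_log_norm_det {G : ℝ → Matrix (Fin m) (Fin m) ℂ} {G' : Matrix (Fin m) (Fin m) ℂ}
    {t : ℝ} (hG : ∀ j k, HasDerivAt (fun s => G s j k) (G' j k) t) (h0 : (G t).det ≠ 0) :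
    HasDerivAt (fun s => Real.log ‖(G s).det‖) ((G t)⁻¹ * G').trace.re t := by
  have := HasDerivAt.log_norm_complex (hasDerivAt_det hG h0) h0
  rwa [mul_div_cancel_left₀ _ h0] at this

end DetDerivative

/-- The complex Hessian of a function composed with a holomorphic curve involves only the first
derivative of the curve. -/
lemma fderiv_fderiv_comp_holomorphic {V : Type*} [NormedAddCommGroup V] [NormedSpace ℂ V]
    [CompleteSpace V] {F : V → ℝ} {γ : ℂ → V} {τ : ℂ} (hF : ContDiffAt ℝ 2 F (γ τ))
    (hγ : AnalyticAt ℂ γ τ) :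
    fderiv ℝ (fderiv ℝ (fun t => F (γ t))) τ 1 1
        + fderiv ℝ (fderiv ℝ (fun t => F (γ t))) τ Complex.I Complex.I
      = fderiv ℝ (fderiv ℝ F) (γ τ) (deriv γ τ) (deriv γ τ)
        + fderiv ℝ (fderiv ℝ F) (γ τ) (Complex.I • deriv γ τ) (Complex.I • deriv γ τ) := by
  have hF1 : ∀ᶠ t in 𝓝 τ, DifferentiableAt ℝ F (γ t) := by
    have h1 : ∀ᶠ z in 𝓝 (γ τ), ContDiffAt ℝ 2 F z := hF.eventually (by simp)
    exact (hγ.continuousAt.eventually h1).mono fun t ht => ht.differentiableAt (by simp)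
  have hγ1 : ∀ᶠ t in 𝓝 τ, AnalyticAt ℂ γ t := hγ.eventually_analyticAt
  have hev : ∀ᶠ t in 𝓝 τ, HasFDerivAt (fun t => F (γ t))
      ((fderiv ℝ F (γ t)).comp
        ((ContinuousLinearMap.toSpanSingleton ℂ (deriv γ t)).restrictScalars ℝ)) t := by
    filter_upwards [hF1, hγ1] with t h1 h2
    have h3 : HasFDerivAt γ ((ContinuousLinearMap.toSpanSingleton ℂ (deriv γ t)).restrictScalars ℝ) t :=
      h2.differentiableAt.hasDerivAt.hasFDerivAt.restrictScalars ℝ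
    exact h1.hasFDerivAt.comp t h3
  have hfd : DifferentiableAt ℝ (fderiv ℝ (fun t => F (γ t))) τ := by
    have : ContDiffAt ℝ 2 (fun t => F (γ t)) τ :=
      hF.comp τ ((hγ.contDiffAt (n := 2)).restrict_scalars ℝ)
    exact (this.fderiv_right (m := 1) (by norm_num)).differentiableAt (by simp)
  have hF2 : DifferentiableAt ℝ (fderiv ℝ F) (γ τ) :=
    (hF.fderiv_right (m := 1) (by norm_num)).differentiableAt (by simp)
  have hγ' : HasFDerivAt γ
      ((ContinuousLinearMap.toSpanSingleton ℂ (deriv γ τ)).restrictScalars ℝ) τ :=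
    hγ.differentiableAt.hasDerivAt.hasFDerivAt.restrictScalars ℝ
  have hγ'' : HasFDerivAt (deriv γ)
      ((ContinuousLinearMap.toSpanSingleton ℂ (deriv (deriv γ) τ)).restrictScalars ℝ) τ :=
    hγ.deriv.differentiableAt.hasDerivAt.hasFDerivAt.restrictScalars ℝ
  -- The second derivative of `γ` enters through `v * v`, so its contributions for `v = 1` and `v =
  -- I` cancel.
  have key : ∀ v : ℂ, fderiv ℝ (fderiv ℝ (fun t => F (γ t))) τ v v
      = fderiv ℝ (fderiv ℝ F) (γ τ) (v • deriv γ τ) (v • deriv γ τ)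
        + fderiv ℝ F (γ τ) ((v * v) • deriv (deriv γ) τ) := fun v => by
    have h1 : HasFDerivAt (fun t => fderiv ℝ (fun t => F (γ t)) t v)
        ((fderiv ℝ (fderiv ℝ (fun t => F (γ t))) τ).flip v) τ :=
      (hfd.hasFDerivAt.clm_apply (hasFDerivAt_const v τ)).congr_fderiv (by ext; simp)
    have h2 : (fun t => fderiv ℝ (fun t => F (γ t)) t v)
        =ᶠ[𝓝 τ] fun t => fderiv ℝ F (γ t) (v • deriv γ t) := by
      filter_upwards [hev] with t ht
      rw [ht.fderiv]
      simp
    have h3 := (hF2.hasFDerivAt.comp τ hγ').clm_apply (hγ''.const_smul v)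
    have h4 := (h1.congr_of_eventuallyEq h2.symm).unique h3
    have h5 := congrArg (fun l => l v) h4
    simp only [ContinuousLinearMap.flip_apply] at h5
    rw [h5]
    simp [smul_smul, add_comm]
  rw [key, key, Complex.I_mul_I, one_mul, one_smul, one_smul, neg_one_smul, map_neg]
  ring

/-! ### The exponential map of the torus -/

section ExpT

variable {r : ℕ}

@[simp] lemma expT_zero : expT (0 : Fin r → ℂ) = 1 := by
  funext j; apply Units.ext; simp [expT]

lemma expT_add (ζ ζ' : Fin r → ℂ) : expT (ζ + ζ') = expT ζ * expT ζ' := by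
  funext j; apply Units.ext; simp [expT, Complex.exp_add]

lemma expT_surjective : Function.Surjective (expT : (Fin r → ℂ) → Fin r → ℂˣ) := fun t =>
  ⟨fun j => Complex.log (t j), by
    funext j; apply Units.ext; simp [expT, Complex.exp_log]⟩

/-- The inclusion `ℝ^r → ℂ^r`. -/
def realIncl (u : Fin r → ℝ) : Fin r → ℂ := fun j => (u j : ℂ)

lemma lieIncl_eq (u : Fin r → ℝ) : lieIncl u = Complex.I • realIncl u := rfl

lemma realIncl_add (u w : Fin r → ℝ) : realIncl (u + w) = realIncl u + realIncl w := by
  funext j; simp [realIncl]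

lemma realIncl_smul (c : ℝ) (u : Fin r → ℝ) : realIncl (c • u) = (c : ℂ) • realIncl u := by
  funext j; simp [realIncl]

lemma smul_I_lieIncl (s : ℝ) (u : Fin r → ℝ) :
    s • (Complex.I • lieIncl u) = ((-s : ℝ) : ℂ) • realIncl u := by
  funext j
  simp [lieIncl, realIncl, ← mul_assoc]

/-- Every element of the compact torus has its angles in `[0, 2π]`. -/
lemma exists_expT_lieIncl_eq (u : Fin r → ℝ) :
    ∃ v ∈ Icc (0 : Fin r → ℝ) (fun _ => 2 * Real.pi), expT (lieIncl v) = expT (lieIncl u) := by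
  have hp := Real.two_pi_pos
  refine ⟨fun j => toIcoMod hp 0 (u j), ⟨fun j => ?_, fun j => ?_⟩, ?_⟩
  · exact (toIcoMod_mem_Ico hp 0 (u j)).1
  · have := (toIcoMod_mem_Ico hp 0 (u j)).2
    simp only [zero_add] at this
    exact this.le
  · funext j; apply Units.ext
    simp only [expT, lieIncl, Units.val_mk0, toIcoMod]
    rw [Complex.exp_eq_exp_iff_exists_int]
    exact ⟨-toIcoDiv hp 0 (u j), by push_cast; simp; ring⟩

end ExpT

/-- A complex derivative is a real derivative. -/
lemma hasMFDerivAt_restrictScalars {E E' M M' : Type*} [NormedAddCommGroup E] [NormedSpace ℂ E]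
    [NormedAddCommGroup E'] [NormedSpace ℂ E'] [TopologicalSpace M] [ChartedSpace E M]
    [TopologicalSpace M'] [ChartedSpace E' M'] {f : M → M'} {x : M} {f' : E →L[ℂ] E'}
    (h : HasMFDerivAt 𝓘(ℂ, E) 𝓘(ℂ, E') f x f') :
    HasMFDerivAt 𝓘(ℝ, E) 𝓘(ℝ, E') f x (f'.restrictScalars ℝ) :=
  ⟨h.1, HasFDerivWithinAt.restrictScalars ℝ h.2⟩

/-- A curve in a manifold with vanishing velocity is constant. -/
lemma eq_of_mfderiv_eq_zero {E X : Type*} [NormedAddCommGroup E] [NormedSpace ℝ E]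
    [TopologicalSpace X] [T2Space X] [ChartedSpace E X] [IsManifold 𝓘(ℝ, E) 1 X]
    {c : ℝ → X} (hc : ∀ t, HasMFDerivAt 𝓘(ℝ, ℝ) 𝓘(ℝ, E) c t (0 : ℝ →L[ℝ] E)) (t s : ℝ) :
    c t = c s := by
  have hcont : Continuous c := continuous_iff_continuousAt.mpr fun t => (hc t).1
  have hloc : IsLocallyConstant c := by
    rw [IsLocallyConstant.iff_eventually_eq]
    intro t₀
    let φ := chartAt E (c t₀)
    have hU : c ⁻¹' φ.source ∈ 𝓝 t₀ :=
      hcont.continuousAt.preimage_mem_nhds (chart_source_mem_nhds E (c t₀))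
    obtain ⟨δ, hδ, hball⟩ := Metric.mem_nhds_iff.mp hU
    have hd : ∀ t ∈ Metric.ball t₀ δ, HasDerivAt (φ ∘ c) 0 t := fun t ht => by
      have h1 : MDifferentiableAt 𝓘(ℝ, E) 𝓘(ℝ, E) φ (c t) :=
        mdifferentiableAt_atlas (chart_mem_atlas E (c t₀)) (hball ht)
      have h2 := h1.hasMFDerivAt.comp t (hc t)
      have aux : ∀ (f : ℝ → E) (A : E →L[ℝ] E),
          HasFDerivAt f (A.comp (0 : ℝ →L[ℝ] E)) t → HasDerivAt f 0 t := fun f A h => by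
        simpa using h.hasDerivAt
      exact aux _ _ h2.hasFDerivAt
    filter_upwards [Metric.ball_mem_nhds t₀ hδ] with t ht
    have h1 := (convex_ball t₀ δ).is_const_of_fderivWithin_eq_zero (𝕜 := ℝ) (f := φ ∘ c)
      (fun t ht => (hd t ht).differentiableAt.differentiableWithinAt)
      (fun t ht => by
        rw [fderivWithin_of_isOpen Metric.isOpen_ball ht]
        have := (hd t ht).hasFDerivAt.fderiv
        rw [this]; ext; simp)
      ht (Metric.mem_ball_self hδ)
    exact φ.injOn (hball ht) (mem_chart_source E (c t₀)) h1
  exact hloc.apply_eq_of_isPreconnected isPreconnected_univ (mem_univ t) (mem_univ s)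

/-! ### Infinitesimal action and stabilisers -/

section Action

variable {r : ℕ} {E X : Type*} [NormedAddCommGroup E] [NormedSpace ℂ E]
    [TopologicalSpace X] [ChartedSpace E X] [MulAction (Fin r → ℂˣ) X]

variable (E) in
/-- The infinitesimal action of `ℂ^r` at a point. -/
def infl (x : X) : (Fin r → ℂ) →L[ℂ] E :=
  mfderiv 𝓘(ℂ, Fin r → ℂ) 𝓘(ℂ, E) (fun ζ : Fin r → ℂ => expT ζ • x) 0

variable (E) in
/-- The differential at `x` of the action of `expT ζ`. -/
def tang (ζ : Fin r → ℂ) (x : X) : E →L[ℂ] E :=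
  mfderiv 𝓘(ℂ, E) 𝓘(ℂ, E) (fun y : X => expT ζ • y) x

namespace IsHolomorphicAction

variable (hact : IsHolomorphicAction r E X)
include hact

lemma continuous : Continuous (fun q : (Fin r → ℂ) × X => expT q.1 • q.2) :=
  ContMDiff.continuous hact

lemma contMDiff_orbit (x : X) :
    ContMDiff 𝓘(ℂ, Fin r → ℂ) 𝓘(ℂ, E) ω (fun ζ : Fin r → ℂ => expT ζ • x) :=
  ContMDiff.comp (g := fun q : (Fin r → ℂ) × X => expT q.1 • q.2)
    (f := fun ζ : Fin r → ℂ => (ζ, x)) hact (contMDiff_id.prodMk contMDiff_const)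

lemma contMDiff_smul (ζ : Fin r → ℂ) :
    ContMDiff 𝓘(ℂ, E) 𝓘(ℂ, E) ω (fun x : X => expT ζ • x) :=
  ContMDiff.comp (g := fun q : (Fin r → ℂ) × X => expT q.1 • q.2)
    (f := fun x : X => (ζ, x)) hact (contMDiff_const.prodMk contMDiff_id)

/-- Near `ζ` the orbit map of `x` is the orbit map of `expT ζ • x` near `0`, precomposed with a
translation. -/
lemma hasMFDerivAt_orbit (ζ : Fin r → ℂ) (x : X) :
    HasMFDerivAt 𝓘(ℂ, Fin r → ℂ) 𝓘(ℂ, E) (fun ζ : Fin r → ℂ => expT ζ • x) ζ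
      (infl E (expT ζ • x)) := by
  have h1 : HasMFDerivAt 𝓘(ℂ, Fin r → ℂ) 𝓘(ℂ, E)
      (fun ζ' : Fin r → ℂ => expT ζ' • (expT ζ • x)) (ζ - ζ) (infl E (expT ζ • x)) := by
    rw [sub_self]
    exact ((hact.contMDiff_orbit (expT ζ • x)).mdifferentiable (by simp) 0).hasMFDerivAt
  have h2 : HasMFDerivAt 𝓘(ℂ, Fin r → ℂ) 𝓘(ℂ, Fin r → ℂ) (fun ζ' : Fin r → ℂ => ζ' - ζ) ζ
      (ContinuousLinearMap.id ℂ (Fin r → ℂ)) :=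
    ((hasFDerivAt_id ζ).sub_const ζ).hasMFDerivAt
  have h3 := HasMFDerivAt.comp (g := fun ζ' : Fin r → ℂ => expT ζ' • (expT ζ • x))
    (f := fun ζ' : Fin r → ℂ => ζ' - ζ) ζ h1 h2
  have h4 : (fun ζ' : Fin r → ℂ => expT ζ' • (expT ζ • x)) ∘ (fun ζ' : Fin r → ℂ => ζ' - ζ)
      = fun ζ' => expT ζ' • x := by
    funext ζ'
    simp only [Function.comp_apply, smul_smul, ← expT_add, sub_add_cancel]
  rw [h4] at h3
  exact h3

lemma hasMFDerivAt_smul (ζ : Fin r → ℂ) (x : X) :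
    HasMFDerivAt 𝓘(ℂ, E) 𝓘(ℂ, E) (fun y : X => expT ζ • y) x (tang E ζ x) :=
  ((hact.contMDiff_smul ζ).mdifferentiable (by simp) x).hasMFDerivAt

lemma mfderiv_smul (ζ : Fin r → ℂ) (x : X) :
    mfderiv 𝓘(ℝ, E) 𝓘(ℝ, E) (fun y : X => expT ζ • y) x = (tang E ζ x).restrictScalars ℝ :=
  (hasMFDerivAt_restrictScalars (hact.hasMFDerivAt_smul ζ x)).mfderiv

lemma tang_add (ζ ζ' : Fin r → ℂ) (x : X) :
    tang E (ζ + ζ') x = (tang E ζ (expT ζ' • x)).comp (tang E ζ' x) := by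
  have h := (hact.hasMFDerivAt_smul ζ (expT ζ' • x)).comp x (hact.hasMFDerivAt_smul ζ' x)
  have h4 : (fun y : X => expT ζ • y) ∘ (fun y : X => expT ζ' • y)
      = fun y => expT (ζ + ζ') • y := by
    funext y
    simp [smul_smul, ← expT_add]
  rw [h4] at h
  exact (hact.hasMFDerivAt_smul (ζ + ζ') x).mfderiv.symm.trans h.mfderiv

omit hact in
lemma tang_zero (x : X) : tang E (0 : Fin r → ℂ) x = ContinuousLinearMap.id ℂ E := by
  have h : (fun y : X => expT (0 : Fin r → ℂ) • y) = id := by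
    funext y; simp
  have h2 : HasMFDerivAt 𝓘(ℂ, E) 𝓘(ℂ, E) (fun y : X => expT (0 : Fin r → ℂ) • y) x
      (ContinuousLinearMap.id ℂ E) := by
    rw [h]; exact hasMFDerivAt_id x
  exact h2.mfderiv

lemma det_tang_ne_zero [FiniteDimensional ℂ E] (ζ : Fin r → ℂ) (x : X) :
    LinearMap.det (tang E ζ x).toLinearMap ≠ 0 := by
  intro h
  have h1 := hact.tang_add (-ζ) ζ x
  rw [neg_add_cancel, tang_zero] at h1
  have h2 := congrArg (fun A : E →L[ℂ] E => LinearMap.det A.toLinearMap) h1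
  simp [LinearMap.det_comp, h] at h2

/-- Commutativity of the torus: translation by `expT ζ` carries the orbit map of `x` to that of
`expT ζ • x`, so the fundamental vector fields are invariant. -/
lemma tang_infl (ζ : Fin r → ℂ) (x : X) (v : Fin r → ℂ) :
    tang E ζ x (infl E x v) = infl E (expT ζ • x) v := by
  have h0 : HasMFDerivAt 𝓘(ℂ, Fin r → ℂ) 𝓘(ℂ, E) (fun ζ : Fin r → ℂ => expT ζ • x) 0
      (infl E x) := ((hact.contMDiff_orbit x).mdifferentiable (by simp) 0).hasMFDerivAt
  have h1 : HasMFDerivAt 𝓘(ℂ, E) 𝓘(ℂ, E) (fun y : X => expT ζ • y)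
      (expT (0 : Fin r → ℂ) • x) (tang E ζ x) := by
    rw [expT_zero, one_smul]
    exact hact.hasMFDerivAt_smul ζ x
  have h2 := h1.comp 0 h0
  have h3 : (fun y : X => expT ζ • y) ∘ (fun ζ' : Fin r → ℂ => expT ζ' • x)
      = fun ζ' => expT ζ' • (expT ζ • x) := by
    funext ζ'
    simp [smul_smul, mul_comm]
  rw [h3] at h2
  have h4 : HasMFDerivAt 𝓘(ℂ, Fin r → ℂ) 𝓘(ℂ, E)
      (fun ζ' : Fin r → ℂ => expT ζ' • (expT ζ • x)) 0 (infl E (expT ζ • x)) :=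
    ((hact.contMDiff_orbit (expT ζ • x)).mdifferentiable (by simp) 0).hasMFDerivAt
  have h5 := h4.mfderiv.symm.trans h2.mfderiv
  exact (congrArg (fun A : (Fin r → ℂ) →L[ℂ] E => A v) h5).symm

lemma hasMFDerivAt_orbit_curve (v : Fin r → ℂ) (x : X) (t : ℝ) :
    HasMFDerivAt 𝓘(ℝ, ℝ) 𝓘(ℝ, E) (fun s : ℝ => expT (s • v) • x) t
      (ContinuousLinearMap.toSpanSingleton ℝ (infl E (expT (t • v) • x) v)) := by
  have h1 := hasMFDerivAt_restrictScalars (hact.hasMFDerivAt_orbit (t • v) x)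
  have h2 : HasMFDerivAt 𝓘(ℝ, ℝ) 𝓘(ℝ, Fin r → ℂ) (fun s : ℝ => s • v) t
      (ContinuousLinearMap.toSpanSingleton ℝ v) := by
    have := (hasDerivAt_id t).smul_const v
    rw [one_smul] at this
    exact this.hasFDerivAt.hasMFDerivAt
  refine (h1.comp t h2).congr_mfderiv ?_
  refine ContinuousLinearMap.ext_ring ?_
  change infl E (expT (t • v) • x) ((1 : ℝ) • v) = (1 : ℝ) • infl E (expT (t • v) • x) v
  rw [one_smul, one_smul]

lemma vectorField_eq (u : Fin r → ℝ) (x : X) :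
    vectorField E u x = (infl E x (lieIncl u) : E) := by
  have h4 : (vectorField E u x : E) = (1 : ℝ) • infl E (expT ((0 : ℝ) • lieIncl u) • x) (lieIncl u) :=
    congrArg (fun A : ℝ →L[ℝ] E => A 1) (hact.hasMFDerivAt_orbit_curve (lieIncl u) x 0).mfderiv
  rw [h4, zero_smul, expT_zero, one_smul, one_smul]

lemma infl_eq_zero_of_forall {x : X} {v : Fin r → ℂ}
    (h : ∀ s : ℝ, expT (s • v) • x = x) : infl E x v = 0 := by
  have h3 := hact.hasMFDerivAt_orbit_curve v x 0
  rw [show (fun s : ℝ => expT (s • v) • x) = fun _ => x from funext h] at h3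
  have h5 := h3.mfderiv.symm.trans
    (hasMFDerivAt_const (I := 𝓘(ℝ, ℝ)) (I' := 𝓘(ℝ, E)) x (0 : ℝ)).mfderiv
  have h6 : (1 : ℝ) • infl E (expT ((0 : ℝ) • v) • x) v = 0 :=
    congrArg (fun A : ℝ →L[ℝ] E => A 1) h5
  simpa using h6

variable [T2Space X] [IsManifold 𝓘(ℂ, E) ω X]

/-- By `tang_infl` a velocity that vanishes at `x` vanishes along the whole curve. Complex `c` are
allowed because `infl` is complex linear, so the compact and the noncompact direction of `v` fix `x`
together. -/
lemma expT_smul_eq_of_infl_eq_zero {x : X} {v : Fin r → ℂ} (h : infl E x v = 0) (c : ℂ) :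
    expT (c • v) • x = x := by
  have : IsManifold 𝓘(ℝ, E) 1 X := IsManifold.of_le (n := ∞) (by simp)
  have hc : ∀ t : ℝ, HasMFDerivAt 𝓘(ℝ, ℝ) 𝓘(ℝ, E) (fun t : ℝ => expT (t • (c • v)) • x) t
      (0 : ℝ →L[ℝ] E) := fun t => by
    refine (hact.hasMFDerivAt_orbit_curve (c • v) x t).congr_mfderiv ?_
    rw [← hact.tang_infl, map_smul, h, smul_zero, map_zero]
    exact ContinuousLinearMap.ext_ring (smul_zero (1 : ℝ))
  simpa using eq_of_mfderiv_eq_zero hc 1 0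

/-- Complex linearity of `infl` trades `lieIncl u` for `realIncl u`, the direction in which
gradients point up to sign. -/
lemma mem_stabLie_iff {x : X} {u : Fin r → ℝ} :
    u ∈ stabLie r x ↔ infl E x (realIncl u) = 0 := by
  constructor
  · intro h
    have h1 : infl E x (lieIncl u) = 0 := hact.infl_eq_zero_of_forall h
    rw [lieIncl_eq, map_smul] at h1
    simpa using h1
  · intro h s
    have := hact.expT_smul_eq_of_infl_eq_zero h (s * Complex.I)
    rwa [mul_smul, Complex.coe_smul, ← lieIncl_eq] at this

end IsHolomorphicAction

end Action

/-! ### Tools for convergence: a strip estimate and first exit times -/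

/-- A bounded holomorphic function on a vertical strip that stays close to constants on the two
boundary lines has nearly equal constants there. -/
lemma norm_sub_le_of_strip {E : Type*} [NormedAddCommGroup E] [NormedSpace ℂ E] [CompleteSpace E]
    {G : ℂ → E} {a b η M : ℝ} {z₀ z₁ : E} (hab : a ≤ b)
    (hd : ∀ ζ : ℂ, ζ.re ∈ Icc a b → DifferentiableAt ℂ G ζ)
    (hM : ∀ ζ : ℂ, ζ.re ∈ Icc a b → ‖G ζ - z₀‖ ≤ M)
    (ha : ∀ t : ℝ, ‖G (a + t * Complex.I) - z₀‖ ≤ η)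
    (hb : ∀ t : ℝ, ‖G (b + t * Complex.I) - z₁‖ ≤ η) : ‖z₁ - z₀‖ ≤ 2 * η := by
  -- Cauchy's theorem for `G - z₀` on the rectangle of height `N`: the horizontal sides contribute
  -- at most `M (b - a)` each, while the vertical sides give `N (z₁ - z₀)` up to an error `2 η N`.
  have key : ∀ N : ℝ, 0 < N → N * ‖z₁ - z₀‖ ≤ N * (2 * η) + 2 * (M * (b - a)) := fun N hN => by
    have hc := Complex.integral_boundary_rect_eq_zero_of_differentiableOn (fun ζ => G ζ - z₀)
      (a : ℂ) ((b : ℂ) + N * Complex.I) (fun ζ hζ => by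
        have h1 : ζ.re ∈ Icc a b := by
          have := hζ.1
          simpa [uIcc_of_le hab] using this
        exact ((hd ζ h1).sub_const z₀).differentiableWithinAt)
    simp only [Complex.ofReal_re, Complex.ofReal_im, Complex.add_re, Complex.add_im,
      Complex.mul_re, Complex.mul_im, Complex.I_re, Complex.I_im, mul_zero, mul_one, zero_mul,
      sub_zero, add_zero, zero_add, Complex.ofReal_zero] at hc
    have hcont : ∀ c ∈ Icc a b, Continuous fun t : ℝ => G (c + t * Complex.I) := fun c hc => by
      refine continuous_iff_continuousAt.mpr fun t => ?_
      refine ContinuousAt.comp (g := G) (f := fun t : ℝ => (c : ℂ) + t * Complex.I)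
        (hd _ (by simpa using hc)).continuousAt (by fun_prop)
    have e1 : ‖∫ x in a..b, (G x - z₀)‖ ≤ M * (b - a) := by
      have := intervalIntegral.norm_integral_le_of_norm_le_const (a := a) (b := b) (C := M)
        (f := fun x : ℝ => G x - z₀) (fun x hx => hM _ (by
          rw [uIoc_of_le hab] at hx
          simpa using ⟨hx.1.le, hx.2⟩))
      rwa [abs_of_nonneg (sub_nonneg.mpr hab)] at this
    have e2 : ‖∫ x in a..b, (G (x + N * Complex.I) - z₀)‖ ≤ M * (b - a) := by
      have := intervalIntegral.norm_integral_le_of_norm_le_const (a := a) (b := b) (C := M)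
        (f := fun x : ℝ => G (x + N * Complex.I) - z₀) (fun x hx => hM _ (by
          rw [uIoc_of_le hab] at hx
          simpa using ⟨hx.1.le, hx.2⟩))
      rwa [abs_of_nonneg (sub_nonneg.mpr hab)] at this
    have e3 : ‖∫ t in (0 : ℝ)..N, (G (a + t * Complex.I) - z₀)‖ ≤ η * N := by
      have := intervalIntegral.norm_integral_le_of_norm_le_const (a := 0) (b := N) (C := η)
        (f := fun t : ℝ => G (a + t * Complex.I) - z₀) (fun t _ => ha t)
      rwa [sub_zero, abs_of_pos hN] at this
    have e4 : ‖∫ t in (0 : ℝ)..N, (G (b + t * Complex.I) - z₁)‖ ≤ η * N := by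
      have := intervalIntegral.norm_integral_le_of_norm_le_const (a := 0) (b := N) (C := η)
        (f := fun t : ℝ => G (b + t * Complex.I) - z₁) (fun t _ => hb t)
      rwa [sub_zero, abs_of_pos hN] at this
    have hbc := hcont b (right_mem_Icc.mpr hab)
    have e5 : ∫ t in (0 : ℝ)..N, (G (b + t * Complex.I) - z₀)
        = (∫ t in (0 : ℝ)..N, (G (b + t * Complex.I) - z₁)) + N • (z₁ - z₀) := by
      rw [intervalIntegral.integral_sub (hbc.intervalIntegrable _ _) (by simp),
        intervalIntegral.integral_sub (hbc.intervalIntegrable _ _) (by simp)]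
      simp [smul_sub]
    rw [e5] at hc
    have hc' := congrArg norm (eq_neg_of_add_eq_zero_right (a := Complex.I • (N • (z₁ - z₀)))
      (b := ((∫ x in a..b, (G x - z₀)) - ∫ x in a..b, (G (x + N * Complex.I) - z₀))
        + Complex.I • (∫ t in (0 : ℝ)..N, (G (b + t * Complex.I) - z₁))
        - Complex.I • ∫ t in (0 : ℝ)..N, (G (a + t * Complex.I) - z₀))
      (by rw [← hc, smul_add]; abel))
    rw [norm_neg, norm_smul, norm_smul, Complex.norm_I, one_mul, Real.norm_of_nonneg hN.le] at hc'
    rw [← hc']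
    refine (norm_sub_le _ _).trans ?_
    rw [norm_smul, Complex.norm_I, one_mul]
    have := norm_add_le ((∫ x in a..b, (G x - z₀)) - ∫ x in a..b, (G (x + N * Complex.I) - z₀))
      (Complex.I • (∫ t in (0 : ℝ)..N, (G (b + t * Complex.I) - z₁)))
    rw [norm_smul, Complex.norm_I, one_mul] at this
    have h6 := norm_sub_le (∫ x in a..b, (G x - z₀)) (∫ x in a..b, (G (x + N * Complex.I) - z₀))
    linarith
  have hM0 : 0 ≤ M := (norm_nonneg _).trans (hM a (by simpa using hab))
  by_contra! hlt
  have hpos : 0 < ‖z₁ - z₀‖ - 2 * η := sub_pos.mpr hlt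
  -- This height makes `N (‖z₁ - z₀‖ - 2η)` exceed the bound `2 M (b - a)` by exactly `1`.
  have h1 := key ((2 * (M * (b - a)) + 1) / (‖z₁ - z₀‖ - 2 * η))
    (div_pos (by nlinarith [mul_nonneg hM0 (sub_nonneg.mpr hab)]) hpos)
  have h2 : (2 * (M * (b - a)) + 1) / (‖z₁ - z₀‖ - 2 * η) * (‖z₁ - z₀‖ - 2 * η)
      = 2 * (M * (b - a)) + 1 := div_mul_cancel₀ _ hpos.ne'
  linarith

/-- The first time at which a curve leaves a neighbourhood. -/
lemma exists_first_exit {X : Type*} [TopologicalSpace X] {x : ℝ → X} (hx : Continuous x)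
    {O D : Set X} (hO : IsOpen O) (hD : IsClosed D) (hOD : O ⊆ D) {s s' : ℝ} (hss : s ≤ s')
    (hs : x s ∈ O) (hs' : x s' ∉ O) :
    ∃ e, s ≤ e ∧ x e ∈ D \ O ∧ ∀ σ ∈ Icc s e, x σ ∈ D := by
  have hK : IsCompact (Icc s s' ∩ x ⁻¹' Oᶜ) :=
    isCompact_Icc.inter_right (hO.isClosed_compl.preimage hx)
  obtain ⟨e, ⟨he1, he2⟩, he3⟩ := hK.exists_isLeast ⟨s', ⟨hss, le_rfl⟩, hs'⟩
  have hlt : s < e := lt_of_le_of_ne he1.1 fun h => he2 (h ▸ hs)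
  have hbefore : ∀ σ ∈ Ico s e, x σ ∈ O := fun σ hσ => by
    by_contra h
    exact absurd (he3 ⟨⟨hσ.1, hσ.2.le.trans he1.2⟩, h⟩) (not_le.mpr hσ.2)
  have heD : x e ∈ D := by
    have h1 : e ∈ closure (Ico s e) := by
      rw [closure_Ico hlt.ne]; exact ⟨hlt.le, le_rfl⟩
    have h2 : x e ∈ closure D := map_mem_closure hx h1 fun σ hσ => hOD (hbefore σ hσ)
    rwa [hD.closure_eq] at h2
  refine ⟨e, hlt.le, ⟨heD, he2⟩, fun σ hσ => ?_⟩
  rcases hσ.2.lt_or_eq with h | h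
  · exact hOD (hbefore σ ⟨hσ.1, h⟩)
  · exact h ▸ heD

/-! ### The moment map and gradients of Hamiltonians -/

section Metric

variable {E X : Type*} [NormedAddCommGroup E] [NormedSpace ℂ E]
    [TopologicalSpace X] [ChartedSpace E X] [IsManifold 𝓘(ℂ, E) ω X]

/-- The metric at a point as a bilinear form on the model space. -/
def KahlerMetric.bilin (g : KahlerMetric E X) (x : X) : E →L[ℝ] E →L[ℝ] ℝ := g.inner x

variable (g : KahlerMetric E X)

lemma KahlerMetric.bilin_symm (x : X) (a b : E) : g.bilin x a b = g.bilin x b a :=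
  g.symm x a b

lemma KahlerMetric.bilin_pos (x : X) {a : E} (ha : a ≠ 0) : 0 < g.bilin x a a :=
  g.pos x a ha

lemma KahlerMetric.bilin_nonneg (x : X) (a : E) : 0 ≤ g.bilin x a a := by
  rcases eq_or_ne a 0 with rfl | h
  · simp
  · exact (g.bilin_pos x h).le

lemma KahlerMetric.bilin_hermitian (x : X) (a b : E) :
    g.bilin x (Complex.I • a) (Complex.I • b) = g.bilin x a b :=
  g.hermitian x a b

variable {r : ℕ} [MulAction (Fin r → ℂˣ) X]

-- Since `ξ_u = I • infl (realIncl u)`, the form `ω(ξ_u, ·) = g(Jξ_u, ·)` is the pairing with `-infl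
-- (realIncl u)`. That vector is the gradient of `H_u`, so the flow `s ↦ expT (s • -realIncl u)` of
-- `Ju` is the gradient flow.
variable {g} in
lemma IsMomentMap.hasMFDerivAt {μ : X → Module.Dual ℝ (Fin r → ℝ)} (hμ : IsMomentMap g μ)
    (hact : IsHolomorphicAction r E X) (u : Fin r → ℝ) (x : X) :
    HasMFDerivAt 𝓘(ℝ, E) 𝓘(ℝ, ℝ) (fun x => μ x u) x
      (-(g.bilin x (infl E x (realIncl u)))) := by
  refine ((hμ.smooth u).mdifferentiable (by simp) x).hasMFDerivAt.congr_mfderiv ?_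
  refine ContinuousLinearMap.ext fun v : E => (hμ.hamiltonian u x v).trans ?_
  have h4 : cplxStr x (vectorField E u x) = (-(infl E x (realIncl u)) : E) := by
    rw [hact.vectorField_eq, lieIncl_eq, map_smul]
    change (Complex.I • Complex.I • _ : E) = _
    rw [smul_smul, Complex.I_mul_I, neg_one_smul]
  unfold KahlerMetric.form
  rw [h4]
  change g.bilin x (-(infl E x (realIncl u))) v = _
  rw [map_neg]
  rfl

variable {g} in
lemma IsMomentMap.hasFDerivAt_orbit {μ : X → Module.Dual ℝ (Fin r → ℝ)} (hμ : IsMomentMap g μ)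
    (hact : IsHolomorphicAction r E X) (u : Fin r → ℝ) (x : X) (ζ : Fin r → ℂ) :
    HasFDerivAt (fun ζ : Fin r → ℂ => μ (expT ζ • x) u)
      (-((g.bilin (expT ζ • x) (infl E (expT ζ • x) (realIncl u))).comp
        ((infl E (expT ζ • x)).restrictScalars ℝ))) ζ := by
  have h := (HasMFDerivAt.comp (g := fun x => μ x u) ζ (hμ.hasMFDerivAt hact u (expT ζ • x))
    (hasMFDerivAt_restrictScalars (hact.hasMFDerivAt_orbit ζ x))).hasFDerivAt
  exact h.congr_fderiv (ContinuousLinearMap.ext fun v => rfl)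

end Metric

/-! ### Convergence of gradient flows -/

section Specialisation

variable {E X : Type*} [NormedAddCommGroup E] [NormedSpace ℂ E]
    [TopologicalSpace X] [T2Space X] [ChartedSpace E X]
    {r : ℕ} [MulAction (Fin r → ℂˣ) X]

/-- Points near a point fixed by a one-parameter subgroup of the compact torus have their orbits
under that subgroup near the fixed point. -/
lemma IsHolomorphicAction.exists_nhds_orbit_subset (hact : IsHolomorphicAction r E X)
    {u : Fin r → ℝ} {q : X}
    (hq : ∀ t : ℝ, expT (t • lieIncl u) • q = q) {O : Set X} (hO : O ∈ 𝓝 q) :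
    ∃ V ∈ 𝓝 q, ∀ x ∈ V, ∀ t : ℝ, expT (t • lieIncl u) • x ∈ O := by
  have hcont : Continuous fun y : (Fin r → ℝ) × X => expT (lieIncl y.1) • y.2 := by
    refine hact.continuous.comp (f := fun y : (Fin r → ℝ) × X => (lieIncl y.1, y.2)) ?_
    unfold lieIncl
    fun_prop
  -- The one-parameter subgroup need not be closed. All torus elements fixing `q` are used instead:
  -- their angles in the cube form a compact set, to which the tube lemma applies.
  have hKc : IsCompact (Icc (0 : Fin r → ℝ) (fun _ => 2 * Real.pi)
      ∩ {v | expT (lieIncl v) • q = q}) :=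
    isCompact_Icc.inter_right
      (isClosed_eq (hcont.comp (Continuous.prodMk_left q)) continuous_const)
  have hopen : IsOpen ((fun y : (Fin r → ℝ) × X => expT (lieIncl y.1) • y.2) ⁻¹' interior O) :=
    isOpen_interior.preimage hcont
  obtain ⟨A, V, hA, hV, hKA, hqV, hAV⟩ := generalized_tube_lemma hKc (isCompact_singleton (x := q))
    hopen (by
      rintro ⟨v, x⟩ ⟨⟨_, hv⟩, hx⟩
      rw [mem_singleton_iff] at hx
      subst hx
      have hv' : expT (lieIncl v) • x = x := hv
      simpa [hv'] using mem_interior_iff_mem_nhds.mpr hO)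
  refine ⟨V, hV.mem_nhds (hqV rfl), fun x hx t => ?_⟩
  have htu : t • lieIncl u = lieIncl (t • u) := by
    funext j; simp [lieIncl]; ring
  obtain ⟨v, hv, hve⟩ := exists_expT_lieIncl_eq (t • u)
  rw [htu, ← hve]
  refine interior_subset (hAV (a := (v, x)) ⟨hKA ⟨hv, ?_⟩, hx⟩)
  change expT (lieIncl v) • q = q
  rw [hve, ← htu, hq]

variable [CompactSpace X] [IsManifold 𝓘(ℂ, E) ω X] {g : KahlerMetric E X}
  {μ : X → Module.Dual ℝ (Fin r → ℝ)}

omit [T2Space X] [CompactSpace X] in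
lemma IsMomentMap.hasDerivAt_flow (hμ : IsMomentMap g μ) (hact : IsHolomorphicAction r E X)
    (u : Fin r → ℝ) (x : X) (s : ℝ) :
    HasDerivAt (fun s : ℝ => μ (expT (s • -realIncl u) • x) u)
      (g.bilin (expT (s • -realIncl u) • x) (infl E (expT (s • -realIncl u) • x) (realIncl u))
        (infl E (expT (s • -realIncl u) • x) (realIncl u))) s := by
  have h1 := hμ.hasFDerivAt_orbit hact u x (s • -realIncl u)
  have h2 : HasDerivAt (fun s : ℝ => s • -realIncl u) (-realIncl u) s := by
    simpa using (hasDerivAt_id s).smul_const (-realIncl u)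
  have h3 := h1.comp_hasDerivAt s h2
  exact h3.congr_deriv (by simp)

omit [T2Space X] [CompactSpace X] [IsManifold 𝓘(ℂ, E) ω X] in
lemma continuous_flow (hact : IsHolomorphicAction r E X) (v : Fin r → ℂ) (x : X) :
    Continuous fun s : ℝ => expT (s • v) • x :=
  hact.continuous.comp (f := fun s : ℝ => (s • v, x)) (by fun_prop)

omit [T2Space X] in
/-- Limit points of the gradient flow are zeros of the vector field. -/
lemma IsMomentMap.infl_eq_zero_of_tendsto (hμ : IsMomentMap g μ)
    (hact : IsHolomorphicAction r E X)
    {u : Fin r → ℝ} {p q : X} {ι : Type*} {l : Filter ι} [l.NeBot] {s : ι → ℝ}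
    (hs : Tendsto s l atTop)
    (hq : Tendsto (fun i => expT (s i • -realIncl u) • p) l (𝓝 q)) :
    infl E q (realIncl u) = 0 := by
  set f : ℝ → ℝ := fun s => μ (expT (s • -realIncl u) • p) u with hf
  have hcont : Continuous fun x => μ x u := (hμ.smooth u).continuous
  have hmono : Monotone f :=
    monotone_of_hasDerivAt_nonneg (fun s => hμ.hasDerivAt_flow hact u p s)
      (fun s => g.bilin_nonneg _ _)
  have hbdd : BddAbove (range f) := by
    have := (isCompact_range hcont).bddAbove
    refine this.mono ?_
    rintro _ ⟨s, rfl⟩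
    exact ⟨_, rfl⟩
  have hlim := tendsto_atTop_ciSup hmono hbdd
  -- Flowing for an extra time `σ` does not change the limit of the Hamiltonian, so it is constant
  -- on the flow line of `q`. Its derivative there, the squared length of the gradient, must vanish.
  have hconst : ∀ σ : ℝ, μ (expT (σ • -realIncl u) • q) u = ⨆ i, f i := fun σ => by
    have h1 : Tendsto (fun i => f (σ + s i)) l (𝓝 (⨆ i, f i)) :=
      hlim.comp (tendsto_atTop_add_const_left l σ hs)
    have h2 : Tendsto (fun i => f (σ + s i)) l (𝓝 (μ (expT (σ • -realIncl u) • q) u)) := by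
      have h3 : Continuous fun x : X => expT (σ • -realIncl u) • x :=
        (hact.contMDiff_smul _).continuous
      have h4 := ((hcont.comp h3).tendsto q).comp hq
      refine h4.congr fun i => ?_
      simp only [hf, Function.comp_apply, smul_smul, ← expT_add, ← add_smul]
    exact tendsto_nhds_unique h2 h1
  have hd := hμ.hasDerivAt_flow hact u q 0
  rw [show (fun s : ℝ => μ (expT (s • -realIncl u) • q) u) = fun _ => ⨆ i, f i from
    funext hconst] at hd
  have h0 := hd.unique (hasDerivAt_const (0 : ℝ) (⨆ i, f i))
  rw [zero_smul, expT_zero, one_smul] at h0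
  by_contra hne
  exact (g.bilin_pos q hne).ne' h0

variable [FiniteDimensional ℂ E]

/-- The gradient flow of a Hamiltonian converges. -/
theorem IsMomentMap.exists_isSpecialisation (hμ : IsMomentMap g μ)
    (hact : IsHolomorphicAction r E X) (u : Fin r → ℝ) (p : X) :
    ∃ q, IsSpecialisation u p q := by
  have : CompleteSpace E := FiniteDimensional.complete ℂ E
  have : ProperSpace E := FiniteDimensional.proper ℂ E
  set x : ℝ → X := fun s => expT (s • -realIncl u) • p with hxdef
  have hxc : Continuous x := continuous_flow hact _ p
  -- One ultrafilter replaces the choice of successive subsequences: the limit point `q` and later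
  -- the limit `q'` of the exit points are both taken along it.
  let U : Ultrafilter ℝ := Ultrafilter.of atTop
  have hU : (U : Filter ℝ) ≤ atTop := Ultrafilter.of_le atTop
  obtain ⟨q, -, hq⟩ := isCompact_univ.ultrafilter_le_nhds (U.map x) (by simp)
  have hqt : Tendsto x U (𝓝 q) := hq
  have hfix : ∀ q : X, infl E q (realIncl u) = 0 → ∀ t : ℝ, expT (t • lieIncl u) • q = q :=
    fun q h t => by
      have := hact.expT_smul_eq_of_infl_eq_zero h (t * Complex.I)
      rwa [mul_smul, Complex.coe_smul, ← lieIncl_eq] at this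
  have hq0 := hfix q (hμ.infl_eq_zero_of_tendsto hact (s := id) (l := (U : Filter ℝ)) hU hqt)
  -- Otherwise the flow line, coming close to `q` at arbitrarily late times, would each time leave a
  -- ball of radius `ρ` about `q` again. The exit points accumulate at a second fixed point `q'` on
  -- the sphere, and the strip estimate on the time interval from near `q` to near `q'` gives the
  -- contradiction.
  have hconv : Tendsto x atTop (𝓝 q) := by
    intro N hN
    rw [mem_map]
    by_contra hfreq
    set φ := chartAt E q with hφ
    have hφc : ∀ y ∈ φ.source, ContinuousAt φ y := fun y hy => φ.continuousAt hy
    -- Radius `1` only serves to supply the bound `M = 1` on the strip and to keep the orbits under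
    -- imaginary time inside the chart.
    have hO1 : φ.source ∩ φ ⁻¹' Metric.ball (φ q) 1 ∈ 𝓝 q :=
      inter_mem (chart_source_mem_nhds E q)
        ((hφc q (mem_chart_source E q)) (Metric.ball_mem_nhds _ one_pos))
    obtain ⟨V, hV, hVO⟩ := hact.exists_nhds_orbit_subset hq0 hO1
    have hsymm : φ.symm ⁻¹' (V ∩ N) ∩ φ.target ∈ 𝓝 (φ q) := by
      refine inter_mem ?_ (chart_target_mem_nhds E q)
      have h1 : ContinuousAt φ.symm (φ q) :=
        φ.symm.continuousAt (φ.map_source (mem_chart_source E q))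
      refine h1.preimage_mem_nhds ?_
      rw [φ.left_inv (mem_chart_source E q)]
      exact inter_mem hV hN
    obtain ⟨ρ, hρ, hball⟩ := Metric.nhds_basis_closedBall.mem_iff.mp hsymm
    set D : Set X := φ.symm '' Metric.closedBall (φ q) ρ with hDdef
    have hsc : ContinuousOn φ.symm (Metric.closedBall (φ q) ρ) :=
      φ.continuousOn_symm.mono fun z hz => (hball hz).2
    have hD : IsClosed D := ((isCompact_closedBall _ _).image_of_continuousOn hsc).isClosed
    set O : Set X := φ.source ∩ φ ⁻¹' Metric.ball (φ q) ρ with hOdef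
    have hO : IsOpen O := φ.isOpen_inter_preimage Metric.isOpen_ball
    have hqO : q ∈ O := ⟨mem_chart_source E q, Metric.mem_ball_self hρ⟩
    have hOD : O ⊆ D := fun y hy =>
      ⟨φ y, Metric.ball_subset_closedBall hy.2, φ.left_inv hy.1⟩
    have hDV : ∀ y ∈ D, y ∈ V ∧ y ∈ N ∧ y ∈ φ.source := by
      rintro _ ⟨z, hz, rfl⟩
      exact ⟨(hball hz).1.1, (hball hz).1.2, φ.map_target (hball hz).2⟩
    have hDO : D \ O ⊆ φ.symm '' Metric.sphere (φ q) ρ := by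
      rintro _ ⟨⟨z, hz, rfl⟩, h2⟩
      refine ⟨z, ?_, rfl⟩
      rw [Metric.mem_sphere]
      refine le_antisymm hz (not_lt.mp fun hlt => h2 ⟨φ.map_target (hball hz).2, ?_⟩)
      rw [mem_preimage, φ.right_inv (hball hz).2]
      exact hlt
    have hexit : ∀ s, ∃ e, x s ∈ O → s ≤ e ∧ x e ∈ D \ O ∧ ∀ σ ∈ Icc s e, x σ ∈ D := fun s => by
      by_cases hs : x s ∈ O
      · have : ∃ s' ≥ s, x s' ∉ N := by
          by_contra! hcon
          exact hfreq (mem_of_superset (Ici_mem_atTop s) hcon)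
        obtain ⟨s', hs', hN'⟩ := this
        obtain ⟨e, he⟩ := exists_first_exit hxc hO hD hOD hs' hs
          (fun h => hN' (hDV _ (hOD h)).2.1)
        exact ⟨e, fun _ => he⟩
      · exact ⟨s, fun h => absurd h hs⟩
    choose e he using hexit
    have hev : ∀ᶠ s in (U : Filter ℝ), x s ∈ O := hqt (hO.mem_nhds hqO)
    have hetop : Tendsto e U atTop :=
      tendsto_atTop_mono' _ (hev.mono fun s hs => (he s hs).1) hU
    have hScomp : IsCompact (φ.symm '' Metric.sphere (φ q) ρ) :=
      (isCompact_sphere _ _).image_of_continuousOn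
        (hsc.mono Metric.sphere_subset_closedBall)
    obtain ⟨q', hq'S, hq'⟩ := hScomp.ultrafilter_le_nhds (U.map (x ∘ e)) (by
      rw [le_principal_iff]
      exact hev.mono fun s hs => hDO (he s hs).2.1)
    have hq't : Tendsto (fun s => x (e s)) U (𝓝 q') := hq'
    have hq'0 := hfix q' (hμ.infl_eq_zero_of_tendsto hact hetop hq't)
    obtain ⟨z', hz', hzq'⟩ := hq'S
    have hz'2 := hball (Metric.sphere_subset_closedBall hz')
    have hq's : q' ∈ φ.source := hzq' ▸ φ.map_target hz'2.2
    have hφq' : φ q' = z' := by rw [← hzq', φ.right_inv hz'2.2]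
    have hρ4 : 0 < ρ / 4 := by positivity
    obtain ⟨V₁, hV₁, hV₁O⟩ := hact.exists_nhds_orbit_subset hq0
      ((hφc q (mem_chart_source E q)) (Metric.ball_mem_nhds _ hρ4))
    obtain ⟨V₂, hV₂, hV₂O⟩ := hact.exists_nhds_orbit_subset hq'0
      ((hφc q' hq's) (Metric.ball_mem_nhds _ hρ4))
    obtain ⟨s, hsO, hsV₁, hsV₂⟩ :=
      (hev.and ((hqt.eventually_mem hV₁).and (hq't.eventually_mem hV₂))).exists
    obtain ⟨hse, -, hseg⟩ := he s hsO
    -- Imaginary time acts through the compact torus, so each vertical line of the strip maps to a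
    -- compact-group orbit of a point of the flow line.
    have hsplit : ∀ ζ : ℂ, expT (ζ • -realIncl u) • p = expT ((-ζ.im) • lieIncl u) • x ζ.re :=
      fun ζ => by
        rw [hxdef, smul_smul, ← expT_add]
        congr 2
        conv_lhs => rw [← Complex.re_add_im ζ]
        rw [add_smul, mul_smul, Complex.coe_smul, Complex.coe_smul, add_comm]
        congr 1
        rw [lieIncl_eq, smul_neg, smul_neg, neg_smul]
    have hsrc : ∀ ζ : ℂ, ζ.re ∈ Icc s (e s) →
        expT (ζ • -realIncl u) • p ∈ φ.source ∩ φ ⁻¹' Metric.ball (φ q) 1 := fun ζ hζ => by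
      rw [hsplit]
      exact hVO _ (hDV _ (hseg _ hζ)).1 _
    -- The two boundary lines stay within `ρ / 4` of `q` and of `q'`, so these would be at distance
    -- at most `ρ / 2` in the chart, while `q'` lies on the sphere of radius `ρ`.
    have hfin := norm_sub_le_of_strip (G := fun ζ : ℂ => φ (expT (ζ • -realIncl u) • p))
      (z₀ := φ q) (z₁ := φ q') (η := ρ / 4) (M := 1) hse
      (fun ζ hζ => by
        have h1 : MDifferentiableAt 𝓘(ℂ, E) 𝓘(ℂ, E) φ (expT (ζ • -realIncl u) • p) :=
          mdifferentiableAt_atlas (chart_mem_atlas E q) (hsrc ζ hζ).1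
        have h2 := (hact.hasMFDerivAt_orbit (ζ • -realIncl u) p).mdifferentiableAt
        have h3 : DifferentiableAt ℂ (fun ζ : ℂ => ζ • -realIncl u) ζ := by fun_prop
        have h4 := MDifferentiableAt.comp (g := fun η : Fin r → ℂ => expT η • p)
          (f := fun ζ : ℂ => ζ • -realIncl u) ζ h2 h3.mdifferentiableAt
        exact (MDifferentiableAt.comp (g := φ) ζ h1 h4).differentiableAt)
      (fun ζ hζ => (mem_ball_iff_norm.mp (hsrc ζ hζ).2).le)
      (fun t => by
        rw [hsplit]
        have := hV₁O _ hsV₁ (-t)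
        simpa using (mem_ball_iff_norm.mp this).le)
      (fun t => by
        rw [hsplit]
        have := hV₂O _ hsV₂ (-t)
        simpa using (mem_ball_iff_norm.mp this).le)
    rw [hφq', mem_sphere_iff_norm.mp hz'] at hfin
    linarith
  refine ⟨q, hconv.congr fun s => ?_⟩
  rw [smul_I_lieIncl, Complex.coe_smul, neg_smul, ← smul_neg]

end Specialisation

/-! ### The Kähler metric in a chart -/

section ChartMetric

variable {E X : Type*} [NormedAddCommGroup E] [NormedSpace ℂ E]
    [TopologicalSpace X] [ChartedSpace E X] [IsManifold 𝓘(ℂ, E) ω X]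

variable (E) in
/-- The differential of the inverse of the chart at `c`. -/
def chartSymmD (c : X) (z : E) : E →L[ℂ] E :=
  mfderiv 𝓘(ℂ, E) 𝓘(ℂ, E) (chartAt E c).symm z

variable (E) in
/-- The differential of the chart at `c`. -/
def chartD (c : X) (x : X) : E →L[ℂ] E :=
  mfderiv 𝓘(ℂ, E) 𝓘(ℂ, E) (chartAt E c) x

variable {c : X} {z : E}

lemma hasMFDerivAt_chartSymmD (hz : z ∈ (chartAt E c).target) :
    HasMFDerivAt 𝓘(ℂ, E) 𝓘(ℂ, E) (chartAt E c).symm z (chartSymmD E c z) :=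
  (mdifferentiableAt_atlas_symm (chart_mem_atlas E c) hz).hasMFDerivAt

lemma hasMFDerivAt_chartD {x : X} (hx : x ∈ (chartAt E c).source) :
    HasMFDerivAt 𝓘(ℂ, E) 𝓘(ℂ, E) (chartAt E c) x (chartD E c x) :=
  (mdifferentiableAt_atlas (chart_mem_atlas E c) hx).hasMFDerivAt

lemma mfderiv_chart_symm (hz : z ∈ (chartAt E c).target) :
    mfderiv 𝓘(ℝ, E) 𝓘(ℝ, E) (chartAt E c).symm z = (chartSymmD E c z).restrictScalars ℝ :=
  (hasMFDerivAt_restrictScalars (hasMFDerivAt_chartSymmD hz)).mfderiv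

lemma chartD_chartSymmD (hz : z ∈ (chartAt E c).target) (a : E) :
    chartD E c ((chartAt E c).symm z) (chartSymmD E c z a) = a := by
  have h := HasMFDerivAt.comp z (hasMFDerivAt_chartD ((chartAt E c).map_target hz))
    (hasMFDerivAt_chartSymmD hz)
  have h2 : HasMFDerivAt 𝓘(ℂ, E) 𝓘(ℂ, E) ((chartAt E c) ∘ (chartAt E c).symm) z
      (ContinuousLinearMap.id ℂ E) := by
    refine (hasMFDerivAt_id z).congr_of_eventuallyEq ?_
    filter_upwards [(chartAt E c).open_target.mem_nhds hz] with y hy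
    exact (chartAt E c).right_inv hy
  exact congrArg (fun A : E →L[ℂ] E => A a) (h.mfderiv.symm.trans h2.mfderiv)

lemma chartSymmD_chartD {x : X} (hx : x ∈ (chartAt E c).source) (a : E) :
    chartSymmD E c (chartAt E c x) (chartD E c x a) = a := by
  have hs := hasMFDerivAt_chartSymmD ((chartAt E c).map_source hx)
  have h := HasMFDerivAt.comp x hs (hasMFDerivAt_chartD hx)
  have h2 : HasMFDerivAt 𝓘(ℂ, E) 𝓘(ℂ, E) ((chartAt E c).symm ∘ (chartAt E c)) x
      (ContinuousLinearMap.id ℂ E) := by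
    refine (hasMFDerivAt_id x).congr_of_eventuallyEq ?_
    filter_upwards [(chartAt E c).open_source.mem_nhds hx] with y hy
    exact (chartAt E c).left_inv hy
  exact congrArg (fun A : E →L[ℂ] E => A a) (h.mfderiv.symm.trans h2.mfderiv)

lemma det_chartD_ne_zero [FiniteDimensional ℂ E] {x : X} (hx : x ∈ (chartAt E c).source) :
    LinearMap.det (chartD E c x).toLinearMap ≠ 0 := by
  intro h
  have h1 : (chartSymmD E c (chartAt E c x)).toLinearMap ∘ₗ (chartD E c x).toLinearMap
      = LinearMap.id := LinearMap.ext fun a => chartSymmD_chartD hx a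
  have h2 := congrArg LinearMap.det h1
  simp [LinearMap.det_comp, h] at h2

omit [IsManifold 𝓘(ℂ, E) ω X] in
lemma chartSymmD_self (c : X) : chartSymmD E c (chartAt E c c) = ContinuousLinearMap.id ℂ E := by
  have hz := (chartAt E c).map_source (mem_chart_source E c)
  refine HasMFDerivAt.mfderiv ⟨(chartAt E c).symm.continuousAt hz, ?_⟩
  refine HasFDerivAt.hasFDerivWithinAt ?_
  refine (hasFDerivAt_id _).congr_of_eventuallyEq ?_
  filter_upwards [(chartAt E c).open_target.mem_nhds hz] with y hy
  simp only [writtenInExtChartAt, mfld_simps, (chartAt E c).left_inv (mem_chart_source E c)]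
  exact (chartAt E c).right_inv hy

/-- The metric in the chart at `c`. -/
def KahlerMetric.chartBilin (g : KahlerMetric E X) (c : X) (z : E) : E →L[ℝ] E →L[ℝ] ℝ :=
  (g.bilin ((chartAt E c).symm z)).bilinearComp
    (mfderiv 𝓘(ℝ, E) 𝓘(ℝ, E) (chartAt E c).symm z : E →L[ℝ] E)
    (mfderiv 𝓘(ℝ, E) 𝓘(ℝ, E) (chartAt E c).symm z : E →L[ℝ] E)

variable (g : KahlerMetric E X)

lemma KahlerMetric.chartBilin_apply (hz : z ∈ (chartAt E c).target) (a b : E) :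
    g.chartBilin c z a b
      = g.bilin ((chartAt E c).symm z) (chartSymmD E c z a) (chartSymmD E c z b) := by
  unfold KahlerMetric.chartBilin
  rw [mfderiv_chart_symm hz]
  rfl

lemma KahlerMetric.chartBilin_self (c : X) : g.chartBilin c (chartAt E c c) = g.bilin c := by
  ext a b
  rw [g.chartBilin_apply ((chartAt E c).map_source (mem_chart_source E c)), chartSymmD_self,
    (chartAt E c).left_inv (mem_chart_source E c)]
  rfl

lemma KahlerMetric.chartBilin_symm (c : X) (z a b : E) :
    g.chartBilin c z a b = g.chartBilin c z b a :=
  g.bilin_symm _ _ _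

lemma KahlerMetric.chartBilin_hermitian (hz : z ∈ (chartAt E c).target) (a b : E) :
    g.chartBilin c z (Complex.I • a) (Complex.I • b) = g.chartBilin c z a b := by
  rw [g.chartBilin_apply hz, g.chartBilin_apply hz, (chartSymmD E c z).map_smul,
    (chartSymmD E c z).map_smul, g.bilin_hermitian]

lemma KahlerMetric.chartBilin_pos (hz : z ∈ (chartAt E c).target) {a : E} (ha : a ≠ 0) :
    0 < g.chartBilin c z a a := by
  rw [g.chartBilin_apply hz]
  refine g.bilin_pos _ fun h => ha ?_
  rw [← chartD_chartSymmD hz a, h, map_zero]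

variable [FiniteDimensional ℂ E]

/-- Smoothness of the metric is given for a section of a bundle; it is evaluated on the constant
coordinate fields, whose images under the tangent map of the inverse chart are smooth. -/
lemma KahlerMetric.contDiffOn_chartBilin (c : X) :
    ContDiffOn ℝ ∞ (g.chartBilin c) (chartAt E c).target := by
  have : FiniteDimensional ℝ E := FiniteDimensional.complexToReal E
  have : IsManifold 𝓘(ℝ, E) 1 X := IsManifold.of_le (n := ∞) (by simp)
  have hT : ∀ v : E, ContMDiffOn 𝓘(ℝ, E) 𝓘(ℝ, E).tangent ∞
      (fun z : E => (⟨(chartAt E c).symm z, mfderiv 𝓘(ℝ, E) 𝓘(ℝ, E) (chartAt E c).symm z v⟩ :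
        TangentBundle 𝓘(ℝ, E) X)) (chartAt E c).target := fun v => by
    have h1 : ContMDiffOn 𝓘(ℝ, E) 𝓘(ℝ, E) ∞ (chartAt E c).symm (chartAt E c).target :=
      contMDiffOn_chart_symm
    have h2 := h1.contMDiffOn_tangentMapWithin (m := ∞) (by simp)
      (chartAt E c).open_target.uniqueMDiffOn
    have h3 : ContMDiff 𝓘(ℝ, E) 𝓘(ℝ, E).tangent ∞
        (fun z : E => (⟨z, v⟩ : TangentBundle 𝓘(ℝ, E) E)) :=
      contMDiff_vectorSpace_iff_contDiff.mpr contDiff_const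
    refine (h2.comp h3.contMDiffOn fun z hz => hz).congr fun z hz => ?_
    simp only [Function.comp_apply, tangentMapWithin]
    rw [mfderivWithin_of_isOpen (chartAt E c).open_target hz]
  rw [contDiffOn_clm_apply]
  intro v
  rw [contDiffOn_clm_apply]
  intro w
  have hg : ContMDiffOn 𝓘(ℝ, E) (𝓘(ℝ, E).prod 𝓘(ℝ, E →L[ℝ] E →L[ℝ] ℝ)) ∞
      (fun z : E => Bundle.TotalSpace.mk' (E →L[ℝ] E →L[ℝ] ℝ)
        (E := fun x : X => TangentSpace 𝓘(ℝ, E) x →L[ℝ] TangentSpace 𝓘(ℝ, E) x →L[ℝ] ℝ)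
        ((chartAt E c).symm z) (g.inner ((chartAt E c).symm z))) (chartAt E c).target :=
    g.contMDiff.comp_contMDiffOn (f := (chartAt E c).symm) contMDiffOn_chart_symm
  have h : ContMDiffOn 𝓘(ℝ, E) (𝓘(ℝ, E).prod 𝓘(ℝ, ℝ)) ∞
      (fun z : E => Bundle.TotalSpace.mk' ℝ (E := Bundle.Trivial X ℝ) ((chartAt E c).symm z)
        (g.inner ((chartAt E c).symm z) (mfderiv 𝓘(ℝ, E) 𝓘(ℝ, E) (chartAt E c).symm z v)
          (mfderiv 𝓘(ℝ, E) 𝓘(ℝ, E) (chartAt E c).symm z w))) (chartAt E c).target :=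
    ContMDiffOn.clm_bundle_apply₂ (F₁ := E) (F₂ := E) hg (hT v) (hT w)
  intro z hz
  have h2 := h z hz
  simp only [Bundle.contMDiffWithinAt_totalSpace] at h2
  exact h2.2.contDiffWithinAt

omit [FiniteDimensional ℂ E] in
lemma KahlerMetric.fderiv_chartBilin_closed (hz : z ∈ (chartAt E c).target)
    (hd : DifferentiableAt ℝ (g.chartBilin c) z) (a b d : E) :
    fderiv ℝ (g.chartBilin c) z a (Complex.I • b) d
      + fderiv ℝ (g.chartBilin c) z b (Complex.I • d) a
      + fderiv ℝ (g.chartBilin c) z d (Complex.I • a) b = 0 := by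
  have h := g.closed _ (chart_mem_atlas E c) z hz a b d
  have key : ∀ v w y : E, fderiv ℝ (fun z => g.inner ((chartAt E c).symm z)
      (cplxStr ((chartAt E c).symm z) (mfderiv 𝓘(ℝ, E) 𝓘(ℝ, E) (chartAt E c).symm z v))
      (mfderiv 𝓘(ℝ, E) 𝓘(ℝ, E) (chartAt E c).symm z w)) z y
      = fderiv ℝ (g.chartBilin c) z y (Complex.I • v) w := fun v w y => by
    have h1 : (fun z => g.inner ((chartAt E c).symm z)
        (cplxStr ((chartAt E c).symm z) (mfderiv 𝓘(ℝ, E) 𝓘(ℝ, E) (chartAt E c).symm z v))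
        (mfderiv 𝓘(ℝ, E) 𝓘(ℝ, E) (chartAt E c).symm z w))
        =ᶠ[𝓝 z] fun z => g.chartBilin c z (Complex.I • v) w := by
      filter_upwards [(chartAt E c).open_target.mem_nhds hz] with y hy
      rw [g.chartBilin_apply hy, map_smul, mfderiv_chart_symm hy]
      rfl
    rw [h1.fderiv_eq]
    have h2 := ((hd.hasFDerivAt.clm_apply (hasFDerivAt_const (Complex.I • v) z)).clm_apply
      (hasFDerivAt_const w z)).fderiv
    rw [h2]
    simp
  unfold extDerivTwo at h
  rw [key, key, key] at h
  exact h

end ChartMetric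

/-! ### The Hessian of a Hamiltonian as a Lie derivative of the metric -/

section KahlerIdentity

variable {E : Type*} [NormedAddCommGroup E] [NormedSpace ℂ E]

/-- For a Kähler metric `G` and a function `H` with holomorphic gradient `V`, the `(1,1)`-part of
the Hessian of `H` is the Lie derivative of `G` along `V`. -/
lemma hessian_add_hessian_I {G : E → E →L[ℝ] E →L[ℝ] ℝ} {G' : E →L[ℝ] E →L[ℝ] E →L[ℝ] ℝ}
    {V : E → E} {A : E →L[ℂ] E} {H : E → ℝ} {z : E}
    (hG : HasFDerivAt G G' z) (hsymm : ∀ᶠ y in 𝓝 z, ∀ a b, G y a b = G y b a)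
    (hherm : ∀ᶠ y in 𝓝 z, ∀ a b, G y (Complex.I • a) (Complex.I • b) = G y a b)
    (hclosed : ∀ a b d, G' a (Complex.I • b) d + G' b (Complex.I • d) a
      + G' d (Complex.I • a) b = 0)
    (hV : HasFDerivAt V A z) (hH : ∀ᶠ y in 𝓝 z, HasFDerivAt H (G y (V y)) y) (a b : E) :
    fderiv ℝ (fderiv ℝ H) z a b + fderiv ℝ (fderiv ℝ H) z (Complex.I • a) (Complex.I • b)
      = G' (V z) a b + G z (A a) b + G z a (A b) := by
  have hVr : HasFDerivAt V (A.restrictScalars ℝ) z := hV.restrictScalars ℝ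
  have hdH : fderiv ℝ H =ᶠ[𝓝 z] fun y => G y (V y) := hH.mono fun y hy => hy.fderiv
  have h2 : HasFDerivAt (fun y => G y (V y))
      (G'.flip (V z) + (G z).comp (A.restrictScalars ℝ)) z :=
    (hG.clm_apply hVr).congr_fderiv (by rw [add_comm])
  have hD : ∀ a b, fderiv ℝ (fderiv ℝ H) z a b = G' a (V z) b + G z (A a) b := fun a b => by
    rw [hdH.fderiv_eq, h2.fderiv]
    simp
  have hsym2 : fderiv ℝ (fderiv ℝ H) z a b = fderiv ℝ (fderiv ℝ H) z b a := by
    rw [hdH.fderiv_eq, h2.fderiv]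
    exact second_derivative_symmetric_of_eventually hH h2 a b
  have hev : ∀ a b, HasFDerivAt (fun y => G y a b) ((G'.flip a).flip b) z := fun a b =>
    ((hG.clm_apply (hasFDerivAt_const a z)).clm_apply (hasFDerivAt_const b z)).congr_fderiv
      (by ext; simp)
  have hG'symm : ∀ v a b, G' v a b = G' v b a := fun v a b => by
    have h := ((hev b a).congr_of_eventuallyEq (hsymm.mono fun y hy => hy a b)).unique (hev a b)
    exact (congrArg (fun l : E →L[ℝ] ℝ => l v) h).symm
  have hG'herm : ∀ v a b, G' v (Complex.I • a) (Complex.I • b) = G' v a b := fun v a b => by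
    have h := ((hev a b).congr_of_eventuallyEq (hherm.mono fun y hy => hy a b)).unique
      (hev (Complex.I • a) (Complex.I • b))
    exact (congrArg (fun l : E →L[ℝ] ℝ => l v) h).symm
  have hII : ∀ x : E, Complex.I • Complex.I • x = -x := fun x => by
    rw [smul_smul, Complex.I_mul_I, neg_one_smul]
  -- The argument `-(I • a)` is chosen so that `I` applied to it is `a`. Closedness then expresses
  -- `G' (V z) a b` through the two derivatives of `G` that occur in the Hessian at `(Ia, Ib)` and
  -- at `(b, a)`.
  have hc := hclosed (V z) (-(Complex.I • a)) b
  rw [smul_neg, hII, neg_neg] at hc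
  have h5 : G' b (Complex.I • V z) (-(Complex.I • a)) = - G' b (V z) a := by
    rw [map_neg, hG'herm]
  rw [h5, map_neg, neg_apply, neg_apply, hG'symm (Complex.I • a) (Complex.I • b) (V z)] at hc
  have h6 : G z (A (Complex.I • a)) (Complex.I • b) = G z (A a) b := by
    rw [A.map_smul]; exact hherm.self_of_nhds _ _
  have h7 : G z (A b) a = G z a (A b) := hsymm.self_of_nhds _ _
  rw [hD (Complex.I • a), h6]
  have h8 := hD a b
  have h9 := hD b a
  rw [hsym2, h9, h7] at *
  linarith

/-- `hermMatrix` only sees the `J`-invariant part of a form, so adding the `J`-transform doubles it.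
This is the factor `2` in `fderiv_logVol_eq_laplacian`. -/
lemma hermMatrix_add_I {m : ℕ} (e : Module.Basis (Fin m) ℂ E) (Q : E →L[ℝ] E →L[ℝ] ℝ) :
    hermMatrix e (fun a b => Q a b + Q (Complex.I • a) (Complex.I • b))
      = (2 : ℂ) • hermMatrix e (fun a b => Q a b) := by
  have hII : ∀ x : E, Complex.I • Complex.I • x = -x := fun x => by
    rw [smul_smul, Complex.I_mul_I, neg_one_smul]
  ext j k
  simp only [hermMatrix, Matrix.of_apply, Matrix.smul_apply, hII, map_neg, neg_apply, smul_eq_mul]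
  push_cast
  ring

end KahlerIdentity

/-! ### The action in a chart -/

section LocalAction

variable {E X : Type*} [NormedAddCommGroup E] [NormedSpace ℂ E]
    [TopologicalSpace X] [ChartedSpace E X] {r : ℕ} [MulAction (Fin r → ℂˣ) X]

variable (E r) in
/-- The action of `ℂ^r` in the chart at `c`. -/
def localAct (c : X) (q : (Fin r → ℂ) × E) : E :=
  chartAt E c (expT q.1 • (chartAt E c).symm q.2)

variable (E r) in
/-- The domain of the action in the chart at `c`. -/
def localDom (c : X) : Set ((Fin r → ℂ) × E) :=
  {q | q.2 ∈ (chartAt E c).target ∧ expT q.1 • (chartAt E c).symm q.2 ∈ (chartAt E c).source}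

variable (E r) in
/-- The derivative of the local action in the direction of the manifold. -/
def localActD (c : X) (q : (Fin r → ℂ) × E) : E →L[ℂ] E :=
  (fderiv ℂ (localAct E r c) q).comp (ContinuousLinearMap.inr ℂ (Fin r → ℂ) E)

variable {c : X} {q : (Fin r → ℂ) × E}

omit [NormedSpace ℂ E] in
lemma zero_mem_localDom {z : E} (hz : z ∈ (chartAt E c).target) :
    ((0 : Fin r → ℂ), z) ∈ localDom E r c :=
  ⟨hz, by simpa using (chartAt E c).map_target hz⟩

omit [NormedSpace ℂ E] in
lemma localAct_mem_target (hq : q ∈ localDom E r c) :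
    localAct E r c q ∈ (chartAt E c).target :=
  (chartAt E c).map_source hq.2

omit [NormedSpace ℂ E] in
lemma chart_symm_localAct (hq : q ∈ localDom E r c) :
    (chartAt E c).symm (localAct E r c q) = expT q.1 • (chartAt E c).symm q.2 :=
  (chartAt E c).left_inv hq.2

omit [NormedSpace ℂ E] in
lemma localAct_zero {z : E} (hz : z ∈ (chartAt E c).target) :
    localAct E r c (0, z) = z := by
  simp [localAct, (chartAt E c).right_inv hz]

variable (hact : IsHolomorphicAction r E X)
include hact

lemma IsHolomorphicAction.isOpen_localDom (c : X) : IsOpen (localDom E r c) := by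
  have h : ContinuousOn (fun q : (Fin r → ℂ) × E => expT q.1 • (chartAt E c).symm q.2)
      (Prod.snd ⁻¹' (chartAt E c).target) := by
    refine hact.continuous.comp_continuousOn
      (f := fun q : (Fin r → ℂ) × E => (q.1, (chartAt E c).symm q.2)) ?_
    exact continuousOn_fst.prodMk
      ((chartAt E c).continuousOn_symm.comp continuousOn_snd fun q hq => hq)
  exact h.isOpen_inter_preimage ((chartAt E c).open_target.preimage continuous_snd)
    (chartAt E c).open_source

variable [IsManifold 𝓘(ℂ, E) ω X]

lemma IsHolomorphicAction.contDiffAt_localAct (hq : q ∈ localDom E r c) :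
    ContDiffAt ℂ ω (localAct E r c) q := by
  have h1 : ContMDiffAt 𝓘(ℂ, (Fin r → ℂ) × E) (𝓘(ℂ, Fin r → ℂ).prod 𝓘(ℂ, E)) ω
      (fun q : (Fin r → ℂ) × E => (q.1, (chartAt E c).symm q.2)) q := by
    refine ContMDiffAt.prodMk contDiff_fst.contMDiff.contMDiffAt ?_
    have h2 : ContMDiffAt 𝓘(ℂ, E) 𝓘(ℂ, E) ω (chartAt E c).symm q.2 :=
      contMDiffOn_chart_symm.contMDiffAt ((chartAt E c).open_target.mem_nhds hq.1)
    exact ContMDiffAt.comp (g := (chartAt E c).symm) (f := Prod.snd) q h2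
      contDiff_snd.contMDiff.contMDiffAt
  have h3 : ContMDiffAt 𝓘(ℂ, (Fin r → ℂ) × E) 𝓘(ℂ, E) ω
      (fun q : (Fin r → ℂ) × E => expT q.1 • (chartAt E c).symm q.2) q :=
    ContMDiffAt.comp (g := fun q : (Fin r → ℂ) × X => expT q.1 • q.2)
      (f := fun q : (Fin r → ℂ) × E => (q.1, (chartAt E c).symm q.2)) q
      (ContMDiff.contMDiffAt hact) h1
  have h4 : ContMDiffAt 𝓘(ℂ, E) 𝓘(ℂ, E) ω (chartAt E c)
      (expT q.1 • (chartAt E c).symm q.2) :=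
    contMDiffOn_chart.contMDiffAt ((chartAt E c).open_source.mem_nhds hq.2)
  exact (ContMDiffAt.comp (g := chartAt E c)
    (f := fun q : (Fin r → ℂ) × E => expT q.1 • (chartAt E c).symm q.2) q h4 h3).contDiffAt

lemma IsHolomorphicAction.hasFDerivAt_localAct (hq : q ∈ localDom E r c) :
    HasFDerivAt (localAct E r c) (fderiv ℂ (localAct E r c) q) q :=
  ((hact.contDiffAt_localAct hq).differentiableAt (by simp)).hasFDerivAt

lemma IsHolomorphicAction.contDiffAt_localActD (hq : q ∈ localDom E r c) :
    ContDiffAt ℂ ω (localActD E r c) q :=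
  ((hact.contDiffAt_localAct hq).fderiv_right (by simp)).clm_comp contDiffAt_const

lemma IsHolomorphicAction.tang_chartSymmD (hq : q ∈ localDom E r c) (a : E) :
    tang E q.1 ((chartAt E c).symm q.2) (chartSymmD E c q.2 a)
      = chartSymmD E c (localAct E r c q) (localActD E r c q a) := by
  have h1 := HasMFDerivAt.comp q.2 (hact.hasMFDerivAt_smul q.1 ((chartAt E c).symm q.2))
    (hasMFDerivAt_chartSymmD hq.1)
  have h2 : HasFDerivAt (fun z : E => localAct E r c (q.1, z)) (localActD E r c q) q.2 :=
    HasFDerivAt.comp (g := localAct E r c) q.2 (hact.hasFDerivAt_localAct hq)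
      (hasFDerivAt_prodMk_right q.1 q.2)
  have h3 := HasMFDerivAt.comp (g := (chartAt E c).symm) q.2
    (hasMFDerivAt_chartSymmD (localAct_mem_target hq)) h2.hasMFDerivAt
  have h4 := h3.congr_of_eventuallyEq (f₁ := (fun y : X => expT q.1 • y) ∘ (chartAt E c).symm) (by
    have : ∀ᶠ z in 𝓝 q.2, (q.1, z) ∈ localDom E r c :=
      (Continuous.prodMk_right q.1).continuousAt.eventually_mem
        ((hact.isOpen_localDom c).mem_nhds hq)
    filter_upwards [this] with z hz
    exact (chart_symm_localAct hz).symm)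
  exact congrArg (fun A : E →L[ℂ] E => A a) (h1.mfderiv.symm.trans h4.mfderiv)

lemma IsHolomorphicAction.infl_chart_symm {z : E} (hz : z ∈ (chartAt E c).target)
    (w : Fin r → ℂ) :
    infl E ((chartAt E c).symm z) w
      = chartSymmD E c z (fderiv ℂ (localAct E r c) (0, z) (w, 0)) := by
  have hq := zero_mem_localDom (r := r) hz
  have h1 := hact.hasMFDerivAt_orbit 0 ((chartAt E c).symm z)
  have h2 : HasFDerivAt (fun ζ : Fin r → ℂ => localAct E r c (ζ, z))
      ((fderiv ℂ (localAct E r c) (0, z)).comp (ContinuousLinearMap.inl ℂ (Fin r → ℂ) E)) 0 :=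
    HasFDerivAt.comp (g := localAct E r c) (0 : Fin r → ℂ) (hact.hasFDerivAt_localAct hq)
      (hasFDerivAt_prodMk_left 0 z)
  have h3 := HasMFDerivAt.comp (g := (chartAt E c).symm) (0 : Fin r → ℂ)
    (hasMFDerivAt_chartSymmD (localAct_mem_target hq)) h2.hasMFDerivAt
  have h4 := h3.congr_of_eventuallyEq (f₁ := fun ζ : Fin r → ℂ => expT ζ • (chartAt E c).symm z) (by
    have : ∀ᶠ ζ in 𝓝 (0 : Fin r → ℂ), (ζ, z) ∈ localDom E r c :=
      (Continuous.prodMk_left z).continuousAt.eventually_mem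
        ((hact.isOpen_localDom c).mem_nhds hq)
    filter_upwards [this] with ζ hζ
    exact (chart_symm_localAct hζ).symm)
  have h5 : infl E (expT (0 : Fin r → ℂ) • (chartAt E c).symm z) w
      = chartSymmD E c (localAct E r c (0, z)) (fderiv ℂ (localAct E r c) (0, z) (w, 0)) :=
    congrArg (fun A : (Fin r → ℂ) →L[ℂ] E => A w) (h1.mfderiv.symm.trans h4.mfderiv)
  rwa [expT_zero, one_smul, localAct_zero hz] at h5

lemma IsHolomorphicAction.det_localActD_ne_zero [FiniteDimensional ℂ E]
    (hq : q ∈ localDom E r c) : LinearMap.det (localActD E r c q).toLinearMap ≠ 0 := by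
  intro h
  have h1 : (tang E q.1 ((chartAt E c).symm q.2)).toLinearMap ∘ₗ (chartSymmD E c q.2).toLinearMap
      = (chartSymmD E c (localAct E r c q)).toLinearMap ∘ₗ (localActD E r c q).toLinearMap :=
    LinearMap.ext fun a => hact.tang_chartSymmD hq a
  have h2 := congrArg LinearMap.det h1
  rw [LinearMap.det_comp, LinearMap.det_comp, h, mul_zero, mul_eq_zero] at h2
  refine h2.elim (hact.det_tang_ne_zero _ _) fun h3 => ?_
  have h4 : (chartD E c ((chartAt E c).symm q.2)).toLinearMap ∘ₗ (chartSymmD E c q.2).toLinearMap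
      = LinearMap.id := LinearMap.ext fun a => chartD_chartSymmD hq.1 a
  have h5 := congrArg LinearMap.det h4
  simp [LinearMap.det_comp, h3] at h5

end LocalAction

/-! ### Smoothness of determinants and of `log |·|` -/

section DetSmooth

lemma contDiffAt_matrix_det {𝕜 V : Type*} [NontriviallyNormedField 𝕜] [NormedAddCommGroup V]
    [NormedSpace 𝕜 V] {A : Type*} [NormedCommRing A] [NormedAlgebra 𝕜 A] {m : ℕ}
    {M : V → Matrix (Fin m) (Fin m) A} {x : V} {n : ℕ∞ω}
    (h : ∀ j k, ContDiffAt 𝕜 n (fun y => M y j k) x) :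
    ContDiffAt 𝕜 n (fun y => (M y).det) x := by
  simp only [Matrix.det_apply, Units.smul_def, zsmul_eq_mul]
  refine ContDiffAt.sum fun σ _ => contDiffAt_const.mul ?_
  exact contDiffAt_prod fun i _ => h _ _

lemma contDiffAt_linearMap_det {V E : Type*} [NormedAddCommGroup V] [NormedSpace ℂ V]
    [NormedAddCommGroup E] [NormedSpace ℂ E] [FiniteDimensional ℂ E] {L : V → E →L[ℂ] E} {x : V}
    {n : ℕ∞ω} (h : ContDiffAt ℂ n L x) :
    ContDiffAt ℂ n (fun y => LinearMap.det (L y).toLinearMap) x := by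
  let e := Module.finBasis ℂ E
  simp only [← LinearMap.det_toMatrix e]
  refine contDiffAt_matrix_det fun j k => ?_
  simp only [LinearMap.toMatrix_apply]
  exact ((e.coord j).toContinuousLinearMap.contDiff.contDiffAt).comp x
    (h.clm_apply contDiffAt_const)

lemma contDiffAt_log_norm {V : Type*} [NormedAddCommGroup V] [NormedSpace ℝ V] {f : V → ℂ} {x : V}
    {n : ℕ∞ω} (hf : ContDiffAt ℝ n f x) (h0 : f x ≠ 0) :
    ContDiffAt ℝ n (fun y => Real.log ‖f y‖) x :=
  (hf.norm ℝ h0).log (norm_ne_zero_iff.mpr h0)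

end DetSmooth

/-! ### The volume density pulled back by the action -/

section LogVolume

variable {E X : Type*} [NormedAddCommGroup E] [NormedSpace ℂ E] [FiniteDimensional ℂ E]
    [TopologicalSpace X] [ChartedSpace E X] [IsManifold 𝓘(ℂ, E) ω X]
    {r : ℕ} [MulAction (Fin r → ℂˣ) X] (g : KahlerMetric E X)

/-- The logarithm of the volume form of the metric pulled back by `expT ζ`, at the point `p`. -/
def logVol (p : X) (ζ : Fin r → ℂ) : ℝ :=
  Real.log ‖(hermMatrix (Module.finBasis ℂ E)
    (fun a b => g.bilin (expT ζ • p) (tang E ζ p a) (tang E ζ p b))).det‖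

/-- The logarithm of the volume form of the metric in the chart at `c`. -/
def chartLogVol (c : X) (z : E) : ℝ :=
  Real.log ‖(hermMatrix (Module.finBasis ℂ E) (fun a b => g.chartBilin c z a b)).det‖

variable (r) in
/-- The logarithm of the volume form of the metric pulled back by the local action. -/
def localLogVol (c : X) (q : (Fin r → ℂ) × E) : ℝ :=
  chartLogVol g c (localAct E r c q) + 2 * Real.log ‖LinearMap.det (localActD E r c q).toLinearMap‖

variable {g} (hact : IsHolomorphicAction r E X)

lemma det_hermMatrix_chartBilin_ne_zero {c : X} {z : E} (hz : z ∈ (chartAt E c).target) :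
    (hermMatrix (Module.finBasis ℂ E) (fun a b => g.chartBilin c z a b)).det ≠ 0 :=
  det_hermMatrix_ne_zero _ _ (g.chartBilin_hermitian hz) fun _ ha => g.chartBilin_pos hz ha

lemma contDiffAt_chartLogVol {c : X} {z : E} (hz : z ∈ (chartAt E c).target) :
    ContDiffAt ℝ ∞ (chartLogVol g c) z := by
  refine contDiffAt_log_norm ?_ (det_hermMatrix_chartBilin_ne_zero hz)
  refine contDiffAt_matrix_det fun j k => ?_
  have h := (g.contDiffOn_chartBilin c).contDiffAt ((chartAt E c).open_target.mem_nhds hz)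
  have hab : ∀ a b : E, ContDiffAt ℝ ∞ (fun z => g.chartBilin c z a b) z := fun a b =>
    (h.clm_apply contDiffAt_const).clm_apply contDiffAt_const
  have hof : ∀ f : E → ℝ, ContDiffAt ℝ ∞ f z → ContDiffAt ℝ ∞ (fun z => (f z : ℂ)) z :=
    fun f hf => Complex.ofRealCLM.contDiff.contDiffAt.comp z hf
  simp only [hermMatrix, Matrix.of_apply]
  exact ((hof _ ((hab _ _).add (hab _ _))).add
    (contDiffAt_const.mul (hof _ ((hab _ _).sub (hab _ _))))).div_const _

include hact

lemma contDiffAt_localLogVol {c : X} {q : (Fin r → ℂ) × E} (hq : q ∈ localDom E r c) :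
    ContDiffAt ℝ ∞ (localLogVol r g c) q := by
  refine ContDiffAt.add ?_ (contDiffAt_const.mul ?_)
  · exact (contDiffAt_chartLogVol (localAct_mem_target hq)).comp q
      (((hact.contDiffAt_localAct hq).restrict_scalars ℝ).of_le (by simp))
  · exact contDiffAt_log_norm
      (((contDiffAt_linearMap_det (hact.contDiffAt_localActD hq)).restrict_scalars ℝ).of_le (by simp))
      (hact.det_localActD_ne_zero hq)

/-- In a chart the pulled-back density splits into the chart density along the orbit, the Jacobian
of the local action, which is holomorphic, and a constant depending only on `p`. The first two
depend smoothly on `ζ` and the point jointly. -/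
lemma logVol_eq_localLogVol {c p : X} {ζ : Fin r → ℂ} (hp : p ∈ (chartAt E c).source)
    (hq : (ζ, chartAt E c p) ∈ localDom E r c) :
    logVol g p ζ = localLogVol r g c (ζ, chartAt E c p)
      + 2 * Real.log ‖LinearMap.det (chartD E c p).toLinearMap‖ := by
  set q : (Fin r → ℂ) × E := (ζ, chartAt E c p) with hqdef
  have hps : (chartAt E c).symm q.2 = p := (chartAt E c).left_inv hp
  have hy : (chartAt E c).symm (localAct E r c q) = expT ζ • p := by
    rw [chart_symm_localAct hq, hps]
  have ht : ∀ a, tang E ζ p a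
      = chartSymmD E c (localAct E r c q) (localActD E r c q (chartD E c p a)) := fun a => by
    rw [← hact.tang_chartSymmD hq, hps, hqdef, chartSymmD_chartD hp]
  have hQ : (fun a b => g.bilin (expT ζ • p) (tang E ζ p a) (tang E ζ p b))
      = fun a b => g.chartBilin c (localAct E r c q)
        (((localActD E r c q).comp (chartD E c p)) a)
        (((localActD E r c q).comp (chartD E c p)) b) := by
    funext a b
    rw [g.chartBilin_apply (localAct_mem_target hq), hy, ht, ht]
    rfl
  have hdet : LinearMap.det ((localActD E r c q).comp (chartD E c p)).toLinearMap
      = LinearMap.det (localActD E r c q).toLinearMap * LinearMap.det (chartD E c p).toLinearMap :=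
    LinearMap.det_comp _ _
  have h1 := norm_ne_zero_iff.mpr (hact.det_localActD_ne_zero hq)
  have h2 := norm_ne_zero_iff.mpr (det_chartD_ne_zero hp)
  have h3 := norm_ne_zero_iff.mpr
    (det_hermMatrix_chartBilin_ne_zero (g := g) (localAct_mem_target hq))
  unfold logVol localLogVol chartLogVol
  rw [hQ, norm_det_hermMatrix_comp _ _ (g.chartBilin_hermitian (localAct_mem_target hq)), hdet,
    norm_mul, Real.log_mul (pow_ne_zero _ (mul_ne_zero h1 h2)) h3, Real.log_pow,
    Real.log_mul h1 h2]
  push_cast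
  ring

/-- The cocycle property of the volume. -/
lemma logVol_add (p : X) (ζ ζ' : Fin r → ℂ) :
    logVol g p (ζ' + ζ) = logVol g (expT ζ • p) ζ'
      + 2 * Real.log ‖LinearMap.det (tang E ζ p).toLinearMap‖ := by
  let Q : E →L[ℝ] E →L[ℝ] ℝ := (g.bilin (expT ζ' • expT ζ • p)).bilinearComp
    ((tang E ζ' (expT ζ • p)).restrictScalars ℝ) ((tang E ζ' (expT ζ • p)).restrictScalars ℝ)
  have hQI : ∀ a b, Q (Complex.I • a) (Complex.I • b) = Q a b := fun a b => by
    simp only [Q, ContinuousLinearMap.bilinearComp_apply,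
      ContinuousLinearMap.coe_restrictScalars', map_smul]
    exact g.bilin_hermitian _ _ _
  have hQpos : ∀ a, a ≠ 0 → 0 < Q a a := fun a ha => by
    refine g.bilin_pos _ fun h => ha ?_
    have h1 := hact.tang_add (-ζ') ζ' (expT ζ • p)
    rw [neg_add_cancel, IsHolomorphicAction.tang_zero] at h1
    have h2 := congrArg (fun A : E →L[ℂ] E => A a) h1
    simp only [ContinuousLinearMap.comp_apply] at h2
    have h3 : tang E ζ' (expT ζ • p) a = 0 := h
    rw [h3, map_zero] at h2
    exact h2
  have hfun : (fun a b => g.bilin (expT (ζ' + ζ) • p) (tang E (ζ' + ζ) p a) (tang E (ζ' + ζ) p b))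
      = fun a b => Q (tang E ζ p a) (tang E ζ p b) := by
    funext a b
    rw [hact.tang_add, expT_add, mul_smul]
    rfl
  have h1 := norm_ne_zero_iff.mpr (hact.det_tang_ne_zero ζ p)
  have h2 := norm_ne_zero_iff.mpr (det_hermMatrix_ne_zero (Module.finBasis ℂ E) Q hQI hQpos)
  unfold logVol
  rw [hfun, norm_det_hermMatrix_comp _ Q hQI, Real.log_mul (pow_ne_zero _ h1) h2, Real.log_pow,
    add_comm]
  rfl

/-- Elements of `T` are isometries and drop out of the pulled-back metric. Hence `logVol g p`
depends only on the real part of its argument. -/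
lemma logVol_lieIncl_add (hg : g.IsInvariant r) (p : X) (u : Fin r → ℝ) (ζ : Fin r → ℂ) :
    logVol g p (lieIncl u + ζ) = logVol g p ζ := by
  unfold logVol
  congr 4
  funext a b
  rw [hact.tang_add, expT_add, mul_smul]
  have h := hg u (expT ζ • p) (tang E ζ p a) (tang E ζ p b)
  rw [hact.mfderiv_smul] at h
  exact h

lemma contDiffAt_logVol_zero (p : X) : ContDiffAt ℝ ∞ (logVol g p) (0 : Fin r → ℂ) := by
  have hp := mem_chart_source E p
  have hq : ((0 : Fin r → ℂ), chartAt E p p) ∈ localDom E r p :=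
    zero_mem_localDom ((chartAt E p).map_source hp)
  have h1 : ContDiffAt ℝ ∞ (fun ζ : Fin r → ℂ => localLogVol r g p (ζ, chartAt E p p)
      + 2 * Real.log ‖LinearMap.det (chartD E p p).toLinearMap‖) 0 :=
    ((contDiffAt_localLogVol hact hq).comp (0 : Fin r → ℂ)
      (contDiffAt_id.prodMk contDiffAt_const)).add contDiffAt_const
  refine h1.congr_of_eventuallyEq ?_
  have : ∀ᶠ ζ in 𝓝 (0 : Fin r → ℂ), (ζ, chartAt E p p) ∈ localDom E r p :=
    (Continuous.prodMk_left _).continuousAt.eventually_mem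
      ((hact.isOpen_localDom p).mem_nhds hq)
  filter_upwards [this] with ζ hζ
  exact logVol_eq_localLogVol hact hp hζ

/-- A chart only controls small `ζ`. The cocycle property moves the base point along the orbit,
which reduces every `ζ` to `0` up to an additive constant. -/
lemma contDiff_logVol (p : X) : ContDiff ℝ ∞ (logVol g p : (Fin r → ℂ) → ℝ) := by
  refine contDiff_iff_contDiffAt.mpr fun ζ => ?_
  have h1 : ContDiffAt ℝ ∞ (fun ζ' : Fin r → ℂ => logVol g (expT ζ • p) (ζ' - ζ)
      + 2 * Real.log ‖LinearMap.det (tang E ζ p).toLinearMap‖) ζ := by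
    refine ContDiffAt.add ?_ contDiffAt_const
    refine ContDiffAt.comp (g := logVol g (expT ζ • p)) (f := fun ζ' => ζ' - ζ) ζ ?_
      (contDiffAt_id.sub contDiffAt_const)
    rw [sub_self]
    exact contDiffAt_logVol_zero hact _
  refine h1.congr_of_eventuallyEq (.of_eq ?_)
  funext ζ'
  rw [← logVol_add hact, sub_add_cancel]

end LogVolume

lemma hasDerivAt_hermMatrix {E : Type*} [NormedAddCommGroup E] [NormedSpace ℂ E] {m : ℕ}
    (e : Module.Basis (Fin m) ℂ E) {Q : ℝ → E → E → ℝ} {Q' : E → E → ℝ} {t : ℝ}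
    (h : ∀ a b, HasDerivAt (fun s => Q s a b) (Q' a b) t) (j k : Fin m) :
    HasDerivAt (fun s => hermMatrix e (Q s) j k) (hermMatrix e Q' j k) t := by
  simp only [hermMatrix, Matrix.of_apply]
  exact ((((h _ _).add (h _ _)).ofReal_comp).add
    ((((h _ _).sub (h _ _)).ofReal_comp).const_mul Complex.I)).div_const 4

lemma hasDerivAt_bilin_comp {V : Type*} [NormedAddCommGroup V] [NormedSpace ℝ V]
    {G : V → V →L[ℝ] V →L[ℝ] ℝ} {G' : V →L[ℝ] V →L[ℝ] V →L[ℝ] ℝ} {γ x y : ℝ → V} {γ' x' y' : V}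
    {t : ℝ} (hG : HasFDerivAt G G' (γ t)) (hγ : HasDerivAt γ γ' t) (hx : HasDerivAt x x' t)
    (hy : HasDerivAt y y' t) :
    HasDerivAt (fun s => G (γ s) (x s) (y s))
      (G' γ' (x t) (y t) + G (γ t) x' (y t) + G (γ t) (x t) y') t := by
  have h1 : HasDerivAt (fun s => G (γ s)) (G' γ') t :=
    HasFDerivAt.comp_hasDerivAt (E := V →L[ℝ] V →L[ℝ] ℝ) t hG hγ
  have h2 : HasDerivAt (fun s => G (γ s) (x s)) (G' γ' (x t) + G (γ t) x') t := h1.clm_apply hx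
  have h3 : HasDerivAt (fun s => G (γ s) (x s) (y s))
      ((G' γ' (x t) + G (γ t) x') (y t) + G (γ t) (x t) y') t := h2.clm_apply hy
  exact h3

/-! ### The Laplacian of a Hamiltonian as a derivative of the volume -/

section Laplacian

variable {E X : Type*} [NormedAddCommGroup E] [NormedSpace ℂ E] [FiniteDimensional ℂ E]
    [TopologicalSpace X] [ChartedSpace E X] [IsManifold 𝓘(ℂ, E) ω X]
    {r : ℕ} [MulAction (Fin r → ℂˣ) X] {g : KahlerMetric E X}
    {μ : X → Module.Dual ℝ (Fin r → ℝ)}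

omit [FiniteDimensional ℂ E] in
lemma IsMomentMap.hasFDerivAt_chart (hμ : IsMomentMap g μ) (hact : IsHolomorphicAction r E X)
    (u : Fin r → ℝ) {c : X} {z : E} (hz : z ∈ (chartAt E c).target) :
    HasFDerivAt (fun z => μ ((chartAt E c).symm z) u)
      (g.chartBilin c z (fderiv ℂ (localAct E r c) (0, z) (-realIncl u, 0))) z := by
  have h1 := HasMFDerivAt.comp (g := fun x => μ x u) z
    (hμ.hasMFDerivAt hact u ((chartAt E c).symm z))
    (hasMFDerivAt_restrictScalars (hasMFDerivAt_chartSymmD hz))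
  have key : ∀ b, g.chartBilin c z (fderiv ℂ (localAct E r c) (0, z) (-realIncl u, 0)) b
      = -(g.bilin ((chartAt E c).symm z) (infl E ((chartAt E c).symm z) (realIncl u))
        (chartSymmD E c z b)) := fun b => by
    rw [g.chartBilin_apply hz, ← hact.infl_chart_symm hz, map_neg, map_neg]
    rfl
  exact h1.hasFDerivAt.congr_fderiv (ContinuousLinearMap.ext fun b : E => (key b).symm)

omit [FiniteDimensional ℂ E] in
lemma localActD_zero (hact : IsHolomorphicAction r E X) {c : X} {z : E}
    (hz : z ∈ (chartAt E c).target) (a : E) : localActD E r c (0, z) a = a := by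
  have h1 := hact.tang_chartSymmD (zero_mem_localDom (r := r) hz) a
  simp only [localAct_zero hz, IsHolomorphicAction.tang_zero, ContinuousLinearMap.id_apply] at h1
  rw [← chartD_chartSymmD hz (localActD E r c (0, z) a), ← h1, chartD_chartSymmD hz]

omit [FiniteDimensional ℂ E] in
/-- The derivative of the local action along a direction in the Lie algebra is a holomorphic vector
field, and its derivative is the velocity of the derivative of the action. -/
lemma IsHolomorphicAction.exists_hasFDerivAt_localAct (hact : IsHolomorphicAction r E X) {c : X}
    {z : E} (hz : z ∈ (chartAt E c).target) (w : Fin r → ℂ) :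
    ∃ A : E →L[ℂ] E, HasFDerivAt (fun y => fderiv ℂ (localAct E r c) (0, y) (w, 0)) A z ∧
      ∀ a, HasDerivAt (fun s : ℝ => localActD E r c (s • w, z) a) (A a) 0 := by
  have hq := zero_mem_localDom (r := r) hz
  set Φ := localAct E r c
  set Φ'' := fderiv ℂ (fderiv ℂ Φ) (0, z)
  have hΦ2 : HasFDerivAt (fderiv ℂ Φ) Φ'' (0, z) :=
    (((hact.contDiffAt_localAct hq).fderiv_right (m := ω) (by simp)).differentiableAt
      (by simp)).hasFDerivAt
  have hΦev : ∀ᶠ q in 𝓝 ((0 : Fin r → ℂ), z), HasFDerivAt Φ (fderiv ℂ Φ q) q := by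
    filter_upwards [(hact.isOpen_localDom c).mem_nhds hq] with q hq
    exact hact.hasFDerivAt_localAct hq
  refine ⟨(Φ''.flip (w, 0)).comp (ContinuousLinearMap.inr ℂ (Fin r → ℂ) E), ?_, fun a => ?_⟩
  · have h1 := HasFDerivAt.comp (g := fderiv ℂ Φ) z hΦ2 (hasFDerivAt_prodMk_right (0 : Fin r → ℂ) z)
    refine (h1.clm_apply (hasFDerivAt_const ((w, 0) : (Fin r → ℂ) × E) z)).congr_fderiv ?_
    ext b
    simp
  · have h1 : HasFDerivAt (fderiv ℂ Φ) (Φ''.restrictScalars ℝ) ((0 : ℝ) • w, z) := by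
      rw [zero_smul]; exact hΦ2.restrictScalars ℝ
    have hline : HasDerivAt (fun s : ℝ => ((s • w, z) : (Fin r → ℂ) × E)) (w, 0) 0 := by
      have := (hasDerivAt_id (0 : ℝ)).smul_const w
      rw [one_smul] at this
      exact this.prodMk (hasDerivAt_const 0 z)
    have h2 := h1.comp_hasDerivAt (0 : ℝ) hline
    have h3 : HasDerivAt (fun s : ℝ => fderiv ℂ Φ (s • w, z) (0, a)) (Φ'' (w, 0) (0, a)) 0 :=
      (((ContinuousLinearMap.apply ℂ E
        ((0, a) : (Fin r → ℂ) × E)).restrictScalars ℝ).hasFDerivAt).comp_hasDerivAt (0 : ℝ) h2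
    -- Differentiating first along the group and then along the manifold, or conversely, gives the
    -- same mixed derivative of the local action.
    rw [second_derivative_symmetric_of_eventually hΦev hΦ2] at h3
    exact h3

/-- The derivative of the metric along the gradient of a Hamiltonian is the `(1,1)`-part of the
Hessian of the Hamiltonian. -/
lemma IsMomentMap.hasDerivAt_pullback (hμ : IsMomentMap g μ) (hact : IsHolomorphicAction r E X)
    (u : Fin r → ℝ) {c : X} {z : E} (hz : z ∈ (chartAt E c).target) (a b : E) :
    HasDerivAt (fun s : ℝ => g.chartBilin c (localAct E r c (s • -realIncl u, z))
        (localActD E r c (s • -realIncl u, z) a) (localActD E r c (s • -realIncl u, z) b))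
      (fderiv ℝ (fderiv ℝ fun z => μ ((chartAt E c).symm z) u) z a b
        + fderiv ℝ (fderiv ℝ fun z => μ ((chartAt E c).symm z) u) z
          (Complex.I • a) (Complex.I • b)) 0 := by
  have hq := zero_mem_localDom (r := r) hz
  have ht : ∀ᶠ y in 𝓝 z, y ∈ (chartAt E c).target := (chartAt E c).open_target.mem_nhds hz
  obtain ⟨A, hA, hL⟩ := hact.exists_hasFDerivAt_localAct hz (-realIncl u)
  have hG : HasFDerivAt (g.chartBilin c) (fderiv ℝ (g.chartBilin c) z) z :=
    (((g.contDiffOn_chartBilin c).contDiffAt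
      ((chartAt E c).open_target.mem_nhds hz)).differentiableAt (by simp)).hasFDerivAt
  have hhess := hessian_add_hessian_I hG
    (.of_forall fun y => g.chartBilin_symm c y)
    (ht.mono fun y hy => g.chartBilin_hermitian hy)
    (g.fderiv_chartBilin_closed hz hG.differentiableAt) hA
    (ht.mono fun y hy => hμ.hasFDerivAt_chart hact u hy) a b
  have hline : HasDerivAt (fun s : ℝ => ((s • -realIncl u, z) : (Fin r → ℂ) × E))
      (-realIncl u, 0) 0 := by
    have := (hasDerivAt_id (0 : ℝ)).smul_const (-realIncl u)
    rw [one_smul] at this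
    exact this.prodMk (hasDerivAt_const 0 z)
  have hΦs : HasDerivAt (fun s : ℝ => localAct E r c (s • -realIncl u, z))
      (fderiv ℂ (localAct E r c) (0, z) (-realIncl u, 0)) 0 := by
    have h1 : HasFDerivAt (localAct E r c) ((fderiv ℂ (localAct E r c) (0, z)).restrictScalars ℝ)
        ((0 : ℝ) • -realIncl u, z) := by
      rw [zero_smul]; exact (hact.hasFDerivAt_localAct hq).restrictScalars ℝ
    exact h1.comp_hasDerivAt (0 : ℝ) hline
  have hG0 : HasFDerivAt (g.chartBilin c) (fderiv ℝ (g.chartBilin c) z)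
      (localAct E r c ((0 : ℝ) • -realIncl u, z)) := by
    rw [zero_smul, localAct_zero hz]; exact hG
  -- At `s = 0` the product rule gives `G' V a b + G (A a) b + G a (A b)`, the right-hand side of
  -- `hessian_add_hessian_I`.
  have h2 := hasDerivAt_bilin_comp hG0 hΦs (hL a) (hL b)
  rw [zero_smul, localAct_zero hz, localActD_zero hact hz, localActD_zero hact hz, ← hhess] at h2
  exact h2

/-- In the chart centred at `p` the differential of the chart at `p` is the identity, so the
matrices are exactly those whose entries are differentiated in `IsMomentMap.hasDerivAt_pullback`. -/
lemma logVol_eventuallyEq (hact : IsHolomorphicAction r E X) (p : X) :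
    (logVol g p : (Fin r → ℂ) → ℝ) =ᶠ[𝓝 0] fun ζ => Real.log ‖(hermMatrix (Module.finBasis ℂ E)
      (fun a b => g.chartBilin p (localAct E r p (ζ, chartAt E p p))
        (localActD E r p (ζ, chartAt E p p) a) (localActD E r p (ζ, chartAt E p p) b))).det‖ := by
  have hz : chartAt E p p ∈ (chartAt E p).target :=
    (chartAt E p).map_source (mem_chart_source E p)
  have hzp : (chartAt E p).symm (chartAt E p p) = p :=
    (chartAt E p).left_inv (mem_chart_source E p)
  have hchart : chartSymmD E p (chartAt E p p) = ContinuousLinearMap.id ℂ E := chartSymmD_self p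
  have h1 : ∀ᶠ ζ in 𝓝 (0 : Fin r → ℂ), (ζ, chartAt E p p) ∈ localDom E r p :=
    (Continuous.prodMk_left _).continuousAt.eventually_mem
      ((hact.isOpen_localDom p).mem_nhds (zero_mem_localDom hz))
  filter_upwards [h1] with ζ hζ
  have ht : ∀ a, tang E ζ p a = chartSymmD E p (localAct E r p (ζ, chartAt E p p))
      (localActD E r p (ζ, chartAt E p p) a) := fun a => by
    have h := hact.tang_chartSymmD hζ a
    simp only [hchart, hzp, ContinuousLinearMap.id_apply] at h
    exact h
  have hy : (chartAt E p).symm (localAct E r p (ζ, chartAt E p p)) = expT ζ • p := by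
    have h := chart_symm_localAct hζ
    simp only [hzp] at h
    exact h
  have hfun : (fun a b => g.bilin (expT ζ • p) (tang E ζ p a) (tang E ζ p b))
      = fun a b => g.chartBilin p (localAct E r p (ζ, chartAt E p p))
        (localActD E r p (ζ, chartAt E p p) a) (localActD E r p (ζ, chartAt E p p) b) := by
    funext a b
    rw [g.chartBilin_apply (localAct_mem_target hζ), ht, ht, hy]
  unfold logVol
  rw [hfun]

/-- The derivative of the volume along the gradient of a Hamiltonian is its Laplacian. -/
theorem fderiv_logVol_eq_laplacian (hact : IsHolomorphicAction r E X) (hμ : IsMomentMap g μ)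
    (u : Fin r → ℝ) (p : X) :
    fderiv ℝ (logVol g p : (Fin r → ℂ) → ℝ) 0 (realIncl u)
      = 2 * g.laplacian (fun x => μ x u) p := by
  have hz : chartAt E p p ∈ (chartAt E p).target :=
    (chartAt E p).map_source (mem_chart_source E p)
  have hself : g.chartBilin p (chartAt E p p) = g.bilin p := g.chartBilin_self p
  have h0 : (fun a b => g.chartBilin p (localAct E r p ((0 : ℝ) • -realIncl u, chartAt E p p))
      (localActD E r p ((0 : ℝ) • -realIncl u, chartAt E p p) a)
      (localActD E r p ((0 : ℝ) • -realIncl u, chartAt E p p) b)) = fun a b => g.bilin p a b := by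
    funext a b
    rw [zero_smul, localAct_zero hz, localActD_zero hact hz, localActD_zero hact hz, hself]
  have hne : (hermMatrix (Module.finBasis ℂ E) (fun a b => g.bilin p a b)).det ≠ 0 :=
    det_hermMatrix_ne_zero _ _ (g.bilin_hermitian p) fun _ ha => g.bilin_pos p ha
  have hdet := hasDerivAt_log_norm_det
    (hasDerivAt_hermMatrix (Module.finBasis ℂ E) (hμ.hasDerivAt_pullback hact u hz))
    (by rw [h0]; exact hne)
  have hlin : HasDerivAt (fun s : ℝ => s • -realIncl u) (-realIncl u) 0 := by
    simpa using (hasDerivAt_id (0 : ℝ)).smul_const (-realIncl u)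
  have hd1 : HasDerivAt (fun s : ℝ => logVol g p (s • -realIncl u))
      (fderiv ℝ (logVol g p : (Fin r → ℂ) → ℝ) 0 (-realIncl u)) 0 := by
    have h1 : HasFDerivAt (logVol g p : (Fin r → ℂ) → ℝ) (fderiv ℝ (logVol g p) 0)
        ((0 : ℝ) • -realIncl u) := by
      rw [zero_smul]
      exact ((contDiff_logVol hact p).differentiable (by simp) 0).hasFDerivAt
    exact h1.comp_hasDerivAt (0 : ℝ) hlin
  have hev := (show Tendsto (fun s : ℝ => s • -realIncl u) (𝓝 0) (𝓝 0) by
    simpa using hlin.continuousAt.tendsto).eventually (logVol_eventuallyEq (g := g) hact p)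
  have hfin := (hd1.congr_of_eventuallyEq (EventuallyEq.symm hev)).unique hdet
  -- The sign of the gradient direction `-realIncl u` cancels the sign in the definition of the
  -- Laplacian.
  rw [map_neg, h0, hermMatrix_add_I, Matrix.mul_smul, Matrix.trace_smul] at hfin
  rw [neg_eq_iff_eq_neg.mp hfin]
  unfold KahlerMetric.laplacian
  simp only [smul_eq_mul, Complex.mul_re, Complex.re_ofNat, Complex.im_ofNat, zero_mul, sub_zero]
  rw [mul_neg]
  rfl

end Laplacian

lemma fderiv_fderiv_apply {V : Type*} [NormedAddCommGroup V] [NormedSpace ℝ V] {f : V → ℝ} {x : V}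
    (hf : ContDiffAt ℝ 2 f x) (v w : V) :
    fderiv ℝ (fun y => fderiv ℝ f y w) x v = fderiv ℝ (fderiv ℝ f) x v w := by
  have h1 : DifferentiableAt ℝ (fderiv ℝ f) x :=
    (hf.fderiv_right (m := 1) (by norm_num)).differentiableAt (by simp)
  rw [(h1.hasFDerivAt.clm_apply (hasFDerivAt_const w x)).fderiv]
  simp

lemma fderiv_fderiv_add {V : Type*} [NormedAddCommGroup V] [NormedSpace ℝ V] {f h : V → ℝ} {x : V}
    (hf : ContDiffAt ℝ 2 f x) (hh : ContDiffAt ℝ 2 h x) :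
    fderiv ℝ (fderiv ℝ fun y => f y + h y) x
      = fderiv ℝ (fderiv ℝ f) x + fderiv ℝ (fderiv ℝ h) x := by
  have hf1 : DifferentiableAt ℝ (fderiv ℝ f) x :=
    (hf.fderiv_right (m := 1) (by norm_num)).differentiableAt (by simp)
  have hh1 : DifferentiableAt ℝ (fderiv ℝ h) x :=
    (hh.fderiv_right (m := 1) (by norm_num)).differentiableAt (by simp)
  have hev : fderiv ℝ (fun y => f y + h y) =ᶠ[𝓝 x] fun y => fderiv ℝ f y + fderiv ℝ h y := by
    filter_upwards [hf.eventually (by simp), hh.eventually (by simp)] with y h1 h2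
    exact fderiv_fun_add (h1.differentiableAt (by simp)) (h2.differentiableAt (by simp))
  rw [hev.fderiv_eq]
  exact fderiv_fun_add hf1 hh1

lemma fderiv_fderiv_add_const {V : Type*} [NormedAddCommGroup V] [NormedSpace ℝ V] (f : V → ℝ)
    (a : ℝ) (x : V) :
    fderiv ℝ (fderiv ℝ fun y => f y + a) x = fderiv ℝ (fderiv ℝ f) x := by
  congr 1
  funext y
  exact fderiv_add_const a

/-- The logarithm of the norm of a holomorphic function without zeros is harmonic. -/
lemma fderiv_fderiv_log_norm {h : ℂ → ℂ} {τ : ℂ} (hh : AnalyticAt ℂ h τ) (h0 : h τ ≠ 0) :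
    fderiv ℝ (fderiv ℝ fun t => Real.log ‖h t‖) τ 1 1
      + fderiv ℝ (fderiv ℝ fun t => Real.log ‖h t‖) τ Complex.I Complex.I = 0 := by
  set k : ℂ → ℂ := fun t => Complex.log (h t / h τ) with hk
  have hka : AnalyticAt ℂ k τ := (hh.div_const).clog (by simp [h0])
  have hev : (fun t => Real.log ‖h t‖) =ᶠ[𝓝 τ] fun t => Complex.reCLM (k t) + Real.log ‖h τ‖ := by
    filter_upwards [hh.continuousAt.eventually_ne h0] with t ht
    rw [Complex.reCLM_apply, hk, Complex.log_re, norm_div, Real.log_div (norm_ne_zero_iff.mpr ht)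
      (norm_ne_zero_iff.mpr h0)]
    ring
  have hre : fderiv ℝ (fderiv ℝ Complex.reCLM) (k τ) = 0 := by
    have : fderiv ℝ Complex.reCLM = fun _ => Complex.reCLM := by
      funext y; exact Complex.reCLM.fderiv
    rw [this]
    exact fderiv_const_apply _
  have hd := fderiv_fderiv_comp_holomorphic (F := Complex.reCLM)
    Complex.reCLM.contDiff.contDiffAt hka
  rw [hre] at hd
  rw [hev.fderiv.fderiv_eq, fderiv_fderiv_add_const, hd]
  simp

lemma eventually_norm_sub_lt {Y W : Type*} [TopologicalSpace Y] [NormedAddCommGroup W] {f : Y → W}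
    {y : Y} (hf : ContinuousAt f y) {δ : ℝ} (hδ : 0 < δ) : ∀ᶠ x in 𝓝 y, ‖f x - f y‖ < δ :=
  (hf.eventually_mem (Metric.ball_mem_nhds _ hδ)).mono fun _ hx => mem_ball_iff_norm.mp hx

lemma eventually_norm_lt {Y W : Type*} [TopologicalSpace Y] [NormedAddCommGroup W] {f : Y → W}
    {y : Y} (hf : ContinuousAt f y) : ∀ᶠ x in 𝓝 y, ‖f x‖ < ‖f y‖ + 1 :=
  hf.norm.eventually_lt continuousAt_const (lt_add_one _)

/-! ### The second derivative of the volume and its uniform bound -/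

section Ricci

variable {E X : Type*} [NormedAddCommGroup E] [NormedSpace ℂ E] [FiniteDimensional ℂ E]
    [TopologicalSpace X] [ChartedSpace E X] [IsManifold 𝓘(ℂ, E) ω X]
    {r : ℕ} [MulAction (Fin r → ℂˣ) X] {g : KahlerMetric E X}
    {μ : X → Module.Dual ℝ (Fin r → ℝ)}

omit [FiniteDimensional ℂ E] in
lemma analyticAt_line {V : Type*} [NormedAddCommGroup V] [NormedSpace ℂ V] [CompleteSpace V]
    {F : (Fin r → ℂ) × E → V} {v : Fin r → ℂ} {z : E} (hF : ContDiffAt ℂ ω F (0, z)) :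
    AnalyticAt ℂ (fun τ : ℂ => F (τ • v, z)) 0 := by
  have h1 : ContDiffAt ℂ ω F ((0 : ℂ) • v, z) := by rwa [zero_smul]
  have h2 : ContDiffAt ℂ ω (fun τ : ℂ => ((τ • v, z) : (Fin r → ℂ) × E)) 0 :=
    (contDiffAt_id.smul contDiffAt_const).prodMk contDiffAt_const
  exact ContDiffAt.analyticAt (ContDiffAt.comp (g := F) (0 : ℂ) h1 h2)

/-- The second derivative of the volume along a real direction is given by the complex Hessian of
the volume in a chart. -/
lemma fderiv_fderiv_logVol (hact : IsHolomorphicAction r E X) (hg : g.IsInvariant r) {c p : X}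
    (hp : p ∈ (chartAt E c).source) (u : Fin r → ℝ) :
    fderiv ℝ (fderiv ℝ (logVol g p)) 0 (realIncl u) (realIncl u)
      = fderiv ℝ (fderiv ℝ (chartLogVol g c)) (chartAt E c p)
          (fderiv ℂ (localAct E r c) (0, chartAt E c p) (realIncl u, 0))
          (fderiv ℂ (localAct E r c) (0, chartAt E c p) (realIncl u, 0))
        + fderiv ℝ (fderiv ℝ (chartLogVol g c)) (chartAt E c p)
          (Complex.I • fderiv ℂ (localAct E r c) (0, chartAt E c p) (realIncl u, 0))
          (Complex.I • fderiv ℂ (localAct E r c) (0, chartAt E c p) (realIncl u, 0)) := by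
  have : CompleteSpace E := FiniteDimensional.complete ℂ E
  set z := chartAt E c p with hzdef
  set v := realIncl u with hv
  have hz : z ∈ (chartAt E c).target := (chartAt E c).map_source hp
  have hq := zero_mem_localDom (r := r) hz
  set f : ℂ → ℝ := fun τ => logVol g p (τ • v) with hf
  set γ : ℂ → E := fun τ => localAct E r c (τ • v, z) with hγ
  set h : ℂ → ℂ := fun τ => LinearMap.det (localActD E r c (τ • v, z)).toLinearMap with hh
  have hγa : AnalyticAt ℂ γ 0 := analyticAt_line (hact.contDiffAt_localAct hq)
  have hha : AnalyticAt ℂ h 0 :=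
    analyticAt_line (F := fun q => LinearMap.det (localActD E r c q).toLinearMap)
      (contDiffAt_linearMap_det (hact.contDiffAt_localActD hq))
  have hγ0 : γ 0 = z := by simp only [hγ, zero_smul, localAct_zero hz]
  have hh0 : h 0 ≠ 0 := by
    simp only [hh, zero_smul]
    exact hact.det_localActD_ne_zero hq
  have hγ' : deriv γ 0 = fderiv ℂ (localAct E r c) (0, z) (v, 0) := by
    have h1 : HasFDerivAt (localAct E r c) (fderiv ℂ (localAct E r c) (0, z)) ((0 : ℂ) • v, z) := by
      rw [zero_smul]; exact hact.hasFDerivAt_localAct hq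
    have h2 : HasDerivAt (fun τ : ℂ => ((τ • v, z) : (Fin r → ℂ) × E)) (v, 0) 0 := by
      have := (hasDerivAt_id (0 : ℂ)).smul_const v
      rw [one_smul] at this
      exact this.prodMk (hasDerivAt_const 0 z)
    exact (h1.comp_hasDerivAt (0 : ℂ) h2).deriv
  have hline : Continuous fun τ : ℂ => ((τ • v, z) : (Fin r → ℂ) × E) := by fun_prop
  -- Besides the chart density there are only logarithms of `|h|` with `h` holomorphic, which are
  -- harmonic, and a constant. Neither contributes to the complex Hessian.
  have hev : f =ᶠ[𝓝 0] fun τ => (chartLogVol g c (γ τ) + (Real.log ‖h τ‖ + Real.log ‖h τ‖))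
      + 2 * Real.log ‖LinearMap.det (chartD E c p).toLinearMap‖ := by
    have : ∀ᶠ τ in 𝓝 (0 : ℂ), (τ • v, z) ∈ localDom E r c :=
      hline.continuousAt.eventually_mem
        ((hact.isOpen_localDom c).mem_nhds (by rwa [zero_smul]))
    filter_upwards [this] with τ hτ
    rw [hf]
    beta_reduce
    rw [logVol_eq_localLogVol hact hp hτ, localLogVol, two_mul (Real.log ‖LinearMap.det _‖)]
  have hℓ : ContDiffAt ℝ 2 (chartLogVol g c) (γ 0) := by
    rw [hγ0]; exact (contDiffAt_chartLogVol hz).of_le ENat.LEInfty.out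
  have hc1 : ContDiffAt ℝ 2 (fun τ => chartLogVol g c (γ τ)) 0 :=
    hℓ.comp (0 : ℂ) (hγa.contDiffAt.restrict_scalars ℝ)
  have hc2 : ContDiffAt ℝ 2 (fun τ => Real.log ‖h τ‖) 0 :=
    contDiffAt_log_norm (hha.contDiffAt.restrict_scalars ℝ) hh0
  have hsum : fderiv ℝ (fderiv ℝ f) 0 1 1 + fderiv ℝ (fderiv ℝ f) 0 Complex.I Complex.I
      = fderiv ℝ (fderiv ℝ (chartLogVol g c)) z (deriv γ 0) (deriv γ 0)
        + fderiv ℝ (fderiv ℝ (chartLogVol g c)) z (Complex.I • deriv γ 0) (Complex.I • deriv γ 0) := by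
    rw [hev.fderiv.fderiv_eq, fderiv_fderiv_add_const, fderiv_fderiv_add hc1 (hc2.add hc2),
      fderiv_fderiv_add hc2 hc2]
    have h1 := fderiv_fderiv_comp_holomorphic hℓ hγa
    have h2 := fderiv_fderiv_log_norm hha hh0
    rw [hγ0] at h1
    simp only [add_apply]
    linarith
  have hLd := contDiff_logVol (g := g) hact p
  have hfd : ∀ τ w : ℂ, fderiv ℝ f τ w = fderiv ℝ (logVol g p) (τ • v) (w • v) := fun τ w => by
    have h1 := (hLd.differentiable (by simp) (τ • v)).hasFDerivAt
    have h2 : HasFDerivAt (fun τ : ℂ => τ • v)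
        ((ContinuousLinearMap.toSpanSingleton ℂ v).restrictScalars ℝ) τ :=
      (ContinuousLinearMap.toSpanSingleton ℂ v).hasFDerivAt.restrictScalars ℝ
    have h3 : HasFDerivAt f _ τ := HasFDerivAt.comp (g := logVol g p) τ h1 h2
    rw [h3.fderiv]
    rfl
  have hfC : ContDiff ℝ 2 f :=
    (hLd.of_le ENat.LEInfty.out).comp (contDiff_id.smul contDiff_const)
  -- By `T`-invariance `f` does not depend on the imaginary part of `τ`, so its Laplacian reduces to
  -- the second derivative in the real direction.
  have hII : fderiv ℝ (fderiv ℝ f) 0 Complex.I Complex.I = 0 := by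
    rw [← fderiv_fderiv_apply hfC.contDiffAt]
    have h1 : (fun τ => fderiv ℝ f τ Complex.I) = fun _ => 0 := by
      funext τ
      have hd := ((hfC.differentiable (by simp) τ).hasFDerivAt).hasLineDerivAt Complex.I
      have hconst : (fun t : ℝ => f (τ + t • Complex.I)) = fun _ => f τ := by
        funext t
        have h2 : (τ + t • Complex.I) • v = lieIncl (t • u) + τ • v := by
          rw [add_smul, add_comm, lieIncl_eq, realIncl_smul, smul_smul, hv]
          congr 2
          rw [Complex.real_smul, mul_comm]
        rw [hf]
        beta_reduce
        rw [h2, logVol_lieIncl_add hact hg]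
      have h3 : HasDerivAt (fun t : ℝ => f (τ + t • Complex.I)) (fderiv ℝ f τ Complex.I) 0 := hd
      rw [hconst] at h3
      exact h3.unique (hasDerivAt_const (0 : ℝ) (f τ))
    rw [h1]
    simp
  have h11 : fderiv ℝ (fderiv ℝ f) 0 1 1 = fderiv ℝ (fderiv ℝ (logVol g p)) 0 v v := by
    rw [← fderiv_fderiv_apply hfC.contDiffAt,
      ← fderiv_fderiv_apply (hLd.of_le ENat.LEInfty.out).contDiffAt]
    have h1 : (fun τ => fderiv ℝ f τ 1) = fun τ : ℂ => fderiv ℝ (logVol g p) (τ • v) v := by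
      funext τ; rw [hfd, one_smul]
    have h2 : HasFDerivAt (fun τ : ℂ => τ • v)
        ((ContinuousLinearMap.toSpanSingleton ℂ v).restrictScalars ℝ) 0 :=
      (ContinuousLinearMap.toSpanSingleton ℂ v).hasFDerivAt.restrictScalars ℝ
    have h3 : DifferentiableAt ℝ (fun ζ => fderiv ℝ (logVol g p) ζ v) ((0 : ℂ) • v) :=
      ((hLd.fderiv_right (m := ∞) (by simp)).clm_apply contDiff_const).differentiable (by simp) _
    have h4 : HasFDerivAt (fun τ : ℂ => fderiv ℝ (logVol g p) (τ • v) v) _ 0 :=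
      HasFDerivAt.comp (g := fun ζ => fderiv ℝ (logVol g p) ζ v) (0 : ℂ) h3.hasFDerivAt h2
    rw [h1, h4.fderiv, zero_smul]
    simp
  rw [hII, add_zero, h11, hγ'] at hsum
  exact hsum

/-- A continuous field of positive definite forms bounds the norm locally uniformly. -/
lemma exists_norm_sq_le_of_pos {V : Type*} [NormedAddCommGroup V] [NormedSpace ℝ V]
    [FiniteDimensional ℝ V] {G : V → V →L[ℝ] V →L[ℝ] ℝ} {z : V} (hG : ContinuousAt G z)
    (hpos : ∀ a, a ≠ 0 → 0 < G z a a) :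
    ∃ K, 0 ≤ K ∧ ∀ᶠ y in 𝓝 z, ∀ a, ‖a‖ ^ 2 ≤ K * G y a a := by
  have : ProperSpace V := FiniteDimensional.proper ℝ V
  obtain ⟨m, hm, hmb⟩ : ∃ m, 0 < m ∧ ∀ a, ‖a‖ = 1 → m ≤ G z a a := by
    rcases (Metric.sphere (0 : V) 1).eq_empty_or_nonempty with he | hne
    · refine ⟨1, one_pos, fun a ha => ?_⟩
      have : a ∈ Metric.sphere (0 : V) 1 := by simpa using ha
      rw [he] at this
      exact this.elim
    · have hcont : Continuous fun a => G z a a := by fun_prop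
      obtain ⟨a₀, ha₀, hmin⟩ := (isCompact_sphere (0 : V) 1).exists_isMinOn hne hcont.continuousOn
      refine ⟨G z a₀ a₀, hpos _ fun h => ?_, fun a ha => hmin (by simpa using ha)⟩
      rw [h] at ha₀
      simp at ha₀
  have hm2 : ∀ a, m * ‖a‖ ^ 2 ≤ G z a a := fun a => by
    rcases eq_or_ne a 0 with rfl | ha
    · simp
    · have hn : ‖a‖ ≠ 0 := norm_ne_zero_iff.mpr ha
      have h1 := hmb (‖a‖⁻¹ • a) (by rw [norm_smul, norm_inv, norm_norm, inv_mul_cancel₀ hn])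
      rw [map_smul, map_smul, smul_apply, smul_eq_mul, smul_eq_mul] at h1
      have h2 : G z a a = ‖a‖ ^ 2 * (‖a‖⁻¹ * (‖a‖⁻¹ * G z a a)) := by field_simp
      rw [h2, mul_comm]
      exact mul_le_mul_of_nonneg_left h1 (by positivity)
  refine ⟨2 / m, by positivity, ?_⟩
  have hnear : ∀ᶠ y in 𝓝 z, ‖G y - G z‖ < m / 2 :=
    eventually_norm_sub_lt (W := V →L[ℝ] V →L[ℝ] ℝ) hG (half_pos hm)
  filter_upwards [hnear] with y hy a
  have h1 : |(G y - G z) a a| ≤ m / 2 * ‖a‖ ^ 2 := by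
    calc |(G y - G z) a a| ≤ ‖G y - G z‖ * ‖a‖ * ‖a‖ := (G y - G z).le_opNorm₂ a a
      _ ≤ m / 2 * ‖a‖ * ‖a‖ := by gcongr
      _ = m / 2 * ‖a‖ ^ 2 := by ring
  have h2 := (abs_le.mp h1).1
  simp only [sub_apply] at h2
  have h3 := hm2 a
  have h4 : m / 2 * ‖a‖ ^ 2 ≤ G y a a := by linarith
  calc ‖a‖ ^ 2 = 2 / m * (m / 2 * ‖a‖ ^ 2) := by field_simp
    _ ≤ 2 / m * G y a a := mul_le_mul_of_nonneg_left h4 (by positivity)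

/-- The complex Hessian of the chart density is continuous, hence locally bounded, and it is
evaluated on the vector representing `infl E p (realIncl u)` in the chart. Thus the bound involves
the length of that vector rather than the size of `u`, and stays comparable to the growth of `H_u`
near fixed points. -/
lemma exists_bound_near (hact : IsHolomorphicAction r E X) (hg : g.IsInvariant r) (c : X) :
    ∃ K, 0 ≤ K ∧ ∀ᶠ p in 𝓝 c, ∀ u : Fin r → ℝ,
      |fderiv ℝ (fderiv ℝ (logVol g p)) 0 (realIncl u) (realIncl u)|
        ≤ K * g.bilin p (infl E p (realIncl u)) (infl E p (realIncl u)) := by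
  have : FiniteDimensional ℝ E := FiniteDimensional.complexToReal E
  have hz : chartAt E c c ∈ (chartAt E c).target :=
    (chartAt E c).map_source (mem_chart_source E c)
  obtain ⟨K, hK, hKb⟩ := exists_norm_sq_le_of_pos
    ((g.contDiffOn_chartBilin c).continuousOn.continuousAt
      ((chartAt E c).open_target.mem_nhds hz)) fun a ha => g.chartBilin_pos hz ha
  have hℓ : ContinuousAt (fderiv ℝ (fderiv ℝ (chartLogVol g c))) (chartAt E c c) :=
    (((contDiffAt_chartLogVol hz).fderiv_right (m := ∞) (by simp)).fderiv_right (m := ∞)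
      (by simp)).continuousAt
  have hM : ∀ᶠ y in 𝓝 (chartAt E c c), ‖fderiv ℝ (fderiv ℝ (chartLogVol g c)) y‖
      < ‖fderiv ℝ (fderiv ℝ (chartLogVol g c)) (chartAt E c c)‖ + 1 :=
    eventually_norm_lt (W := E →L[ℝ] E →L[ℝ] ℝ) hℓ
  set M := ‖fderiv ℝ (fderiv ℝ (chartLogVol g c)) (chartAt E c c)‖ + 1
  have hM0 : 0 ≤ M := by positivity
  refine ⟨2 * M * K, by positivity, ?_⟩
  have hφ : ContinuousAt (chartAt E c) c := (chartAt E c).continuousAt (mem_chart_source E c)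
  filter_upwards [chart_source_mem_nhds E c, hφ.eventually hKb, hφ.eventually hM] with p hp h1 h2 u
  rw [fderiv_fderiv_logVol hact hg hp]
  set a := fderiv ℂ (localAct E r c) (0, chartAt E c p) (realIncl u, 0) with ha
  have h3 : g.bilin p (infl E p (realIncl u)) (infl E p (realIncl u))
      = g.chartBilin c (chartAt E c p) a a := by
    have hzp := (chartAt E c).map_source hp
    rw [g.chartBilin_apply hzp, ha, ← hact.infl_chart_symm hzp, (chartAt E c).left_inv hp]
  have h4 : ∀ b : E, |fderiv ℝ (fderiv ℝ (chartLogVol g c)) (chartAt E c p) b b| ≤ M * ‖b‖ ^ 2 :=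
    fun b => by
      calc _ ≤ ‖fderiv ℝ (fderiv ℝ (chartLogVol g c)) (chartAt E c p)‖ * ‖b‖ * ‖b‖ :=
            (fderiv ℝ (fderiv ℝ (chartLogVol g c)) (chartAt E c p)).le_opNorm₂ b b
        _ ≤ M * ‖b‖ * ‖b‖ := by gcongr
        _ = M * ‖b‖ ^ 2 := by ring
  rw [h3]
  have h5 := h4 a
  have h6 := h4 (Complex.I • a)
  rw [norm_smul, Complex.norm_I, one_mul] at h6
  calc _ ≤ M * ‖a‖ ^ 2 + M * ‖a‖ ^ 2 := (abs_add_le _ _).trans (add_le_add h5 h6)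
    _ = 2 * M * ‖a‖ ^ 2 := by ring
    _ ≤ 2 * M * (K * g.chartBilin c (chartAt E c p) a a) :=
        mul_le_mul_of_nonneg_left (h1 a) (by positivity)
    _ = _ := by ring

/-- The Ricci form of a compact Kähler manifold is bounded in terms of the metric. -/
theorem exists_bound [CompactSpace X] (hact : IsHolomorphicAction r E X) (hg : g.IsInvariant r) :
    ∃ K, 0 ≤ K ∧ ∀ (p : X) (u : Fin r → ℝ),
      |fderiv ℝ (fderiv ℝ (logVol g p)) 0 (realIncl u) (realIncl u)|
        ≤ K * g.bilin p (infl E p (realIncl u)) (infl E p (realIncl u)) := by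
  have h := isCompact_univ.induction_on (X := X) (p := fun s => ∃ K, 0 ≤ K ∧ ∀ p ∈ s,
      ∀ u : Fin r → ℝ, |fderiv ℝ (fderiv ℝ (logVol g p)) 0 (realIncl u) (realIncl u)|
        ≤ K * g.bilin p (infl E p (realIncl u)) (infl E p (realIncl u)))
    ⟨0, le_rfl, fun p hp => hp.elim⟩
    (fun s t hst ⟨K, hK, h⟩ => ⟨K, hK, fun p hp => h p (hst hp)⟩)
    (fun s t ⟨K, hK, h⟩ ⟨K', hK', h'⟩ => ⟨max K K', le_max_of_le_left hK, fun p hp u =>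
      hp.elim
        (fun hp => (h p hp u).trans
          (mul_le_mul_of_nonneg_right (le_max_left _ _) (g.bilin_nonneg _ _)))
        (fun hp => (h' p hp u).trans
          (mul_le_mul_of_nonneg_right (le_max_right _ _) (g.bilin_nonneg _ _)))⟩)
    (fun c _ => by
      obtain ⟨K, hK, hev⟩ := exists_bound_near hact hg c
      exact ⟨_, nhdsWithin_le_nhds hev, K, hK, fun p hp => hp⟩)
  obtain ⟨K, hK, h⟩ := h
  exact ⟨K, hK, fun p => h p (mem_univ p)⟩

/-- The definition uses a different chart at each point. Near `c` the Laplacian is half a derivative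
of `localLogVol` in the single chart at `c`, which is jointly smooth. -/
lemma continuous_laplacian (hact : IsHolomorphicAction r E X) (hμ : IsMomentMap g μ)
    (u : Fin r → ℝ) : Continuous (g.laplacian fun x => μ x u) := by
  refine continuous_iff_continuousAt.mpr fun c => ?_
  have hz : chartAt E c c ∈ (chartAt E c).target :=
    (chartAt E c).map_source (mem_chart_source E c)
  have hc : ContinuousAt (fun p => (1 / 2 : ℝ) *
      fderiv ℝ (localLogVol r g c) (0, chartAt E c p) (realIncl u, 0)) c := by
    have h1 : ContinuousAt (fderiv ℝ (localLogVol r g c)) ((0 : Fin r → ℂ), chartAt E c c) :=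
      ((contDiffAt_localLogVol hact (zero_mem_localDom hz)).fderiv_right (m := ∞)
        (by simp)).continuousAt
    have h2 : ContinuousAt (fun p => ((0 : Fin r → ℂ), chartAt E c p)) c :=
      continuousAt_const.prodMk ((chartAt E c).continuousAt (mem_chart_source E c))
    have h3 : ContinuousAt (fun p => fderiv ℝ (localLogVol r g c) (0, chartAt E c p)) c :=
      ContinuousAt.comp (g := fderiv ℝ (localLogVol r g c))
        (f := fun p => ((0 : Fin r → ℂ), chartAt E c p)) h1 h2
    exact continuousAt_const.mul (h3.clm_apply continuousAt_const)
  refine hc.congr ?_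
  filter_upwards [chart_source_mem_nhds E c] with p hp
  have hzp := (chartAt E c).map_source hp
  have hq := zero_mem_localDom (r := r) hzp
  have h1 : (logVol g p : (Fin r → ℂ) → ℝ) =ᶠ[𝓝 0] fun ζ => localLogVol r g c (ζ, chartAt E c p)
      + 2 * Real.log ‖LinearMap.det (chartD E c p).toLinearMap‖ := by
    have : ∀ᶠ ζ in 𝓝 (0 : Fin r → ℂ), (ζ, chartAt E c p) ∈ localDom E r c :=
      (Continuous.prodMk_left _).continuousAt.eventually_mem
        ((hact.isOpen_localDom c).mem_nhds hq)
    filter_upwards [this] with ζ hζ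
    exact logVol_eq_localLogVol hact hp hζ
  have h2 : HasFDerivAt (localLogVol r g c)
      (fderiv ℝ (localLogVol r g c) (0, chartAt E c p)) (0, chartAt E c p) :=
    ((contDiffAt_localLogVol hact hq).differentiableAt (by simp)).hasFDerivAt
  have h3 := (HasFDerivAt.comp (g := localLogVol r g c) (0 : Fin r → ℂ) h2
    (hasFDerivAt_prodMk_left (𝕜 := ℝ) (0 : Fin r → ℂ) (chartAt E c p))).add_const
    (2 * Real.log ‖LinearMap.det (chartD E c p).toLinearMap‖)
  have h4 := (h3.congr_of_eventuallyEq h1).fderiv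
  have h5 := fderiv_logVol_eq_laplacian hact hμ u p
  rw [h4] at h5
  have h6 : fderiv ℝ (localLogVol r g c) (0, chartAt E c p) (realIncl u, 0)
      = 2 * g.laplacian (fun x => μ x u) p := by
    rw [← h5]; simp
  rw [h6]
  ring

/-- The Laplacian of a Hamiltonian on an orbit is a derivative of the volume. -/
lemma laplacian_orbit (hact : IsHolomorphicAction r E X) (hμ : IsMomentMap g μ)
    (u : Fin r → ℝ) (p : X) (ζ : Fin r → ℂ) :
    g.laplacian (fun x => μ x u) (expT ζ • p) = 1 / 2 * fderiv ℝ (logVol g p) ζ (realIncl u) := by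
  have h1 : (logVol g p : (Fin r → ℂ) → ℝ) = fun ζ' => logVol g (expT ζ • p) (ζ' - ζ)
      + 2 * Real.log ‖LinearMap.det (tang E ζ p).toLinearMap‖ := by
    funext ζ'
    rw [← logVol_add hact, sub_add_cancel]
  rw [h1, fderiv_add_const, fderiv_comp_sub, sub_self, fderiv_logVol_eq_laplacian hact hμ]
  ring

lemma fderiv_fderiv_logVol_orbit (hact : IsHolomorphicAction r E X) (p : X) (ζ : Fin r → ℂ) :
    fderiv ℝ (fderiv ℝ (logVol g p)) ζ = fderiv ℝ (fderiv ℝ (logVol g (expT ζ • p))) 0 := by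
  have h1 : fderiv ℝ (logVol g p : (Fin r → ℂ) → ℝ)
      = fun ζ' => fderiv ℝ (logVol g (expT ζ • p)) (ζ' - ζ) := by
    funext ζ''
    have h1 : (logVol g p : (Fin r → ℂ) → ℝ) = fun ζ' => logVol g (expT ζ • p) (ζ' - ζ)
        + 2 * Real.log ‖LinearMap.det (tang E ζ p).toLinearMap‖ := by
      funext ζ'
      rw [← logVol_add hact, sub_add_cancel]
    rw [h1, fderiv_add_const, fderiv_comp_sub]
  rw [h1, fderiv_comp_sub (f := fderiv ℝ (logVol g (expT ζ • p))), sub_self]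

end Ricci

/-! ### Duality and critical points of convex functions -/

section LinearAlgebra

variable {V : Type*} [AddCommGroup V] [Module ℝ V]

/-- An inner product as a bilinear form. -/
def coreBilin (ip : InnerProductSpace.Core ℝ V) : LinearMap.BilinForm ℝ V :=
  LinearMap.mk₂ ℝ ip.inner ip.add_left (fun c m n => ip.smul_left m n c)
    (fun m n n' => by
      have h (a b : V) : ip.inner a b = ip.inner b a := by simpa using (ip.conj_inner_symm a b).symm
      rw [h, ip.add_left, h n, h n'])
    (fun c m n => by
      have h (a b : V) : ip.inner a b = ip.inner b a := by simpa using (ip.conj_inner_symm a b).symm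
      rw [h, ip.smul_left, h n]; rfl)

lemma coreBilin_comm (ip : InnerProductSpace.Core ℝ V) (m n : V) :
    coreBilin ip m n = coreBilin ip n m := (ip.conj_inner_symm m n).symm

lemma coreBilin_nondegenerate (ip : InnerProductSpace.Core ℝ V) : (coreBilin ip).Nondegenerate :=
  ⟨fun m h => ip.definite m (h m), fun m h => ip.definite m (h m)⟩

/-- A linear function is represented by a vector of `S` if and only if it vanishes on `Sᗮ`. -/
lemma exists_represents_iff [FiniteDimensional ℝ V] (ip : InnerProductSpace.Core ℝ V)
    (S : Submodule ℝ V) (ℓ : V →ₗ[ℝ] ℝ) :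
    (∃ m ∈ S, Represents ip m ℓ) ↔ ∀ u ∈ orthCompl ip S, ℓ u = 0 := by
  constructor
  · rintro ⟨m, hm, h⟩ u hu
    rw [← h u, hu m hm]
  · intro h
    have hrep (v : V) :
        coreBilin ip (((coreBilin ip).toDual (coreBilin_nondegenerate ip)).symm ℓ) v = ℓ v :=
      LinearMap.BilinForm.apply_toDual_symm_apply (hB := coreBilin_nondegenerate ip) ℓ v
    refine ⟨_, ?_, hrep⟩
    -- In finite dimension `S = Sᗮᗮ`, and the dual vector of `ℓ` is orthogonal to everything on
    -- which `ℓ` vanishes.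
    rw [← LinearMap.BilinForm.orthogonal_orthogonal (coreBilin_nondegenerate ip)
      (fun m n hmn => (coreBilin_comm ip n m).trans hmn) S]
    intro n hn
    change coreBilin ip n _ = 0
    rw [coreBilin_comm, hrep]
    exact h n fun v hv => hn v hv

end LinearAlgebra

/-- A function on a finite-dimensional space whose radial derivatives increase and are eventually
positive has a critical point. -/
lemma exists_critical_point {V : Type*} [NormedAddCommGroup V] [NormedSpace ℝ V]
    [FiniteDimensional ℝ V] (W : Submodule ℝ V) {f : V → ℝ} {L : V → V →L[ℝ] ℝ}
    (hf : ∀ v, HasFDerivAt f (L v) v) (hL : Continuous L)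
    (hmono : ∀ u, Monotone fun s : ℝ => L (s • u) u)
    (hpos : ∀ u ∈ W, u ≠ 0 → ∃ s : ℝ, 0 < L (s • u) u) : ∃ v, ∀ u ∈ W, L v u = 0 := by
  have : ProperSpace V := FiniteDimensional.proper ℝ V
  have hWc : IsClosed (W : Set V) := W.closed_of_finiteDimensional
  have hf' (v u : V) (s : ℝ) : HasDerivAt (fun s : ℝ => f (v + s • u)) (L (v + s • u) u) s := by
    have h1 : HasDerivAt (fun s : ℝ => v + s • u) u s := by
      simpa using ((hasDerivAt_id s).smul_const u).const_add v
    exact (hf (v + s • u)).comp_hasDerivAt s h1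
  -- Radial derivatives are monotone, so the open sets of directions with positive slope at radius
  -- `n` increase with `n`. By compactness one `n` works for the whole unit sphere of `W`.
  obtain ⟨n, hn⟩ := ((isCompact_sphere (0 : V) 1).inter_right hWc).elim_directed_cover
    (fun n : ℕ => {u | 0 < L ((n : ℝ) • u) u})
    (fun n => isOpen_lt continuous_const
      ((hL.comp (continuous_const.smul continuous_id)).clm_apply continuous_id))
    (by
      rintro u ⟨hu, huW⟩
      obtain ⟨s, hs⟩ := hpos u huW fun h => by simp [h] at hu
      obtain ⟨n, hn⟩ := exists_nat_ge s
      exact mem_iUnion.mpr ⟨n, hs.trans_le (hmono u hn)⟩)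
    (directed_of_isDirected_le fun a b hab u (hu : 0 < _) =>
      hu.trans_le (hmono u (Nat.cast_le.mpr hab)))
  have hn0 : (0 : ℝ) < n + 1 := by positivity
  have hfc : Continuous f := continuous_iff_continuousAt.mpr fun v => (hf v).continuousAt
  obtain ⟨v, ⟨hvb, hvW⟩, hv⟩ := ((isCompact_closedBall (0 : V) (n + 1)).inter_right
    hWc).exists_isMinOn ⟨0, by simpa using hn0.le, W.zero_mem⟩ hfc.continuousOn
  -- A minimiser on the boundary is impossible: by the mean value theorem `f` increases strictly
  -- along each ray between radius `n` and radius `n + 1`.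
  have hv1 : ‖v‖ < n + 1 := by
    refine lt_of_le_of_ne (mem_closedBall_zero_iff.mp hvb) fun hvn => ?_
    set u := ((n : ℝ) + 1)⁻¹ • v with hu
    have huv : ((n : ℝ) + 1) • u = v := smul_inv_smul₀ hn0.ne' v
    have hu1 : ‖u‖ = 1 := by
      rw [hu, norm_smul, norm_inv, Real.norm_of_nonneg hn0.le, hvn, inv_mul_cancel₀ hn0.ne']
    have huW : u ∈ W := W.smul_mem _ hvW
    obtain ⟨c, hc, hce⟩ := exists_hasDerivAt_eq_slope (fun s : ℝ => f (0 + s • u))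
      (fun s => L (0 + s • u) u) (lt_add_one (n : ℝ))
      (fun s _ => (hf' 0 u s).continuousAt.continuousWithinAt) (fun s _ => hf' 0 u s)
    have h1 : 0 < L (c • u) u :=
      lt_of_lt_of_le (hn ⟨mem_sphere_zero_iff_norm.mpr hu1, huW⟩) (hmono u hc.1.le)
    have h2 : f v ≤ f ((n : ℝ) • u) := hv ⟨by
      rw [mem_closedBall_zero_iff, norm_smul, hu1, mul_one, Real.norm_of_nonneg n.cast_nonneg]
      exact (lt_add_one _).le, W.smul_mem _ huW⟩
    simp only [zero_add, huv, add_sub_cancel_left, div_one] at hce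
    linarith
  refine ⟨v, fun u hu => ?_⟩
  have hmin : IsLocalMin (fun s : ℝ => f (v + s • u)) 0 := by
    have h1 : ∀ᶠ s : ℝ in 𝓝 0, ‖v + s • u‖ < n + 1 :=
      ContinuousAt.eventually_lt (by fun_prop) continuousAt_const (by simpa using hv1)
    filter_upwards [h1] with s hs
    simpa using hv ⟨mem_closedBall_zero_iff.mpr hs.le, W.add_mem hvW (W.smul_mem s hu)⟩
  simpa using hmin.hasDerivAt_eq_zero (hf' v u 0)

/-! ### Zeros of the perturbed moment map and positivity at specialisations -/

section Stability

variable {E X : Type*} [NormedAddCommGroup E] [NormedSpace ℂ E] [FiniteDimensional ℂ E]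
    [TopologicalSpace X] [ChartedSpace E X] [IsManifold 𝓘(ℂ, E) ω X]
    {r : ℕ} [MulAction (Fin r → ℂˣ) X] {g : KahlerMetric E X}
    {μ : X → Module.Dual ℝ (Fin r → ℝ)}

lemma isSpecialisation_iff (u : Fin r → ℝ) (p q : X) :
    IsSpecialisation u p q ↔ Tendsto (fun s : ℝ => expT (s • -realIncl u) • p) atTop (𝓝 q) := by
  have h (s : ℝ) : s • (Complex.I • lieIncl u) = s • -realIncl u := by
    rw [smul_I_lieIncl, Complex.coe_smul, neg_smul, smul_neg]
  simp only [IsSpecialisation, h]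

/-- The inclusion `ℝ^r → ℂ^r` as a continuous linear map. -/
def realInclL (r : ℕ) : (Fin r → ℝ) →L[ℝ] (Fin r → ℂ) :=
  LinearMap.toContinuousLinearMap
    { toFun := realIncl
      map_add' := realIncl_add
      map_smul' := fun c u => by rw [realIncl_smul, Complex.coe_smul]; rfl }

lemma realInclL_apply (u : Fin r → ℝ) : realInclL r u = realIncl u := rfl

variable (E) in
/-- The Lie algebra of the stabiliser as a subspace. -/
def stabSubmodule (r : ℕ) [MulAction (Fin r → ℂˣ) X] (x : X) : Submodule ℝ (Fin r → ℝ) :=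
  (((infl E x).restrictScalars ℝ).comp (realInclL r)).ker

omit [FiniteDimensional ℂ E] [IsManifold 𝓘(ℂ, E) ω X] in
lemma infl_expT_smul_eq_zero_iff (hact : IsHolomorphicAction r E X) (ζ v : Fin r → ℂ) (x : X) :
    infl E (expT ζ • x) v = 0 ↔ infl E x v = 0 := by
  refine ⟨fun h => ?_, fun h => by rw [← hact.tang_infl, h, map_zero]⟩
  have h1 := hact.tang_infl (-ζ) (expT ζ • x) v
  rwa [h, map_zero, smul_smul, ← expT_add, neg_add_cancel, expT_zero, one_smul, eq_comm] at h1

variable (g μ) in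
/-- The perturbed moment map `a μ + b Δμ`. -/
def perturbedMoment (a b : ℝ) (x : X) (u : Fin r → ℝ) : ℝ :=
  a * μ x u + b * g.laplacian (fun x => μ x u) x

/-- The perturbed moment map along an orbit as a linear form on `𝔱`. -/
def momentForm (g : KahlerMetric E X) (μ : X → Module.Dual ℝ (Fin r → ℝ)) (a b : ℝ) (p : X)
    (v : Fin r → ℝ) : (Fin r → ℝ) →L[ℝ] ℝ :=
  a • LinearMap.toContinuousLinearMap (μ (expT (-realIncl v) • p))
    + (b * (1 / 2)) • (fderiv ℝ (logVol g p) (-realIncl v)).comp (realInclL r)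

/-- Linearity in `u` is built into `momentForm` through the derivative of `logVol`; this transfers
it to the perturbed moment map. -/
lemma momentForm_apply (hact : IsHolomorphicAction r E X) (hμ : IsMomentMap g μ) (a b : ℝ) (p : X)
    (v u : Fin r → ℝ) :
    momentForm g μ a b p v u = perturbedMoment g μ a b (expT (-realIncl v) • p) u := by
  rw [perturbedMoment, laplacian_orbit hact hμ, ← mul_assoc]
  rfl

lemma perturbedMoment_continuous (hact : IsHolomorphicAction r E X) (hμ : IsMomentMap g μ)
    (a b : ℝ) (u : Fin r → ℝ) : Continuous fun x => perturbedMoment g μ a b x u :=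
  (continuous_const.mul (hμ.smooth u).continuous).add
    (continuous_const.mul (continuous_laplacian hact hμ u))

lemma hasDerivAt_perturbedMoment (hact : IsHolomorphicAction r E X) (hμ : IsMomentMap g μ)
    (a b : ℝ) (u : Fin r → ℝ) (p : X) (s : ℝ) :
    HasDerivAt (fun s : ℝ => perturbedMoment g μ a b (expT (s • -realIncl u) • p) u)
      (a * g.bilin (expT (s • -realIncl u) • p) (infl E (expT (s • -realIncl u) • p) (realIncl u))
          (infl E (expT (s • -realIncl u) • p) (realIncl u))
        - b / 2 * fderiv ℝ (fderiv ℝ (logVol g (expT (s • -realIncl u) • p))) 0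
          (realIncl u) (realIncl u)) s := by
  simp only [perturbedMoment, laplacian_orbit hact hμ]
  have h1 : HasDerivAt (fun s : ℝ => s • -realIncl u) (-realIncl u) s := by
    simpa using (hasDerivAt_id s).smul_const (-realIncl u)
  have h2 : HasFDerivAt (fderiv ℝ (logVol g p : (Fin r → ℂ) → ℝ))
      (fderiv ℝ (fderiv ℝ (logVol g p)) (s • -realIncl u)) (s • -realIncl u) :=
    (((contDiff_logVol hact p).fderiv_right (m := ∞) (by simp)).differentiable
      (by simp) _).hasFDerivAt
  have h3 := (HasFDerivAt.comp_hasDerivAt (E := (Fin r → ℂ) →L[ℝ] ℝ) s h2 h1).clm_apply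
    (hasDerivAt_const s (realIncl u))
  refine (((hμ.hasDerivAt_flow hact u p s).const_mul a).add
    ((h3.const_mul (1 / 2)).const_mul b)).congr_deriv ?_
  rw [fderiv_fderiv_logVol_orbit hact]
  simp
  ring

/-- The perturbed moment map increases along gradient flows. -/
lemma le_deriv_perturbedMoment {K a b : ℝ} (hbK : |b| * K ≤ a) {p : X} {u : Fin r → ℝ}
    (hK : |fderiv ℝ (fderiv ℝ (logVol g p)) 0 (realIncl u) (realIncl u)|
        ≤ K * g.bilin p (infl E p (realIncl u)) (infl E p (realIncl u))) :
    a / 2 * g.bilin p (infl E p (realIncl u)) (infl E p (realIncl u))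
      ≤ a * g.bilin p (infl E p (realIncl u)) (infl E p (realIncl u))
        - b / 2 * fderiv ℝ (fderiv ℝ (logVol g p)) 0 (realIncl u) (realIncl u) := by
  set β := g.bilin p (infl E p (realIncl u)) (infl E p (realIncl u)) with hβ
  set D := fderiv ℝ (fderiv ℝ (logVol g p)) 0 (realIncl u) (realIncl u)
  have h1 : b * D ≤ |b| * (K * β) :=
    (le_abs_self _).trans ((abs_mul b D).le.trans (mul_le_mul_of_nonneg_left hK (abs_nonneg b)))
  have h2 : |b| * K * β ≤ a * β := mul_le_mul_of_nonneg_right hbK (g.bilin_nonneg _ _)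
  linarith

/-- The perturbed moment map along an orbit of the imaginary torus is the differential of a
function. -/
lemma exists_potential (hact : IsHolomorphicAction r E X) (hμ : IsMomentMap g μ) (a b : ℝ)
    (p : X) : ∃ f : (Fin r → ℝ) → ℝ, ∀ v, HasFDerivAt f (momentForm g μ a b p v) v := by
  have hneg (v : Fin r → ℝ) :
      HasFDerivAt (fun v : Fin r → ℝ => -realIncl v) (-(realInclL r)) v :=
    (realInclL r).hasFDerivAt.neg
  have hd (u v : Fin r → ℝ) : HasFDerivAt (fun v => μ (expT (-realIncl v) • p) u)
      ((-((g.bilin (expT (-realIncl v) • p) (infl E (expT (-realIncl v) • p) (realIncl u))).comp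
        ((infl E (expT (-realIncl v) • p)).restrictScalars ℝ))).comp (-(realInclL r))) v :=
    HasFDerivAt.comp (g := fun ζ : Fin r → ℂ => μ (expT ζ • p) u) v
      (hμ.hasFDerivAt_orbit hact u p (-realIncl v)) (hneg v)
  set η : (Fin r → ℝ) → (Fin r → ℝ) →L[ℝ] ℝ := fun v =>
    LinearMap.toContinuousLinearMap (μ (expT (-realIncl v) • p)) with hη
  have hηd : Differentiable ℝ η := by
    have h1 : η = fun v => ∑ j, μ (expT (-realIncl v) • p) (Pi.single j 1) •
        (ContinuousLinearMap.proj j : (Fin r → ℝ) →L[ℝ] ℝ) := by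
      funext v
      ext u
      have h2 := congrArg (μ (expT (-realIncl v) • p)) (pi_eq_sum_univ' u)
      simp only [map_sum, map_smul] at h2
      simp [hη, h2, mul_comm, Pi.single]
    rw [h1]
    exact Differentiable.fun_sum fun j _ => fun v =>
      ((hd (Pi.single j 1) v).differentiableAt).smul_const _
  -- The derivative is the metric on two fundamental fields, hence symmetric in `u` and `w`. The
  -- one-form given by `μ` is therefore closed on a vector space, hence exact; the Laplacian part is
  -- already a differential of `logVol`.
  have hηf (v w u : Fin r → ℝ) : fderiv ℝ η v w u
      = g.bilin (expT (-realIncl v) • p) (infl E (expT (-realIncl v) • p) (realIncl u))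
        (infl E (expT (-realIncl v) • p) (realIncl w)) := by
    have h1 := (hηd v).hasFDerivAt.clm_apply (hasFDerivAt_const u v)
    have h2 := congrArg (fun A : (Fin r → ℝ) →L[ℝ] ℝ => A w) (h1.unique (hd u v))
    simpa [realInclL_apply] using h2
  obtain ⟨Φ, hΦ⟩ := convex_univ.exists_forall_hasFDerivAt_of_fderiv_symmetric (𝕜 := ℝ)
    isOpen_univ hηd.differentiableOn (fun v _ w u => by
      rw [hηf, hηf, g.bilin_symm])
  refine ⟨fun v => a * Φ v + -(b * (1 / 2)) * logVol g p (-realIncl v), fun v => ?_⟩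
  have h1 : HasFDerivAt (logVol g p) (fderiv ℝ (logVol g p) (-realIncl v)) (-realIncl v) :=
    ((contDiff_logVol hact p).differentiable (by simp) _).hasFDerivAt
  refine (((hΦ v (mem_univ v)).const_mul a).add
    ((HasFDerivAt.comp (g := logVol g p) v h1 (hneg v)).const_mul
      (-(b * (1 / 2))))).congr_fderiv ?_
  ext u
  simp [momentForm, hη]

lemma continuous_momentForm (hact : IsHolomorphicAction r E X) (hμ : IsMomentMap g μ) (a b : ℝ)
    (p : X) : Continuous (momentForm g μ a b p) := by
  refine continuous_clm_apply.mpr fun u => ?_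
  simp only [momentForm_apply hact hμ]
  refine (perturbedMoment_continuous hact hμ a b u).comp ?_
  exact hact.continuous.comp (f := fun v : Fin r → ℝ => (-realIncl v, p))
    ((realInclL r).continuous.neg.prodMk continuous_const)

variable [T2Space X]

omit [FiniteDimensional ℂ E] in
lemma coe_stabSubmodule (hact : IsHolomorphicAction r E X) (x : X) :
    (stabSubmodule E r x : Set (Fin r → ℝ)) = stabLie r x :=
  Set.ext fun _ => hact.mem_stabLie_iff.symm

omit [FiniteDimensional ℂ E] in
lemma stabLie_expT_smul (hact : IsHolomorphicAction r E X) (ζ : Fin r → ℂ) (x : X) :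
    stabLie r (expT ζ • x) = stabLie r x :=
  Set.ext fun _ => by
    rw [hact.mem_stabLie_iff, hact.mem_stabLie_iff, infl_expT_smul_eq_zero_iff hact]

/-- On the orbit of a point fixed by the subgroup of `u`, the `u`-component is constant. -/
lemma perturbedMoment_expT_smul (hact : IsHolomorphicAction r E X) (hμ : IsMomentMap g μ)
    (a b : ℝ) {u : Fin r → ℝ} {q : X} (hq : infl E q (realIncl u) = 0) (ζ : Fin r → ℂ) :
    perturbedMoment g μ a b (expT ζ • q) u = perturbedMoment g μ a b q u := by
  have h1 : μ (expT ζ • q) u = μ q u := by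
    have hd (η : Fin r → ℂ) : HasFDerivAt (fun η : Fin r → ℂ => μ (expT η • q) u)
        (0 : (Fin r → ℂ) →L[ℝ] ℝ) η :=
      (hμ.hasFDerivAt_orbit hact u q η).congr_fderiv <| by
        rw [(infl_expT_smul_eq_zero_iff hact η _ q).mpr hq, map_zero]
        simp
    have := is_const_of_fderiv_eq_zero (𝕜 := ℝ) (f := fun η : Fin r → ℂ => μ (expT η • q) u)
      (fun η => (hd η).differentiableAt)
      (fun η => (hd η).fderiv) ζ 0
    simpa using this
  have hdir (η : Fin r → ℂ) : HasDerivAt (fun s : ℝ => logVol g q (η + s • realIncl u))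
      (fderiv ℝ (logVol g q) η (realIncl u)) 0 := by
    have h1 : HasDerivAt (fun s : ℝ => η + s • realIncl u) (realIncl u) 0 := by
      simpa using ((hasDerivAt_id (0 : ℝ)).smul_const (realIncl u)).const_add η
    have h2 : HasFDerivAt (logVol g q) (fderiv ℝ (logVol g q) η) (η + (0 : ℝ) • realIncl u) := by
      rw [zero_smul, add_zero]
      exact ((contDiff_logVol hact q).differentiable (by simp) η).hasFDerivAt
    exact h2.comp_hasDerivAt 0 h1
  -- Since `q` is fixed in the direction `u`, the cocycle term depends on `s` but not on `η`. So the
  -- derivative of the volume in direction `u` is the same at `ζ` and at `0`.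
  have hshift (η : Fin r → ℂ) (s : ℝ) : logVol g q (η + s • realIncl u)
      = logVol g q η + 2 * Real.log ‖LinearMap.det (tang E (s • realIncl u) q).toLinearMap‖ := by
    have h3 : expT (s • realIncl u) • q = q := by
      simpa using hact.expT_smul_eq_of_infl_eq_zero hq (s : ℂ)
    rw [logVol_add hact, h3]
  have h2 : fderiv ℝ (logVol g q) ζ (realIncl u) = fderiv ℝ (logVol g q) 0 (realIncl u) := by
    have h3 : (fun s : ℝ => logVol g q (ζ + s • realIncl u)) = fun s : ℝ =>
        logVol g q (0 + s • realIncl u) + (logVol g q ζ - logVol g q (0 : Fin r → ℂ)) := by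
      funext s
      rw [hshift, hshift]
      ring
    have h4 := hdir ζ
    rw [h3] at h4
    exact h4.unique ((hdir 0).add_const _)
  have h3 := laplacian_orbit hact hμ u q 0
  rw [expT_zero, one_smul] at h3
  rw [perturbedMoment, perturbedMoment, h1, laplacian_orbit hact hμ u q ζ, h2, h3]

variable [CompactSpace X]

/-- The criterion for a zero of the perturbed moment map on an orbit. -/
theorem exists_zero_iff (hact : IsHolomorphicAction r E X) (hμ : IsMomentMap g μ)
    {K : ℝ} (hK : ∀ (p : X) (u : Fin r → ℝ),
      |fderiv ℝ (fderiv ℝ (logVol g p)) 0 (realIncl u) (realIncl u)|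
        ≤ K * g.bilin p (infl E p (realIncl u)) (infl E p (realIncl u)))
    {a b : ℝ} (ha : 0 < a) (hbK : |b| * K ≤ a) (p : X) (W : Submodule ℝ (Fin r → ℝ))
    (hW : ∀ u ∈ W, u ≠ 0 → u ∉ stabLie r p) :
    (∃ ζ : Fin r → ℂ, ∀ u ∈ W, perturbedMoment g μ a b (expT ζ • p) u = 0) ↔
      ∀ u ∈ W, u ≠ 0 → ∃ q, IsSpecialisation u p q ∧ 0 < perturbedMoment g μ a b q u := by
  have hmono (u : Fin r → ℝ) (y : X) :
      Monotone fun s : ℝ => perturbedMoment g μ a b (expT (s • -realIncl u) • y) u :=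
    monotone_of_hasDerivAt_nonneg (hasDerivAt_perturbedMoment hact hμ a b u y) fun s =>
      (mul_nonneg (half_pos ha).le (g.bilin_nonneg _ _)).trans
        (le_deriv_perturbedMoment hbK (hK _ u))
  constructor
  · rintro ⟨ζ, hζ⟩ u hu hu0
    obtain ⟨q, hq⟩ := hμ.exists_isSpecialisation hact u p
    refine ⟨q, hq, ?_⟩
    rw [isSpecialisation_iff] at hq
    -- The gradient of `H_u` vanishes nowhere on the orbit because `u` is not in the stabiliser
    -- algebra of `p`.
    have hstrict : StrictMono fun s : ℝ =>
        perturbedMoment g μ a b (expT (s • -realIncl u) • expT ζ • p) u := by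
      refine strictMono_of_hasDerivAt_pos
        (hasDerivAt_perturbedMoment hact hμ a b u (expT ζ • p)) fun s => ?_
      refine (mul_pos (half_pos ha) (g.bilin_pos _ ?_)).trans_le
        (le_deriv_perturbedMoment hbK (hK _ u))
      rw [Ne, infl_expT_smul_eq_zero_iff hact, infl_expT_smul_eq_zero_iff hact,
        ← hact.mem_stabLie_iff]
      exact hW u hu hu0
    -- By commutativity the flow from `expT ζ • p` tends to `expT ζ • q`, where the `u`-component
    -- has the same value as at `q`.
    have hlim : Tendsto (fun s : ℝ =>
        perturbedMoment g μ a b (expT (s • -realIncl u) • expT ζ • p) u) atTop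
        (𝓝 (perturbedMoment g μ a b (expT ζ • q) u)) := by
      have h1 : Continuous fun x : X => perturbedMoment g μ a b (expT ζ • x) u :=
        (perturbedMoment_continuous hact hμ a b u).comp (hact.contMDiff_smul ζ).continuous
      refine ((h1.tendsto q).comp hq).congr fun s => ?_
      simp only [Function.comp_apply, smul_smul, mul_comm]
    rw [← perturbedMoment_expT_smul hact hμ a b
      (hμ.infl_eq_zero_of_tendsto hact tendsto_id hq) ζ]
    calc (0 : ℝ) = perturbedMoment g μ a b (expT ((0 : ℝ) • -realIncl u) • expT ζ • p) u := by
          rw [zero_smul, expT_zero, one_smul, hζ u hu]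
      _ < perturbedMoment g μ a b (expT ((1 : ℝ) • -realIncl u) • expT ζ • p) u :=
          hstrict one_pos
      _ ≤ _ := hstrict.monotone.ge_of_tendsto hlim 1
  · intro h
    obtain ⟨f, hf⟩ := exists_potential hact hμ a b p
    have hline (u : Fin r → ℝ) (s : ℝ) : momentForm g μ a b p (s • u) u
        = perturbedMoment g μ a b (expT (s • -realIncl u) • p) u := by
      rw [momentForm_apply hact hμ, realIncl_smul, Complex.coe_smul, smul_neg]
    -- The radial derivative of the potential is the perturbed moment map along the gradient flow:
    -- it increases, and its positive limit at `q` forces a positive value at a finite time.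
    obtain ⟨v, hv⟩ := exists_critical_point W hf (continuous_momentForm hact hμ a b p)
      (fun u => by simpa only [hline] using hmono u p)
      (fun u hu hu0 => by
        obtain ⟨q, hq, hpos⟩ := h u hu hu0
        rw [isSpecialisation_iff] at hq
        have h1 := ((perturbedMoment_continuous hact hμ a b u).tendsto q).comp hq
        obtain ⟨s, hs⟩ := (h1.eventually_const_lt hpos).exists
        exact ⟨s, by rw [hline]; exact hs⟩)
    exact ⟨-realIncl v, fun u hu => by rw [← momentForm_apply hact hμ, hv u hu]⟩

end Stability

end

end KempfNess

/-! ### The main theorem -/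

theorem mainTheorem6
    {E X : Type*} [NormedAddCommGroup E] [NormedSpace ℂ E] [FiniteDimensional ℂ E]
    [TopologicalSpace X] [T2Space X] [CompactSpace X] [ChartedSpace E X]
    [IsManifold 𝓘(ℂ, E) ω X]
    (r : ℕ) [MulAction (Fin r → ℂˣ) X] (hact : KempfNess.IsHolomorphicAction r E X)
    (g : KempfNess.KahlerMetric E X) (hg : g.IsInvariant r)
    (μ : X → Module.Dual ℝ (Fin r → ℝ)) (hμ : KempfNess.IsMomentMap g μ)
    (A B : ℝ → ℝ) (hA : ∀ᶠ ε in 𝓝[>] (0 : ℝ), 0 < A ε) (hB : B =o[𝓝[>] (0 : ℝ)] A)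
    (ip : ℝ → InnerProductSpace.Core ℝ (Fin r → ℝ)) (p : X) :
    ∀ᶠ ε in 𝓝[>] (0 : ℝ),
      ((∃ pε ∈ MulAction.orbit (Fin r → ℂˣ) p, ∃ m ∈ KempfNess.stabLie r pε,
        KempfNess.Represents (ip ε) m
          (fun v => A ε * μ pε v + B ε * g.laplacian (fun x => μ x v) pε)) ↔
      ∀ u ∈ KempfNess.orthCompl (ip ε) (KempfNess.stabLie r p), u ≠ 0 →
        ∃ q : X, KempfNess.IsSpecialisation u p q ∧
          0 < A ε * μ q u + B ε * g.laplacian (fun x => μ x u) q) := by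
  open KempfNess in
  obtain ⟨K, hK0, hK⟩ := exists_bound hact hg
  have hK1 : 0 < K + 1 := by positivity
  -- `K + 1` rather than `K` allows for `K = 0`. The bound depends neither on `p` nor on the inner
  -- products, so the latter may vary with `ε`.
  filter_upwards [hA, hB.def (inv_pos.mpr hK1)] with ε ha hb
  have hbK : |B ε| * K ≤ A ε := by
    rw [Real.norm_eq_abs, Real.norm_of_nonneg ha.le, inv_mul_eq_div, le_div_iff₀ hK1] at hb
    linarith [abs_nonneg (B ε)]
  let W : Submodule ℝ (Fin r → ℝ) :=
    (coreBilin (ip ε)).orthogonal (stabSubmodule E r p)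
  have hWmem (u : Fin r → ℝ) : u ∈ W ↔ u ∈ orthCompl (ip ε) (stabLie r p) := by
    rw [← coe_stabSubmodule (E := E) hact]
    exact Iff.rfl
  -- A vector in both the stabiliser algebra and its orthogonal complement is orthogonal to itself,
  -- hence zero.
  have key := exists_zero_iff hact hμ hK ha hbK p W fun u hu hu0 hs =>
    hu0 ((ip ε).definite u ((hWmem u).mp hu u hs))
  simp only [hWmem, perturbedMoment] at key
  rw [← key]
  have hrep (ζ : Fin r → ℂ) : (∃ m ∈ stabLie r (expT ζ • p), Represents (ip ε) m
      (fun v => A ε * μ (expT ζ • p) v + B ε * g.laplacian (fun x => μ x v) (expT ζ • p))) ↔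
      ∀ u ∈ orthCompl (ip ε) (stabLie r p),
        A ε * μ (expT ζ • p) u + B ε * g.laplacian (fun x => μ x u) (expT ζ • p) = 0 := by
    -- With `expT ζ • p` as base point and `v = 0`, `momentForm` presents the perturbed moment map
    -- at that point as a linear form, to which the duality lemma applies.
    have h1 : (momentForm g μ (A ε) (B ε) (expT ζ • p) 0 : (Fin r → ℝ) → ℝ) = fun v =>
        A ε * μ (expT ζ • p) v + B ε * g.laplacian (fun x => μ x v) (expT ζ • p) := by
      funext v
      have h2 : -realIncl (0 : Fin r → ℝ) = 0 := by
        rw [← realInclL_apply, map_zero, neg_zero]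
      rw [momentForm_apply hact hμ, h2, expT_zero, one_smul, perturbedMoment]
    have h3 := exists_represents_iff (ip ε) (stabSubmodule E r (expT ζ • p))
      (momentForm g μ (A ε) (B ε) (expT ζ • p) 0).toLinearMap
    simp only [← SetLike.mem_coe, coe_stabSubmodule hact, ContinuousLinearMap.coe_coe, h1,
      stabLie_expT_smul hact] at h3
    rw [stabLie_expT_smul hact, h3]
  constructor
  · rintro ⟨_, ⟨t, rfl⟩, h⟩
    obtain ⟨ζ, rfl⟩ := expT_surjective t
    exact ⟨ζ, (hrep ζ).mp h⟩
  · rintro ⟨ζ, h⟩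
    exact ⟨expT ζ • p, ⟨_, rfl⟩, (hrep ζ).mpr h⟩
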